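/- Let $n\ge 2$ and let $X\subset\mathbb R^n$ be a nonempty bounded convex open set with $C^1$ boundary, outward unit normal $\nu$ and surface measure $\mu$. Let $\Gamma_-=\{(x,v)\in\partial X\times\mathbb S^{n-1}: v\cdot\nu(x)<0\}$ and $d\xi=|v\cdot\nu(x)|\,d\mu(x)\,dv$. Fix constants $M$ and $\sigma_0,\delta_0>0$. A pair of measurable coefficients $(\sigma(x,v),k(x,v',v))$ is called admissible if, almost everywhere in $X$, $0\le\sigma\le M$, $0\le k\le M$ and $\sigma_a\ge\sigma_0$, where $$\sigma_a(x,v)=\sigma(x,v)-\int_{\mathbb S^{n-1}}k(x,v,v')\,dv'.$$ For every admissible $(\sigma,k)$ there is exactly one bounded operator $A:L^1(\Gamma_-,d\xi)\to L^1(X)$ (the albedo operator) such that, for every $\phi\in L^1(\Gamma_-,d\xi)$, $$A\phi(x)=\int_{\mathbb S^{n-1}}\sigma_a(x,v)u(x,v)\,dv$$ for a solution $u\in L^1(X\times\mathbb S^{n-1})$ of $$v\cdot\nabla_xu+\sigma(x,v)u-\int_{\mathbb S^{n-1}}k(x,v',v)u(x,v')\,dv'=0\ \text{ in }X\times\mathbb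 S^{n-1},\qquad u=\phi\ \text{ on }\Gamma_-.$$ Here the equation and the boundary condition are understood along almost every characteristic: for $\xi$-a.e. $(x',v')\in\Gamma_-$ the function $t\mapsto u(x'+tv',v')$ agrees a.e., up to the exit time from $X$, with an absolutely continuous function that equals $\phi(x',v')$ at $t=0$ and satisfies the equation for a.e. $t$. Now let $(\sigma,k)$ and $(\tilde\sigma,\tilde k)$ be admissible, with albedo operators $A$ and $\tilde A$. Assume that $\sigma_a,\sigma,\tilde\sigma_a,\tilde\sigma$ are invariant under $v\mapsto-v$ and that $\sigma(x,v)=\tilde\sigma(x,v)$ for a.e. $(x,v)\in X\times\mathbb S^{n-1}$ with $\mathrm{dist}(x,\partial X)<\delta_0$. 1. (Uniqueness) If $A=\tilde A$, then $\sigma_a=\tilde\sigma_a$ and $\sigma=\tilde\sigma$ a.e. in $X\times\mathbb S^{n-1}$. 2. (Stability) There is a constant $C>0$, depending only on $X$ (hence $n$), $\delta_0$, $\sigma_0$ and $M$, such that for all such pairs $$\|\sigma-\tilde\sigma\|_{L^\infty(\mathbb S^{n-1};W^{-1,1}(X))}+\|\sigma_a-\tilde\sigma_a\|_{L^\infty(\mathbb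 S^{n-1};L^1(X))}\le C\,\|A-\tilde A\|_{\mathcal L(L^1(\Gamma_-,d\xi);L^1(X))}.$$ Here $W^{-1,1}(X)$ carries the norm dual to $\|\varphi\|_{L^\infty(X)}+\|\nabla\varphi\|_{L^\infty(X)}$ on $W^{1,\infty}_0(X)=\{\varphi\in L^\infty(X):\mathrm{supp}\,\varphi\subset X,\ \nabla\varphi\in L^\infty(X)\}$ (distributional gradient), and a function $f$ is identified with the functional $\varphi\mapsto\int_Xf\varphi\,dx$. -/

import Mathlib

open MeasureTheory Set Metric Topology
open scoped ENNReal RealInnerProductSpace ContDiff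

noncomputable section

namespace Photoacoustics

/-- The Euclidean space `ℝⁿ`. -/
abbrev Space (n : ℕ) : Type := EuclideanSpace ℝ (Fin n)

/-- The sphere of directions `S^{n-1}`. -/
abbrev Dir (n : ℕ) : Type := sphere (0 : Space n) 1

/-- The surface measure `dv` on `S^{n-1}`. -/
def dirMeasure (n : ℕ) : Measure (Dir n) := (volume : Measure (Space n)).toSphere

instance (n : ℕ) : IsFiniteMeasure (dirMeasure n) := by
  unfold dirMeasure; infer_instance

/-- Lebesgue measure `dx` on `X`. -/
def spaceMeasure {n : ℕ} (X : Set (Space n)) : Measure (Space n) := volume.restrict X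

/-- The measure `dx dv` on `X × S^{n-1}`. -/
def phaseMeasure {n : ℕ} (X : Set (Space n)) : Measure (Space n × Dir n) :=
  (spaceMeasure X).prod (dirMeasure n)

/-! ### The domain and its boundary -/

/-- `f` is a `C¹` function near the boundary point `x`, with nonvanishing gradient at `x`, such that
`X` coincides with `{f < 0}` near `x`. -/
structure IsLocalDefiningFunction {n : ℕ} (X : Set (Space n)) (x : Space n) (f : Space n → ℝ) :
    Prop where
  contDiffAt : ContDiffAt ℝ 1 f x
  map_eq_zero : f x = 0
  gradient_ne_zero : gradient f x ≠ 0
  mem_iff : ∀ᶠ y in 𝓝 x, (y ∈ X ↔ f y < 0)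

/-- The open set `X` has a `C¹` boundary. -/
def HasC1Boundary {n : ℕ} (X : Set (Space n)) : Prop :=
  ∀ x ∈ frontier X, ∃ f, IsLocalDefiningFunction X x f

/-- `w` is the outward unit normal to `X` at the boundary point `x`. -/
def IsOuterNormal {n : ℕ} (X : Set (Space n)) (x w : Space n) : Prop :=
  ∃ f, IsLocalDefiningFunction X x f ∧ w = ‖gradient f x‖⁻¹ • gradient f x

open Classical in
/-- The outward unit normal `ν(x)` at `x ∈ ∂X` (zero where there is none, in particular
off the boundary). -/
def outerNormal {n : ℕ} (X : Set (Space n)) (x : Space n) : Space n :=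
  if h : ∃ w, x ∈ frontier X ∧ IsOuterNormal X x w then h.choose else 0

/-- The incoming boundary `Γ_- = {(x, v) ∈ ∂X × S^{n-1} : v · ν(x) < 0}`. -/
def incoming {n : ℕ} (X : Set (Space n)) : Set (Space n × Dir n) :=
  {p | p.1 ∈ frontier X ∧ ⟪(p.2 : Space n), outerNormal X p.1⟫ < 0}

/-- The surface measure `dμ` of `∂X`. -/
def boundaryMeasure {n : ℕ} (X : Set (Space n)) : Measure (Space n) :=
  (μHE[n - 1] : Measure (Space n)).restrict (frontier X)

/-- The measure `dξ = |v · ν(x)| dμ(x) dv` on `Γ_-`, as a measure on `ℝⁿ × S^{n-1}`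
carried by `Γ_-`. -/
def incomingMeasure {n : ℕ} (X : Set (Space n)) : Measure (Space n × Dir n) :=
  (((boundaryMeasure X).prod (dirMeasure n)).restrict (incoming X)).withDensity
    fun p => ENNReal.ofReal |⟪(p.2 : Space n), outerNormal X p.1⟫|

/-- The escape time `τ_+(x, v)` from `X` of a particle starting at `x` with velocity `v`; the
infimum is over positive times, so that it is the right quantity on `Γ_-` as well. -/
def exitTime {n : ℕ} (X : Set (Space n)) (x : Space n) (v : Dir n) : ℝ :=
  sInf {s : ℝ | 0 < s ∧ x + s • (v : Space n) ∉ X}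

/-! ### Optical coefficients -/

/-- A pair of optical coefficients: the total attenuation `σ(x, v)` and the scattering coefficient
`k(x, v', v)` (from direction `v'` into direction `v`). Only their values for `x ∈ X` matter. -/
structure Coeffs (n : ℕ) where
  sigma : Space n → Dir n → ℝ
  k : Space n → Dir n → Dir n → ℝ

/-- `σ_s(x, v) = ∫ k(x, v, v') dv'`. -/
def Coeffs.sigmaS {n : ℕ} (c : Coeffs n) (x : Space n) (v : Dir n) : ℝ :=
  ∫ v', c.k x v v' ∂(dirMeasure n)

/-- The intrinsic attenuation `σ_a = σ - σ_s`. -/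
def Coeffs.sigmaA {n : ℕ} (c : Coeffs n) (x : Space n) (v : Dir n) : ℝ :=
  c.sigma x v - c.sigmaS x v

/-- The standing assumptions: `σ` and `k` are measurable, nonnegative and bounded by `M`, and
`σ_a ≥ σ₀`, almost everywhere in `X`. -/
structure Coeffs.Admissible {n : ℕ} (X : Set (Space n)) (M σ₀ : ℝ) (c : Coeffs n) : Prop where
  measurable_sigma : Measurable fun p : Space n × Dir n => c.sigma p.1 p.2
  measurable_k : Measurable fun p : Space n × Dir n × Dir n => c.k p.1 p.2.1 p.2.2
  sigma_mem : ∀ᵐ p ∂(phaseMeasure X), c.sigma p.1 p.2 ∈ Icc 0 M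
  k_mem : ∀ᵐ p ∂((spaceMeasure X).prod ((dirMeasure n).prod (dirMeasure n))),
    c.k p.1 p.2.1 p.2.2 ∈ Icc 0 M
  le_sigmaA : ∀ᵐ p ∂(phaseMeasure X), σ₀ ≤ c.sigmaA p.1 p.2

/-- `σ_a(x, v) = σ_a(x, -v)` and `σ(x, v) = σ(x, -v)` almost everywhere in `X × S^{n-1}`. -/
structure Coeffs.Symmetric {n : ℕ} (X : Set (Space n)) (c : Coeffs n) : Prop where
  sigmaA_neg : ∀ᵐ p ∂(phaseMeasure X), c.sigmaA p.1 p.2 = c.sigmaA p.1 (-p.2)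
  sigma_neg : ∀ᵐ p ∂(phaseMeasure X), c.sigma p.1 p.2 = c.sigma p.1 (-p.2)

/-- The total attenuations of `c` and `c'` coincide in the part of `X` at distance less than `δ₀`
from `∂X`. -/
def AgreeNearBoundary {n : ℕ} (X : Set (Space n)) (δ₀ : ℝ) (c c' : Coeffs n) : Prop :=
  ∀ᵐ p ∂(phaseMeasure X), infDist p.1 (frontier X) < δ₀ → c.sigma p.1 p.2 = c'.sigma p.1 p.2

/-! ### The transport equation and the albedo operator -/

/-- `u` solves `v · ∇ₓu + σ u - ∫ k(x, v', v) u(x, v') dv' = 0` in `X × S^{n-1}`, `u = φ` on `Γ_-`.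
Here `v · ∇ₓ` is the derivative along the characteristics `t ↦ (x' + t v', v')`,
`(x', v') ∈ Γ_-`, `0 < t < τ_+(x', v')`: along almost every one of them, `u` coincides almost
everywhere with an absolutely continuous function `w` that starts from `φ(x', v')` and satisfies the
equation at almost every time. -/
def IsTransportSolution {n : ℕ} (X : Set (Space n)) (c : Coeffs n)
    (φ u : Space n × Dir n → ℝ) : Prop :=
  ∀ᵐ p ∂(incomingMeasure X), ∃ w : ℝ → ℝ,
    AbsolutelyContinuousOnInterval w 0 (exitTime X p.1 p.2) ∧ w 0 = φ p ∧
    ∀ᵐ t : ℝ, t ∈ Ioo 0 (exitTime X p.1 p.2) →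
      u (p.1 + t • (p.2 : Space n), p.2) = w t ∧
      HasDerivAt w
        (-(c.sigma (p.1 + t • (p.2 : Space n)) p.2 * u (p.1 + t • (p.2 : Space n), p.2))
          + ∫ v', c.k (p.1 + t • (p.2 : Space n)) v' p.2 * u (p.1 + t • (p.2 : Space n), v')
              ∂(dirMeasure n)) t

/-- `L¹(Γ_-, dξ)`. -/
abbrev L1In {n : ℕ} (X : Set (Space n)) := Lp ℝ 1 (incomingMeasure X)

/-- `L¹(X)`. -/
abbrev L1Space {n : ℕ} (X : Set (Space n)) := Lp ℝ 1 (spaceMeasure X)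

/-- `L¹(X × S^{n-1})`. -/
abbrev L1Phase {n : ℕ} (X : Set (Space n)) := Lp ℝ 1 (phaseMeasure X)

/-- `A` is the albedo operator of `c`: it maps the boundary radiation `φ ∈ L¹(Γ_-, dξ)` to the
deposited energy `H(x) = ∫ σ_a(x, v) u(x, v) dv`, where `u ∈ L¹(X × S^{n-1})` is the solution of the
transport equation with boundary condition `φ`. -/
def IsAlbedoOperator {n : ℕ} (X : Set (Space n)) (c : Coeffs n)
    (A : L1In X →L[ℝ] L1Space X) : Prop :=
  ∀ φ : L1In X, ∃ u : L1Phase X, IsTransportSolution X c φ u ∧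
    ∀ᵐ x ∂(spaceMeasure X), A φ x = ∫ v, c.sigmaA x v * u (x, v) ∂(dirMeasure n)

/-! ### Norms -/

/-- `φ ∈ W_0^{1,∞}(X)` with distributional gradient `G`: `φ` and `G` are essentially bounded,
`supp φ ⊂ X`, and `∇φ = G` in the sense of distributions on `X`. -/
structure IsW01Infty {n : ℕ} (X : Set (Space n)) (φ : Space n → ℝ) (G : Space n → Space n) :
    Prop where
  memLp : MemLp φ ∞ (spaceMeasure X)
  tsupport_subset : tsupport φ ⊆ X
  memLp_grad : MemLp G ∞ (spaceMeasure X)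
  integral_eq : ∀ ψ : Space n → ℝ, ContDiff ℝ ∞ ψ → HasCompactSupport ψ → tsupport ψ ⊆ X →
    ∀ e : Space n, ∫ x in X, φ x * fderiv ℝ ψ x e = -∫ x in X, ⟪G x, e⟫ * ψ x

/-- The `W^{-1,1}(X)` norm of a function `f`, identified with the functional `φ ↦ ∫_X f φ`
on `W_0^{1,∞}(X)`, the latter with the norm `‖φ‖_∞ + ‖∇φ‖_∞`. -/
def negSobolevNorm {n : ℕ} (X : Set (Space n)) (f : Space n → ℝ) : ℝ≥0∞ :=
  ⨆ (φ : Space n → ℝ) (G : Space n → Space n) (_ : IsW01Infty X φ G)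
    (_ : eLpNorm φ ∞ (spaceMeasure X) + eLpNorm G ∞ (spaceMeasure X) ≤ 1),
    ‖∫ x in X, f x * φ x‖ₑ

/-- The norm of `g` in `L^∞(S^{n-1}; W^{-1,1}(X))`. -/
def normLinftyNegSobolev {n : ℕ} (X : Set (Space n)) (g : Space n → Dir n → ℝ) : ℝ≥0∞ :=
  essSup (fun v => negSobolevNorm X fun x => g x v) (dirMeasure n)

/-- The norm of `g` in `L^∞(S^{n-1}; L¹(X))`. -/
def normLinftyL1 {n : ℕ} (X : Set (Space n)) (g : Space n → Dir n → ℝ) : ℝ≥0∞ :=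
  essSup (fun v => ∫⁻ x in X, ‖g x v‖ₑ) (dirMeasure n)

end Photoacoustics

end

/-!
The transport equation is an ordinary differential equation along each characteristic, so it is
equivalent to the integral equation `u = J φ + T K u`, where `J` transports the boundary radiation
without scattering, `T` solves the equation with an interior source, and `K` is the scattering
operator. Absorption makes `K T` a contraction on `L¹`: the total attenuation absorbs at most the
source, `∫ σ T|q| ≤ ∫ |q|`, and `σ_s = σ - σ_a ≤ (1 - σ₀ / max M σ₀) σ`. Hence the equation is
uniquely solvable (`exists_solutionOp`) and the albedo operator exists and is unique. All of this
rests on the change of variables `dx dv = dξ dt` between phase space and the characteristics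
(`lintegral_phaseMeasure`). Locally this compares the boundary with its tangent hyperplane by a
projection along `v` that is bi-Lipschitz with a constant close to `1`.

The albedo operator is the sum of a ballistic part, coming from `J`, and a scattered part, coming
from `T K u`. The scattered radiation has a direction integral in it, hence is equi-integrable in
space: by polar coordinates a small set is seen from any point under few directions and times.
Radiation that enters near one point of `Γ_-` runs, as long as it is ballistic, in a thin tube
around a segment, which is a small set because `n ≥ 2`. Testing `A - A'` on such radiation with
functions supported in the tube therefore isolates the ballistic parts. With
`E(x, v) = exp (-∫_0^∞ σ(x - s v, v) ds)` this yields, on almost every characteristic,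
`∫ |σ_a E - σ_a' E'| dt ≤ ‖A - A'‖` (`ae_lintegral_ballisticDensity_sub_le`).

On a chord, let `D(t)` be the integral of `σ` up to the parameter `t` and `S` the integral over the
whole chord. By the symmetry in `v`, the characteristic run through backwards gives the same
estimate with `S - D` in place of `D`. The quotient of the two ballistic absorptions
`σ_a exp (-D)` and `σ_a exp (-(S - D))` gives the imbalance `S - 2 D`, their product gives
`σ_a² exp (-S)`. Near the boundary `σ = σ'`, so that the difference of the imbalances there
is the constant `S - S'`, which is thereby controlled, and so is `σ_a` (`line_stability`). The
derivative of the imbalance is `-2 σ`; this gives uniqueness of `σ` and, by integration by parts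
along the direction `v` against mollified test functions, the estimate of `σ` in `W^{-1,1}`
(`negSobolevNorm_sigma_sub_le`). A bound on almost every characteristic is a bound for almost every
direction, at the cost of a factor `μ(∂X)` (`ae_dir_lintegral_le`).
-/

noncomputable section

namespace Photoacoustics

/-! ### Normals and chords of a convex domain with `C¹` boundary -/

/-- The standing assumptions on the domain `X`. -/
structure IsConvexDomain {n : ℕ} (X : Set (Space n)) : Prop where
  isOpen : IsOpen X
  nonempty : X.Nonempty
  isBounded : Bornology.IsBounded X
  convex : Convex ℝ X
  hasC1Boundary : HasC1Boundary X

section Normals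

variable {n : ℕ} {X : Set (Space n)}

theorem norm_dir (v : Dir n) : ‖(v : Space n)‖ = 1 := by simp

theorem IsLocalDefiningFunction.hasGradientAt {x : Space n} {f : Space n → ℝ}
    (hf : IsLocalDefiningFunction X x f) : HasGradientAt f (gradient f x) x :=
  (hf.contDiffAt.differentiableAt one_ne_zero).hasGradientAt

theorem IsLocalDefiningFunction.tendsto_slope {x : Space n} {f : Space n → ℝ}
    (hf : IsLocalDefiningFunction X x f) (e : Space n) :
    Filter.Tendsto (fun t : ℝ => t⁻¹ * f (x + t • e)) (𝓝[>] 0) (𝓝 ⟪gradient f x, e⟫) := by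
  have h1 : HasDerivAt (fun t : ℝ => x + t • e) e 0 := by
    simpa using ((hasDerivAt_id (0 : ℝ)).smul_const e).const_add x
  have h2 : HasFDerivAt f ((InnerProductSpace.toDual ℝ _) (gradient f x)) (x + (0 : ℝ) • e) := by
    simpa using hf.hasGradientAt.hasFDerivAt
  have h3 := h2.comp_hasDerivAt (0 : ℝ) h1
  rw [hasDerivAt_iff_tendsto_slope_zero] at h3
  have h4 := h3.mono_left (nhdsWithin_mono _ (fun t ht => (ne_of_gt ht : t ≠ 0)) :
    𝓝[>] (0 : ℝ) ≤ 𝓝[≠] 0)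
  simpa [hf.map_eq_zero] using h4

theorem IsLocalDefiningFunction.tendsto_line (x e : Space n) :
    Filter.Tendsto (fun t : ℝ => x + t • e) (𝓝[>] 0) (𝓝 x) := by
  have : Continuous fun t : ℝ => x + t • e := by fun_prop
  have h := this.tendsto 0
  simp only [zero_smul, add_zero] at h
  exact h.mono_left nhdsWithin_le_nhds

theorem IsLocalDefiningFunction.eventually_mem {x e : Space n} {f : Space n → ℝ}
    (hf : IsLocalDefiningFunction X x f) (he : ⟪gradient f x, e⟫ < 0) :
    ∀ᶠ t : ℝ in 𝓝[>] 0, x + t • e ∈ X := by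
  filter_upwards [(hf.tendsto_slope e).eventually (gt_mem_nhds he),
    (tendsto_line x e).eventually hf.mem_iff, self_mem_nhdsWithin] with t h1 h2 h3
  rw [h2]
  have h3 : 0 < t := h3
  by_contra h
  exact absurd h1 (not_lt.2 (mul_nonneg (inv_nonneg.2 h3.le) (not_lt.1 h)))

theorem IsLocalDefiningFunction.eventually_notMem {x e : Space n} {f : Space n → ℝ}
    (hf : IsLocalDefiningFunction X x f) (he : 0 < ⟪gradient f x, e⟫) :
    ∀ᶠ t : ℝ in 𝓝[>] 0, x + t • e ∉ X := by
  filter_upwards [(hf.tendsto_slope e).eventually (lt_mem_nhds he),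
    (tendsto_line x e).eventually hf.mem_iff, self_mem_nhdsWithin] with t h1 h2 h3
  rw [h2]
  have h3 : 0 < t := h3
  intro h
  exact absurd h1 (not_lt.2 (mul_nonpos_of_nonneg_of_nonpos (inv_nonneg.2 h3.le) h.le))

/-- Two defining functions at the same point have the same normalized gradient: otherwise some
direction points into `X` for one of them and out of `X` for the other. -/
theorem IsOuterNormal.unique {x w w' : Space n} (h : IsOuterNormal X x w)
    (h' : IsOuterNormal X x w') : w = w' := by
  obtain ⟨f, hf, rfl⟩ := h
  obtain ⟨g, hg, rfl⟩ := h'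
  set a := ‖gradient f x‖⁻¹ • gradient f x with ha
  set b := ‖gradient g x‖⁻¹ • gradient g x with hb
  have hfp : 0 < ‖gradient f x‖ := norm_pos_iff.2 hf.gradient_ne_zero
  have hgp : 0 < ‖gradient g x‖ := norm_pos_iff.2 hg.gradient_ne_zero
  have na : ‖a‖ = 1 := by rw [ha, norm_smul, norm_inv, norm_norm, inv_mul_cancel₀ hfp.ne']
  have nb : ‖b‖ = 1 := by rw [hb, norm_smul, norm_inv, norm_norm, inv_mul_cancel₀ hgp.ne']
  by_contra hne
  have hlt : ⟪a, b⟫ < 1 := (inner_lt_one_iff_real_of_norm_eq_one na nb).2 hne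
  have e1 : ⟪a, b - a⟫ < 0 := by
    rw [inner_sub_right, real_inner_self_eq_norm_sq, na]; linarith
  have e2 : 0 < ⟪b, b - a⟫ := by
    rw [inner_sub_right, real_inner_self_eq_norm_sq, nb, real_inner_comm]; linarith
  rw [ha, real_inner_smul_left] at e1
  rw [hb, real_inner_smul_left] at e2
  have e1' : ⟪gradient f x, b - a⟫ < 0 := by
    by_contra h
    exact absurd e1 (not_lt.2 (mul_nonneg (inv_nonneg.2 hfp.le) (not_lt.1 h)))
  have e2' : 0 < ⟪gradient g x, b - a⟫ := by
    by_contra h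
    exact absurd e2 (not_lt.2 (mul_nonpos_of_nonneg_of_nonpos (inv_nonneg.2 hgp.le) (not_lt.1 h)))
  obtain ⟨t, h1, h2⟩ := ((hf.eventually_mem e1').and (hg.eventually_notMem e2')).exists
  exact h2 h1

theorem outerNormal_eq {x w : Space n} (hx : x ∈ frontier X) (h : IsOuterNormal X x w) :
    outerNormal X x = w := by
  have hex : ∃ w, x ∈ frontier X ∧ IsOuterNormal X x w := ⟨w, hx, h⟩
  rw [outerNormal, dif_pos hex]
  exact hex.choose_spec.2.unique h

theorem IsLocalDefiningFunction.outerNormal_eq {x : Space n} {f : Space n → ℝ}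
    (hx : x ∈ frontier X) (hf : IsLocalDefiningFunction X x f) :
    outerNormal X x = ‖gradient f x‖⁻¹ • gradient f x :=
  Photoacoustics.outerNormal_eq hx ⟨f, hf, rfl⟩

theorem IsLocalDefiningFunction.gradient_eq {x : Space n} {f : Space n → ℝ}
    (hx : x ∈ frontier X) (hf : IsLocalDefiningFunction X x f) :
    gradient f x = ‖gradient f x‖ • outerNormal X x := by
  rw [hf.outerNormal_eq hx, smul_smul, mul_inv_cancel₀ (norm_ne_zero_iff.2 hf.gradient_ne_zero),
    one_smul]

theorem IsConvexDomain.norm_outerNormal (hX : IsConvexDomain X) {x : Space n}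
    (hx : x ∈ frontier X) : ‖outerNormal X x‖ = 1 := by
  obtain ⟨f, hf⟩ := hX.hasC1Boundary x hx
  have hfp : 0 < ‖gradient f x‖ := norm_pos_iff.2 hf.gradient_ne_zero
  rw [hf.outerNormal_eq hx, norm_smul, norm_inv, norm_norm, inv_mul_cancel₀ hfp.ne']

/-- A defining function at a boundary point vanishes on the nearby boundary. -/
theorem IsLocalDefiningFunction.eventually_eq_zero (hX : IsOpen X) {x : Space n} {f : Space n → ℝ}
    (hf : IsLocalDefiningFunction X x f) : ∀ᶠ y in 𝓝 x, y ∈ frontier X → f y = 0 := by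
  filter_upwards [hf.mem_iff.eventually_nhds,
    hf.contDiffAt.eventually (by simp)] with y hy hc hyX
  rw [hX.frontier_eq] at hyX
  have h1 : 0 ≤ f y := not_lt.1 fun h => hyX.2 (hy.self_of_nhds.2 h)
  refine le_antisymm ?_ h1
  by_contra h
  have h2 : ∀ᶠ z in 𝓝 y, 0 < f z := hc.continuousAt.eventually (lt_mem_nhds (not_le.1 h))
  obtain ⟨z, hz, hz'⟩ := (mem_closure_iff_frequently.1 hyX.1).and_eventually (h2.and hy) |>.exists
  exact absurd (hz'.2.1 hz) (not_lt.2 hz'.1.le)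

theorem IsLocalDefiningFunction.continuousAt_gradient {x : Space n} {f : Space n → ℝ}
    (hf : IsLocalDefiningFunction X x f) : ContinuousAt (gradient f) x :=
  (LinearIsometryEquiv.continuous _).continuousAt.comp
    (hf.contDiffAt.continuousAt_fderiv one_ne_zero)

theorem IsLocalDefiningFunction.eventually_isLocalDefiningFunction (hX : IsOpen X) {x : Space n}
    {f : Space n → ℝ} (hf : IsLocalDefiningFunction X x f) :
    ∀ᶠ y in 𝓝 x, y ∈ frontier X → IsLocalDefiningFunction X y f := by
  filter_upwards [hf.eventually_eq_zero hX, hf.contDiffAt.eventually (by simp),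
    hf.mem_iff.eventually_nhds,
    hf.continuousAt_gradient.eventually_ne hf.gradient_ne_zero] with y h1 h2 h3 h4 hy
  exact ⟨h2, h1 hy, h4, h3⟩

theorem IsConvexDomain.continuousOn_outerNormal (hX : IsConvexDomain X) :
    ContinuousOn (outerNormal X) (frontier X) := by
  intro x hx
  obtain ⟨f, hf⟩ := hX.hasC1Boundary x hx
  have h1 : ContinuousAt (fun y => ‖gradient f y‖⁻¹ • gradient f y) x :=
    (hf.continuousAt_gradient.norm.inv₀ (norm_ne_zero_iff.2 hf.gradient_ne_zero)).smul
      hf.continuousAt_gradient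
  refine h1.continuousWithinAt.congr_of_eventuallyEq ?_ (hf.outerNormal_eq hx)
  have h2 := hf.eventually_isLocalDefiningFunction hX.isOpen
  filter_upwards [h2.filter_mono nhdsWithin_le_nhds, self_mem_nhdsWithin] with y hy hyX
  exact (hy hyX).outerNormal_eq hyX

theorem IsConvexDomain.eventually_mem (hX : IsConvexDomain X) {x e : Space n}
    (hx : x ∈ frontier X) (he : ⟪outerNormal X x, e⟫ < 0) :
    ∀ᶠ t : ℝ in 𝓝[>] 0, x + t • e ∈ X := by
  obtain ⟨f, hf⟩ := hX.hasC1Boundary x hx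
  refine hf.eventually_mem ?_
  rw [hf.gradient_eq hx, real_inner_smul_left]
  exact mul_neg_of_pos_of_neg (norm_pos_iff.2 hf.gradient_ne_zero) he

theorem IsConvexDomain.add_smul_sub_mem (hX : IsConvexDomain X) {x y : Space n}
    (hx : x ∈ closure X) (hy : y ∈ X) {t : ℝ} (ht : 0 < t) (ht1 : t ≤ 1) :
    x + t • (y - x) ∈ X := by
  have := hX.convex.add_smul_sub_mem_interior' hx (by rwa [hX.isOpen.interior_eq])
    (show t ∈ Ioc (0:ℝ) 1 from ⟨ht, ht1⟩)
  rwa [hX.isOpen.interior_eq] at this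

/-- The tangent hyperplane at a boundary point strictly supports the open convex set `X`. -/
theorem IsConvexDomain.inner_outerNormal_neg (hX : IsConvexDomain X) {x y : Space n}
    (hx : x ∈ frontier X) (hy : y ∈ X) : ⟪outerNormal X x, y - x⟫ < 0 := by
  have key : ∀ z ∈ X, ⟪outerNormal X x, z - x⟫ ≤ 0 := by
    intro z hz
    by_contra h
    obtain ⟨f, hf⟩ := hX.hasC1Boundary x hx
    have h' : 0 < ⟪gradient f x, z - x⟫ := by
      rw [hf.gradient_eq hx, real_inner_smul_left]
      exact mul_pos (norm_pos_iff.2 hf.gradient_ne_zero) (not_le.1 h)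
    have h1 : ∀ᶠ t : ℝ in 𝓝[>] 0, t ≤ 1 :=
      nhdsWithin_le_nhds (Iic_mem_nhds one_pos)
    obtain ⟨t, ⟨ht1, ht2⟩, ht0⟩ :=
      (((hf.eventually_notMem h').and h1).and self_mem_nhdsWithin).exists
    exact ht1 (hX.add_smul_sub_mem (frontier_subset_closure hx) hz ht0 ht2)
  have hcont : ContinuousAt (fun t : ℝ => y + t • outerNormal X x) 0 := by fun_prop
  have hev : ∀ᶠ t : ℝ in 𝓝 0, y + t • outerNormal X x ∈ X :=
    hcont.eventually (by simpa using hX.isOpen.mem_nhds hy)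
  obtain ⟨t, ht, ht0⟩ :=
    ((hev.filter_mono (nhdsWithin_le_nhds (s := Ioi 0))).and self_mem_nhdsWithin).exists
  have := key _ ht
  rw [add_sub_right_comm, inner_add_right, real_inner_smul_right, real_inner_self_eq_norm_sq,
    hX.norm_outerNormal hx] at this
  have ht0 : 0 < t := ht0
  linarith

end Normals

section Chords

variable {n : ℕ} {X : Set (Space n)}

theorem IsConvexDomain.exists_diam_bound (hX : IsConvexDomain X) :
    ∃ d : ℝ, 0 < d ∧ ∀ x ∈ closure X, ∀ y ∈ closure X, dist x y ≤ d := by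
  refine ⟨diam (closure X) + 1, by positivity, fun x hx y hy => ?_⟩
  have := dist_le_diam_of_mem hX.isBounded.closure hx hy
  linarith

/-- If the half line from `x` in the direction `v` starts inside `X`, then it stays in `X` exactly
up to the exit time. -/
theorem IsConvexDomain.exitTime_spec (hX : IsConvexDomain X) {x : Space n} {v : Dir n}
    (h : ∀ᶠ t : ℝ in 𝓝[>] 0, x + t • (v : Space n) ∈ X) :
    0 < exitTime X x v ∧ (∀ s : ℝ, 0 < s → (x + s • (v : Space n) ∈ X ↔ s < exitTime X x v)) ∧
      x + exitTime X x v • (v : Space n) ∈ frontier X := by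
  set S := {s : ℝ | 0 < s ∧ x + s • (v : Space n) ∉ X} with hS
  have hcont : Continuous fun t : ℝ => x + t • (v : Space n) := by fun_prop
  obtain ⟨ε, hε, hεX⟩ : ∃ ε : ℝ, 0 < ε ∧ ∀ s ∈ Ioo (0 : ℝ) ε, x + s • (v : Space n) ∈ X := by
    obtain ⟨ε, hε, h⟩ := (mem_nhdsGT_iff_exists_Ioo_subset).1 h
    exact ⟨ε, hε, fun s hs => h hs⟩
  -- membership propagates backwards along the half line
  have hback : ∀ s r : ℝ, 0 < r → r ≤ s → x + s • (v : Space n) ∈ X →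
      x + r • (v : Space n) ∈ X := by
    intro s r hr hrs hs
    set q := min (ε / 2) r
    have hq0 : 0 < q := lt_min (half_pos hε) hr
    have hq : x + q • (v : Space n) ∈ X :=
      hεX q ⟨hq0, (min_le_left _ _).trans_lt (half_lt_self hε)⟩
    have hqr : q ≤ r := min_le_right _ _
    have := (hX.convex.segment_subset hq hs)
    apply this
    rcases eq_or_lt_of_le (hqr.trans hrs) with h0 | h0
    · have : r = q := le_antisymm (h0 ▸ hrs) hqr
      rw [this]; exact left_mem_segment _ _ _
    · rw [segment_eq_image']
      refine ⟨(r - q) / (s - q), ⟨div_nonneg (by linarith) (by linarith),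
        (div_le_one (by linarith)).2 (by linarith)⟩, ?_⟩
      have hsq : s - q ≠ 0 := by linarith
      simp only
      rw [add_sub_add_left_eq_sub, ← sub_smul, smul_smul, div_mul_cancel₀ _ hsq, add_assoc,
        ← add_smul]
      congr 2; ring
  have hne : S.Nonempty := by
    obtain ⟨d, hd, hdX⟩ := hX.exists_diam_bound
    refine ⟨d + 1 + ε, by positivity, fun hmem => ?_⟩
    have h1 := hεX (ε / 2) ⟨half_pos hε, half_lt_self hε⟩
    have h2 := hdX _ (subset_closure hmem) _ (subset_closure h1)
    rw [dist_add_left, dist_eq_norm, ← sub_smul, norm_smul, norm_dir, mul_one,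
      Real.norm_of_nonneg (by linarith)] at h2
    linarith
  have hbdd : BddBelow S := ⟨0, fun s hs => hs.1.le⟩
  have hτ : exitTime X x v = sInf S := rfl
  have hετ : ε ≤ sInf S := by
    refine le_csInf hne fun s hs => ?_
    by_contra hlt
    exact hs.2 (hεX s ⟨hs.1, not_le.1 hlt⟩)
  have hpos : 0 < sInf S := hε.trans_le hετ
  have hbelow : ∀ s, 0 < s → s < sInf S → x + s • (v : Space n) ∈ X := by
    intro s hs hs'
    by_contra hmem
    exact absurd (csInf_le hbdd (show s ∈ S from ⟨hs, hmem⟩)) (not_le.2 hs')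
  have hτX : x + sInf S • (v : Space n) ∉ X := by
    intro hmem
    have hev : ∀ᶠ t in 𝓝 (sInf S), x + t • (v : Space n) ∈ X :=
      hcont.continuousAt.eventually (hX.isOpen.mem_nhds hmem)
    obtain ⟨η, hη, hηX⟩ := Metric.eventually_nhds_iff.1 hev
    have : sInf S + η / 2 ≤ sInf S := by
      refine le_csInf hne fun s hs => ?_
      by_contra hlt
      refine hs.2 (hback (sInf S + η / 2) s hs.1 (not_le.1 hlt).le (hηX ?_))
      rw [Real.dist_eq, add_sub_cancel_left, abs_of_pos (half_pos hη)]
      exact half_lt_self hη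
    linarith
  refine ⟨hτ ▸ hpos, fun s hs => ⟨fun hmem => ?_, fun hlt => hbelow s hs (hτ ▸ hlt)⟩, ?_⟩
  · rw [hτ]
    by_contra hge
    exact hτX (hback s _ hpos (not_lt.1 hge) hmem)
  · rw [hτ, hX.isOpen.frontier_eq]
    refine ⟨?_, hτX⟩
    have h1 : Filter.Tendsto (fun t : ℝ => x + t • (v : Space n)) (𝓝[<] (sInf S))
        (𝓝 (x + sInf S • (v : Space n))) := (hcont.tendsto _).mono_left nhdsWithin_le_nhds
    refine mem_closure_of_tendsto h1 ?_
    filter_upwards [self_mem_nhdsWithin,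
      nhdsWithin_le_nhds (Ioi_mem_nhds hpos)] with t ht ht0
    exact hbelow t ht0 ht

theorem IsConvexDomain.eventually_mem_of_mem (hX : IsConvexDomain X) {x : Space n} (hx : x ∈ X)
    (e : Space n) : ∀ᶠ t : ℝ in 𝓝[>] 0, x + t • e ∈ X :=
  (IsLocalDefiningFunction.tendsto_line x e).eventually (hX.isOpen.mem_nhds hx)

theorem IsConvexDomain.eventually_mem_of_incoming (hX : IsConvexDomain X) {x : Space n}
    {v : Dir n} (hp : (x, v) ∈ incoming X) : ∀ᶠ t : ℝ in 𝓝[>] 0, x + t • (v : Space n) ∈ X :=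
  hX.eventually_mem hp.1 (by rw [real_inner_comm]; exact hp.2)

theorem IsConvexDomain.mem_iff_of_incoming (hX : IsConvexDomain X) {x : Space n}
    {v : Dir n} (hp : (x, v) ∈ incoming X) (s : ℝ) :
    x + s • (v : Space n) ∈ X ↔ s ∈ Ioo 0 (exitTime X x v) := by
  rcases lt_or_ge 0 s with hs | hs
  · rw [(hX.exitTime_spec (hX.eventually_mem_of_incoming hp)).2.1 s hs]
    simp [hs]
  · refine ⟨fun h => ?_, fun h => absurd h.1 (not_lt.2 hs)⟩
    have h1 := hX.inner_outerNormal_neg hp.1 h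
    rw [add_sub_cancel_left, real_inner_smul_right, real_inner_comm] at h1
    exact absurd h1 (not_lt.2 (mul_nonneg_of_nonpos_of_nonpos hs hp.2.le))

theorem IsConvexDomain.exitTime_pos (hX : IsConvexDomain X) {x : Space n}
    {v : Dir n} (hp : (x, v) ∈ incoming X) : 0 < exitTime X x v :=
  (hX.exitTime_spec (hX.eventually_mem_of_incoming hp)).1

/-- The length of the part of the half line from `x` in the direction `v` inside `X`. -/
def chordLength (X : Set (Space n)) (x : Space n) (v : Dir n) : ℝ :=
  (volume {s : ℝ | 0 < s ∧ x + s • (v : Space n) ∈ X}).toReal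

/-- The point where the line through `x` with direction `v` enters `X`, for `x ∈ X`. -/
def entryPoint (X : Set (Space n)) (x : Space n) (v : Dir n) : Space n :=
  x - chordLength X x (-v) • (v : Space n)

theorem IsConvexDomain.chordLength_eq (hX : IsConvexDomain X) {x : Space n} {v : Dir n}
    (h : ∀ᶠ t : ℝ in 𝓝[>] 0, x + t • (v : Space n) ∈ X) :
    chordLength X x v = exitTime X x v := by
  obtain ⟨h0, h1, -⟩ := hX.exitTime_spec h
  have : {s : ℝ | 0 < s ∧ x + s • (v : Space n) ∈ X} = Ioo 0 (exitTime X x v) := by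
    ext s
    exact and_congr_right fun hs => h1 s hs
  rw [chordLength, this, Real.volume_Ioo, sub_zero, ENNReal.toReal_ofReal h0.le]

theorem measurable_chordLength (hX : IsOpen X) :
    Measurable fun p : Space n × Dir n => chordLength X p.1 p.2 := by
  have h : MeasurableSet {q : (Space n × Dir n) × ℝ | 0 < q.2 ∧
      q.1.1 + q.2 • (q.1.2 : Space n) ∈ X} := by
    have hc : Continuous fun q : (Space n × Dir n) × ℝ => q.1.1 + q.2 • (q.1.2 : Space n) := by
      fun_prop
    exact ((isOpen_lt continuous_const continuous_snd).inter
      (hX.preimage hc)).measurableSet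
  exact (measurable_measure_prodMk_left (ν := volume) h).ennreal_toReal

theorem continuous_dir_neg : Continuous fun v : Dir n => -v :=
  Continuous.subtype_mk (continuous_neg.comp continuous_subtype_val) _

theorem measurable_dir_neg : Measurable fun v : Dir n => -v := continuous_dir_neg.measurable

theorem measurable_entryPoint (hX : IsOpen X) :
    Measurable fun p : Space n × Dir n => entryPoint X p.1 p.2 := by
  have h0 : Measurable fun p : Space n × Dir n => (p.1, -p.2) :=
    measurable_fst.prodMk (measurable_dir_neg.comp measurable_snd)
  have h1 := (measurable_chordLength hX).comp h0
  simp only [Function.comp_def] at h1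
  have h2 : Measurable fun p : Space n × Dir n => (p.2 : Space n) :=
    measurable_subtype_coe.comp measurable_snd
  have h3 : Measurable fun p : Space n × Dir n => chordLength X p.1 (-p.2) • (p.2 : Space n) :=
    h1.smul h2
  unfold entryPoint
  exact measurable_fst.sub h3

theorem IsConvexDomain.entryPoint_mem (hX : IsConvexDomain X) {x : Space n} (hx : x ∈ X)
    (v : Dir n) : (entryPoint X x v, v) ∈ incoming X := by
  have hev := hX.eventually_mem_of_mem hx ((-v : Dir n) : Space n)
  obtain ⟨h0, -, h2⟩ := hX.exitTime_spec hev
  have he : entryPoint X x v = x + exitTime X x (-v) • ((-v : Dir n) : Space n) := by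
    rw [entryPoint, hX.chordLength_eq hev, coe_neg_sphere, smul_neg, sub_eq_add_neg]
  have hfr : entryPoint X x v ∈ frontier X := he ▸ h2
  refine ⟨hfr, ?_⟩
  have h3 := hX.inner_outerNormal_neg hfr hx
  have h4 : x - entryPoint X x v = exitTime X x (-v) • (v : Space n) := by
    rw [he, coe_neg_sphere, smul_neg]; abel
  rw [h4, real_inner_smul_right, real_inner_comm] at h3
  by_contra hge
  exact absurd h3 (not_lt.2 (mul_nonneg h0.le (not_lt.1 hge)))

theorem entryPoint_add (x : Space n) (v : Dir n) :
    entryPoint X x v + chordLength X x (-v) • (v : Space n) = x := by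
  rw [entryPoint, sub_add_cancel]

theorem IsConvexDomain.chordLength_neg_of_incoming (hX : IsConvexDomain X) {x : Space n}
    {v : Dir n} (hp : (x, v) ∈ incoming X) {t : ℝ} (ht : t ∈ Ioo 0 (exitTime X x v)) :
    chordLength X (x + t • (v : Space n)) (-v) = t := by
  have : {s : ℝ | 0 < s ∧ x + t • (v : Space n) + s • ((-v : Dir n) : Space n) ∈ X} = Ioo 0 t := by
    ext s
    have : x + t • (v : Space n) + s • ((-v : Dir n) : Space n) = x + (t - s) • (v : Space n) := by
      rw [coe_neg_sphere, smul_neg, sub_smul]; abel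
    simp only [mem_ofPred_eq, this, hX.mem_iff_of_incoming hp, mem_Ioo]
    constructor
    · rintro ⟨h1, h2, -⟩; exact ⟨h1, by linarith⟩
    · rintro ⟨h1, h2⟩; exact ⟨h1, by linarith, by linarith [ht.2]⟩
  rw [chordLength, this, Real.volume_Ioo, sub_zero, ENNReal.toReal_ofReal ht.1.le]

theorem IsConvexDomain.entryPoint_of_incoming (hX : IsConvexDomain X) {x : Space n}
    {v : Dir n} (hp : (x, v) ∈ incoming X) {t : ℝ} (ht : t ∈ Ioo 0 (exitTime X x v)) :
    entryPoint X (x + t • (v : Space n)) v = x := by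
  rw [entryPoint, hX.chordLength_neg_of_incoming hp ht, add_sub_cancel_right]

theorem IsConvexDomain.exitTime_le (hX : IsConvexDomain X) {d : ℝ}
    (hd : ∀ x ∈ closure X, ∀ y ∈ closure X, dist x y ≤ d) {x : Space n}
    {v : Dir n} (hp : (x, v) ∈ incoming X) : exitTime X x v ≤ d := by
  obtain ⟨h0, -, h2⟩ := hX.exitTime_spec (hX.eventually_mem_of_incoming hp)
  have := hd _ (frontier_subset_closure h2) _ (frontier_subset_closure hp.1)
  rwa [dist_eq_norm, add_sub_cancel_left, norm_smul, norm_dir, mul_one,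
    Real.norm_of_nonneg h0.le] at this

end Chords

/-! ### Fubini's theorem along oblique lines -/

section Oblique

variable {n : ℕ}

theorem lintegral_eq_orthogonal_line {u : Space n} (hu : ‖u‖ = 1) {f : Space n → ℝ≥0∞}
    (hf : Measurable f) :
    ∫⁻ x, f x = ∫⁻ t : ℝ, ∫⁻ b : (ℝ ∙ u)ᗮ, f (t • u + b) := by
  have h1 := (LinearIsometryEquiv.measurePreserving
    (ℝ ∙ u).orthogonalDecomposition.symm).comp (WithLp.volume_preserving_toLp (ℝ ∙ u) (ℝ ∙ u)ᗮ)
  have h2 := h1.lintegral_comp hf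
  have h3 := (LinearIsometryEquiv.measurePreserving
    (LinearIsometryEquiv.toSpanUnitSingleton (𝕜 := ℝ) u hu))
  have h4 : ∀ z : (ℝ ∙ u) × (ℝ ∙ u)ᗮ,
      (((ℝ ∙ u).orthogonalDecomposition.symm) ∘ (WithLp.toLp 2)) z = (z.1 : Space n) + z.2 := by
    intro z
    simp
  have hm : Measurable fun z : (ℝ ∙ u) × (ℝ ∙ u)ᗮ => f ((z.1 : Space n) + z.2) := by fun_prop
  simp only [h4] at h2
  rw [← h2, Measure.volume_eq_prod, lintegral_prod _ hm.aemeasurable,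
    ← h3.lintegral_comp hm.lintegral_prod_right']
  rfl

/-- Integration over `ℝⁿ` along the lines of direction `v`, which are parametrized by the
hyperplane `u^⊥`; the Jacobian is `|u · v|`. -/
theorem lintegral_eq_oblique_line {u v : Space n} (hu : ‖u‖ = 1) (huv : ⟪u, v⟫ ≠ 0)
    {f : Space n → ℝ≥0∞} (hf : Measurable f) :
    ∫⁻ x, f x = ENNReal.ofReal |⟪u, v⟫| * ∫⁻ b : (ℝ ∙ u)ᗮ, ∫⁻ t : ℝ, f (b + t • v) := by
  set a := ⟪u, v⟫ with ha
  have hw : v - a • u ∈ (ℝ ∙ u)ᗮ := by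
    rw [Submodule.mem_orthogonal_singleton_iff_inner_right, inner_sub_right,
      real_inner_smul_right, real_inner_self_eq_norm_sq, hu, ← ha]
    ring
  set w : (ℝ ∙ u)ᗮ := ⟨v - a • u, hw⟩
  have hm : Measurable fun z : (ℝ ∙ u)ᗮ × ℝ => f (z.1 + z.2 • v) := by fun_prop
  have h1 : ∫⁻ b : (ℝ ∙ u)ᗮ, ∫⁻ t : ℝ, f (b + t • v)
      = ∫⁻ t : ℝ, ∫⁻ b : (ℝ ∙ u)ᗮ, f ((a * t) • u + b) := by
    rw [lintegral_lintegral_swap hm.aemeasurable]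
    refine lintegral_congr fun t => ?_
    rw [← lintegral_add_right_eq_self (fun b : (ℝ ∙ u)ᗮ => f ((a * t) • u + b)) (t • w)]
    refine lintegral_congr fun b => ?_
    congr 1
    simp only [Submodule.coe_add, Submodule.coe_smul, w, smul_sub, smul_smul, mul_comm t a]
    abel
  have hg : Measurable fun s : ℝ => ∫⁻ b : (ℝ ∙ u)ᗮ, f (s • u + b) := by
    have : Measurable fun z : ℝ × (ℝ ∙ u)ᗮ => f (z.1 • u + z.2) := by fun_prop
    exact this.lintegral_prod_right'
  have h2 := lintegral_map (μ := volume) hg (measurable_const_mul a)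
  rw [Real.map_volume_mul_left huv, lintegral_smul_measure, smul_eq_mul] at h2
  rw [h1, ← h2, lintegral_eq_orthogonal_line hu hf, ← mul_assoc, ← ENNReal.ofReal_mul (abs_nonneg _),
    ← abs_mul, mul_inv_cancel₀ huv, abs_one, ENNReal.ofReal_one, one_mul]

/-- The projection onto the hyperplane `u^⊥` along the direction `v`, which must be transversal to
it. -/
def obliqueProj (u v : Space n) (huv : ⟪u, v⟫ ≠ 0) (x : Space n) : (ℝ ∙ u)ᗮ :=
  ⟨x - (⟪u, x⟫ / ⟪u, v⟫) • v, by
    rw [Submodule.mem_orthogonal_singleton_iff_inner_right, inner_sub_right,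
      real_inner_smul_right, div_mul_cancel₀ _ huv, sub_self]⟩

variable {u v : Space n} (huv : ⟪u, v⟫ ≠ 0)

theorem coe_obliqueProj (x : Space n) :
    (obliqueProj u v huv x : Space n) = x - (⟪u, x⟫ / ⟪u, v⟫) • v := rfl

theorem continuous_obliqueProj : Continuous (obliqueProj u v huv) := by
  unfold obliqueProj
  exact Continuous.subtype_mk (by fun_prop) _

theorem obliqueProj_add (x : Space n) (t : ℝ) :
    obliqueProj u v huv (x + t • v) = obliqueProj u v huv x := by
  apply Subtype.ext
  rw [coe_obliqueProj, coe_obliqueProj, inner_add_right, real_inner_smul_right, add_div,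
    mul_div_cancel_right₀ _ huv, add_smul]
  abel

theorem obliqueProj_coe (b : (ℝ ∙ u)ᗮ) : obliqueProj u v huv b = b := by
  apply Subtype.ext
  rw [coe_obliqueProj, (Submodule.mem_orthogonal_singleton_iff_inner_right).1 b.2]
  simp

theorem obliqueProj_add_smul (x : Space n) :
    (obliqueProj u v huv x : Space n) + (⟪u, x⟫ / ⟪u, v⟫) • v = x := by
  rw [coe_obliqueProj, sub_add_cancel]

theorem norm_obliqueProj_sub (hv : ‖v‖ = 1) (x y : Space n) :
    |dist (obliqueProj u v huv x) (obliqueProj u v huv y) - dist x y|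
      ≤ |⟪u, x - y⟫| / |⟪u, v⟫| := by
  rw [Subtype.dist_eq, dist_eq_norm, dist_eq_norm, coe_obliqueProj, coe_obliqueProj]
  refine (abs_norm_sub_norm_le _ _).trans (le_of_eq ?_)
  have : x - (⟪u, x⟫ / ⟪u, v⟫) • v - (y - (⟪u, y⟫ / ⟪u, v⟫) • v) - (x - y)
      = -((⟪u, x - y⟫ / ⟪u, v⟫) • v) := by
    rw [inner_sub_right, sub_div, sub_smul]; abel
  rw [this, norm_neg, norm_smul, hv, mul_one, Real.norm_eq_abs, abs_div]

/-- The union of the lines of direction `v` through the points of `B`. -/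
def lineHull (v : Space n) (B : Set (Space n)) : Set (Space n) :=
  {z | ∃ x ∈ B, ∃ t : ℝ, z = x + t • v}

theorem lineHull_eq_preimage (B : Set (Space n)) :
    lineHull v B = obliqueProj u v huv ⁻¹' (obliqueProj u v huv '' B) := by
  ext z
  constructor
  · rintro ⟨x, hx, t, rfl⟩
    exact ⟨x, hx, (obliqueProj_add huv x t).symm⟩
  · rintro ⟨x, hx, h⟩
    refine ⟨x, hx, ⟪u, z⟫ / ⟪u, v⟫ - ⟪u, x⟫ / ⟪u, v⟫, ?_⟩
    have hz := obliqueProj_add_smul huv z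
    rw [← h, coe_obliqueProj] at hz
    calc z = x - (⟪u, x⟫ / ⟪u, v⟫) • v + (⟪u, z⟫ / ⟪u, v⟫) • v := hz.symm
      _ = _ := by rw [sub_smul]; abel

theorem lintegral_lineHull (hu : ‖u‖ = 1) {B : Set (Space n)}
    (hB : MeasurableSet (obliqueProj u v huv '' B)) {f : Space n → ℝ≥0∞} (hf : Measurable f) :
    ∫⁻ x in lineHull v B, f x =
      ENNReal.ofReal |⟪u, v⟫| * ∫⁻ b in obliqueProj u v huv '' B, ∫⁻ t : ℝ, f (b + t • v) := by
  have hmeas : MeasurableSet (lineHull v B) := by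
    rw [lineHull_eq_preimage huv]
    exact (continuous_obliqueProj huv).measurable hB
  rw [← lintegral_indicator hmeas, lintegral_eq_oblique_line hu huv (hf.indicator hmeas),
    ← lintegral_indicator hB]
  congr 1
  refine lintegral_congr fun b => ?_
  have key : ∀ t : ℝ, (b : Space n) + t • v ∈ lineHull v B ↔ b ∈ obliqueProj u v huv '' B := by
    intro t
    rw [lineHull_eq_preimage huv, mem_preimage, obliqueProj_add, obliqueProj_coe]
  by_cases hb : b ∈ obliqueProj u v huv '' B
  · rw [indicator_of_mem hb]
    exact lintegral_congr fun t => indicator_of_mem ((key t).2 hb) _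
  · rw [indicator_of_notMem hb]
    simp [indicator_of_notMem (fun h => hb ((key _).1 h))]

end Oblique

/-! ### The surface measure of the boundary -/

section Surface

variable {n : ℕ} {X : Set (Space n)}

theorem euclideanHausdorffMeasure_orthogonal (hn : 1 ≤ n) {u : Space n} (hu : ‖u‖ = 1) :
    (μHE[n - 1] : Measure (ℝ ∙ u)ᗮ) = volume := by
  have : Fact (Module.finrank ℝ (Space n) = (n - 1) + 1) := ⟨by
    rw [finrank_euclideanSpace_fin]; omega⟩
  have hu0 : u ≠ 0 := by rintro rfl; simp at hu
  have h := Submodule.finrank_orthogonal_span_singleton (𝕜 := ℝ) (n := n - 1) hu0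
  rw [← InnerProductSpace.euclideanHausdorffMeasure_eq_volume, h]

theorem euclideanHausdorffMeasure_image_le {Y Z : Type*} [MetricSpace Y] [MeasurableSpace Y]
    [BorelSpace Y] [MetricSpace Z] [MeasurableSpace Z] [BorelSpace Z] {K : NNReal} {d : ℕ}
    {g : Y → Z} {B : Set Y} (h : ∀ x ∈ B, ∀ y ∈ B, dist (g x) (g y) ≤ K * dist x y) :
    μHE[d] (g '' B) ≤ (K : ℝ≥0∞) ^ d * μHE[d] B := by
  have h1 : LipschitzOnWith K g B := LipschitzOnWith.of_dist_le_mul h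
  have h2 := h1.hausdorffMeasure_image_le (d := d) (Nat.cast_nonneg d)
  rw [ENNReal.rpow_natCast] at h2
  simp only [Measure.euclideanHausdorffMeasure_def, Measure.smul_apply]
  refine (smul_le_smul_of_nonneg_left h2 zero_le).trans (le_of_eq ?_)
  simp only [ENNReal.smul_def, smul_eq_mul]
  ring

theorem le_euclideanHausdorffMeasure_image {Y Z : Type*} [MetricSpace Y] [MeasurableSpace Y]
    [BorelSpace Y] [MetricSpace Z] [MeasurableSpace Z] [BorelSpace Z] {K : NNReal} {d : ℕ}
    {g : Y → Z} {B : Set Y} (h : ∀ x ∈ B, ∀ y ∈ B, dist x y ≤ K * dist (g x) (g y)) :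
    μHE[d] B ≤ (K : ℝ≥0∞) ^ d * μHE[d] (g '' B) := by
  have h1 : AntilipschitzWith K (fun b : B => g b) :=
    AntilipschitzWith.of_le_mul_dist fun x y => h x x.2 y y.2
  have h2 := h1.le_hausdorffMeasure_image (d := d) (Nat.cast_nonneg d) univ
  have h3 : μH[d] (univ : Set B) = μH[d] B := by
    rw [← (isometry_subtype_coe (s := B)).hausdorffMeasure_image (Or.inl (Nat.cast_nonneg d)),
      image_univ, Subtype.range_coe]
  have h4 : (fun b : B => g b) '' univ = g '' B := by
    rw [image_univ]; ext; simp
  rw [ENNReal.rpow_natCast, h3, h4] at h2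
  simp only [Measure.euclideanHausdorffMeasure_def, Measure.smul_apply]
  refine (smul_le_smul_of_nonneg_left h2 zero_le).trans (le_of_eq ?_)
  simp only [ENNReal.smul_def, smul_eq_mul]
  ring

/-- Near a boundary point where `v` is transversal to the boundary, the projection along `v` onto
the tangent hyperplane is almost an isometry of the boundary. -/
theorem IsConvexDomain.obliqueProj_biLipschitz (hX : IsConvexDomain X) {x₀ v : Space n}
    (hx₀ : x₀ ∈ frontier X) (hv : ‖v‖ = 1) (huv : ⟪outerNormal X x₀, v⟫ ≠ 0) {K : NNReal}
    (hK : 1 < K) : ∃ U ∈ 𝓝 x₀, ∀ x ∈ U ∩ frontier X, ∀ y ∈ U ∩ frontier X,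
      dist (obliqueProj _ v huv x) (obliqueProj _ v huv y) ≤ K * dist x y ∧
      dist x y ≤ K * dist (obliqueProj _ v huv x) (obliqueProj _ v huv y) := by
  obtain ⟨f, hf⟩ := hX.hasC1Boundary x₀ hx₀
  set ν := outerNormal X x₀ with hν
  have hK1 : (1 : ℝ) < K := hK
  have hK0 : (0 : ℝ) < K := one_pos.trans hK1
  have hg : 0 < ‖gradient f x₀‖ := norm_pos_iff.2 hf.gradient_ne_zero
  have ha : 0 < |⟪ν, v⟫| := abs_pos.2 huv
  -- the oblique projection displaces differences by at most the factor `η = 1 - K⁻¹`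
  set η : ℝ := 1 - (K : ℝ)⁻¹ with hη
  have hη0 : 0 < η := sub_pos.2 (inv_lt_one_of_one_lt₀ hK1)
  have hstrict := (hf.contDiffAt.hasStrictFDerivAt one_ne_zero).isLittleO
  have hc : 0 < η * |⟪ν, v⟫| * ‖gradient f x₀‖ := by positivity
  have hev := hstrict.def hc
  rw [nhds_prod_eq] at hev
  obtain ⟨U, hU, hUf⟩ := Filter.eventually_prod_self_iff'.1 hev
  obtain ⟨V, hV, hVf⟩ := Filter.eventually_iff_exists_mem.1 (hf.eventually_eq_zero hX.isOpen)
  refine ⟨U ∩ V, Filter.inter_mem hU hV, ?_⟩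
  rintro x ⟨⟨hxU, hxV⟩, hxX⟩ y ⟨⟨hyU, hyV⟩, hyX⟩
  have h1 := hUf x hxU y hyU
  rw [hVf x hxV hxX, hVf y hyV hyX, sub_self, zero_sub, norm_neg] at h1
  have h2 : fderiv ℝ f x₀ (x - y) = ‖gradient f x₀‖ * ⟪ν, x - y⟫ := by
    have := hf.hasGradientAt.hasFDerivAt.fderiv
    rw [this, InnerProductSpace.toDual_apply_apply, ← real_inner_smul_left, ← hf.gradient_eq hx₀]
  rw [h2, Real.norm_eq_abs, abs_mul, abs_of_pos hg] at h1
  have h3 : |⟪ν, x - y⟫| / |⟪ν, v⟫| ≤ η * dist x y := by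
    rw [div_le_iff₀ ha, dist_eq_norm]
    refine le_of_mul_le_mul_left ?_ hg
    linarith
  have h4 := (norm_obliqueProj_sub huv hv x y).trans h3
  rw [abs_le] at h4
  have hd : 0 ≤ dist x y := dist_nonneg
  have hKK : (K : ℝ)⁻¹ * K = 1 := inv_mul_cancel₀ hK0.ne'
  constructor
  · have : 1 + η ≤ K := by
      have : 0 < (K : ℝ)⁻¹ := inv_pos.2 hK0
      nlinarith
    nlinarith [h4.2]
  · have h5 : (K : ℝ)⁻¹ * dist x y ≤ dist (obliqueProj _ v huv x) (obliqueProj _ v huv y) := by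
      have : (K : ℝ)⁻¹ = 1 - η := by rw [hη]; ring
      rw [this]; linarith [h4.1]
    calc dist x y = K * ((K : ℝ)⁻¹ * dist x y) := by rw [← mul_assoc, mul_comm (K : ℝ), hKK, one_mul]
      _ ≤ _ := mul_le_mul_of_nonneg_left h5 hK0.le

/-- The boundary has finite surface measure. -/
theorem IsConvexDomain.hausdorff_frontier_lt_top (hX : IsConvexDomain X) (hn : 1 ≤ n) :
    (μHE[n - 1] : Measure (Space n)) (frontier X) < ⊤ := by
  have hcomp : IsCompact (frontier X) :=
    Metric.isCompact_of_isClosed_isBounded isClosed_frontier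
      (hX.isBounded.closure.subset frontier_subset_closure)
  refine hcomp.measure_lt_top_of_nhdsWithin fun x hx => ?_
  have hν := hX.norm_outerNormal hx
  have huv : ⟪outerNormal X x, outerNormal X x⟫ ≠ 0 := by
    rw [real_inner_self_eq_norm_sq, hν]; norm_num
  obtain ⟨U, hU, hUX⟩ := hX.obliqueProj_biLipschitz hx hν huv (K := 2) (by norm_num)
  refine ⟨U ∩ frontier X, Filter.inter_mem (mem_nhdsWithin_of_mem_nhds hU) self_mem_nhdsWithin, ?_⟩
  refine (le_euclideanHausdorffMeasure_image (K := 2)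
    fun a ha b hb => (hUX a ha b hb).2).trans_lt ?_
  refine ENNReal.mul_lt_top (by finiteness) ?_
  rw [euclideanHausdorffMeasure_orthogonal hn hν]
  refine Bornology.IsBounded.measure_lt_top ?_
  have h1 : IsCompact (obliqueProj _ _ huv '' frontier X) :=
    hcomp.image (continuous_obliqueProj huv)
  exact h1.isBounded.subset (image_mono inter_subset_right)

/-- The part of the boundary through which the direction `v` enters `X`. -/
def inflow (X : Set (Space n)) (v : Dir n) : Set (Space n) :=
  {x | (x, v) ∈ incoming X}

theorem IsConvexDomain.measurableSet_incoming (hX : IsConvexDomain X) :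
    MeasurableSet (incoming X) := by
  have hF : IsClosed (frontier X ×ˢ (univ : Set (Dir n))) := isClosed_frontier.prod isClosed_univ
  have hc : ContinuousOn (fun p : Space n × Dir n => ⟪(p.2 : Space n), outerNormal X p.1⟫)
      (frontier X ×ˢ univ) := by
    refine ContinuousOn.inner (𝕜 := ℝ) (by fun_prop) ?_
    exact hX.continuousOn_outerNormal.comp continuousOn_fst fun p hp => hp.1
  obtain ⟨U, hU, h⟩ := (_root_.continuousOn_iff'.1 hc) (Iio 0) isOpen_Iio
  have : incoming X = U ∩ (frontier X ×ˢ univ) := by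
    rw [← h]
    ext p
    simp [incoming, and_comm]
  rw [this]
  exact hU.measurableSet.inter hF.measurableSet

theorem IsConvexDomain.measurableSet_inflow (hX : IsConvexDomain X) (v : Dir n) :
    MeasurableSet (inflow X v) :=
  measurable_prodMk_right hX.measurableSet_incoming

/-- The Jacobian of the projection of the boundary along `v`. -/
def inflowWeight (X : Set (Space n)) (v : Dir n) (x : Space n) : ℝ≥0∞ :=
  ENNReal.ofReal |⟪(v : Space n), outerNormal X x⟫|

/-- Up to a factor close to `1`, the formula `∫ f = ∫ |v · ν| ∫ f(x + tv) dt dμ(x)` holds on the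
lines through a small piece of the boundary. -/
theorem IsConvexDomain.exists_nhds_lintegral_lineHull (hX : IsConvexDomain X) (hn : 1 ≤ n)
    {v : Dir n} {x₀ : Space n} (hx₀ : x₀ ∈ inflow X v) {K : NNReal} (hK : 1 < K) :
    ∃ U ∈ 𝓝 x₀, ∀ B : Set (Space n), MeasurableSet B → B ⊆ U ∩ inflow X v →
      MeasurableSet (lineHull (v : Space n) B) ∧
      ∀ f : Space n → ℝ≥0∞, Measurable f →
      (∫⁻ x in lineHull (v : Space n) B, f x ≤ (K : ℝ≥0∞) ^ n *
        ∫⁻ x in B, inflowWeight X v x * (∫⁻ t : ℝ, f (x + t • (v : Space n))) ∂μHE[n - 1]) ∧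
      (∫⁻ x in B, inflowWeight X v x * (∫⁻ t : ℝ, f (x + t • (v : Space n))) ∂μHE[n - 1] ≤
        (K : ℝ≥0∞) ^ n * ∫⁻ x in lineHull (v : Space n) B, f x) := by
  have hν := hX.norm_outerNormal hx₀.1
  have ha : ⟪outerNormal X x₀, (v : Space n)⟫ < 0 := by rw [real_inner_comm]; exact hx₀.2
  have huv := ha.ne
  have hK0 : (0 : ℝ) < K := one_pos.trans hK
  obtain ⟨U, hU, hUX⟩ := hX.obliqueProj_biLipschitz hx₀.1 (norm_dir v) huv hK
  set Q := obliqueProj (outerNormal X x₀) (v : Space n) huv with hQ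
  -- the weight is almost constant near `x₀`
  have hw : ∀ᶠ x in 𝓝[frontier X] x₀,
      inflowWeight X v x ≤ K * ENNReal.ofReal |⟪outerNormal X x₀, (v : Space n)⟫| ∧
      ENNReal.ofReal |⟪outerNormal X x₀, (v : Space n)⟫| ≤ K * inflowWeight X v x := by
    have hc : Filter.Tendsto (fun x => |⟪(v : Space n), outerNormal X x⟫|) (𝓝[frontier X] x₀)
        (𝓝 |⟪(v : Space n), outerNormal X x₀⟫|) :=
      (ContinuousWithinAt.inner (𝕜 := ℝ) continuousWithinAt_const
        (hX.continuousOn_outerNormal x₀ hx₀.1)).abs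
    rw [real_inner_comm] at hc
    have hpos : 0 < |⟪outerNormal X x₀, (v : Space n)⟫| := abs_pos.2 huv
    have e1 := hc.eventually (gt_mem_nhds
      (lt_mul_of_one_lt_left hpos (show (1 : ℝ) < K from hK)))
    have e2 := (hc.const_mul (K : ℝ)).eventually (lt_mem_nhds
      (lt_mul_of_one_lt_left hpos (show (1 : ℝ) < K from hK)))
    have hcoe : (K : ℝ≥0∞) = ENNReal.ofReal K := (ENNReal.ofReal_coe_nnreal).symm
    filter_upwards [e1, e2] with x h1 h2
    rw [inflowWeight, hcoe, ← ENNReal.ofReal_mul hK0.le, ← ENNReal.ofReal_mul hK0.le]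
    exact ⟨ENNReal.ofReal_le_ofReal h1.le, ENNReal.ofReal_le_ofReal h2.le⟩
  obtain ⟨V, hV, hVX⟩ := mem_nhdsWithin_iff_exists_mem_nhds_inter.1 hw
  refine ⟨U ∩ V, Filter.inter_mem hU hV, fun B hB hBU => ?_⟩
  have hBX : ∀ x ∈ B, x ∈ U ∩ frontier X := fun x hx => ⟨(hBU hx).1.1, (hBU hx).2.1⟩
  have hQc : Continuous Q := continuous_obliqueProj huv
  have hinj : InjOn Q B := by
    intro x hx y hy hxy
    have := (hUX x (hBX x hx) y (hBX y hy)).2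
    rw [hxy, dist_self, mul_zero] at this
    exact dist_le_zero.1 this
  have hQB : MeasurableSet (Q '' B) := hB.image_of_continuousOn_injOn hQc.continuousOn hinj
  have hvol := euclideanHausdorffMeasure_orthogonal hn hν
  set A := ENNReal.ofReal |⟪outerNormal X x₀, (v : Space n)⟫| with hA
  have hKn : (K : ℝ≥0∞) ^ n = K * (K : ℝ≥0∞) ^ (n - 1) := by
    rw [← pow_succ', Nat.sub_add_cancel hn]
  refine ⟨by rw [lineHull_eq_preimage huv]; exact hQc.measurable hQB, fun f hf => ?_⟩
  rw [lintegral_lineHull huv hν hQB hf]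
  set F : Space n → ℝ≥0∞ := fun x => ∫⁻ t : ℝ, f (x + t • (v : Space n)) with hF
  have hFm : Measurable F := by
    have : Measurable fun z : Space n × ℝ => f (z.1 + z.2 • (v : Space n)) := by fun_prop
    exact this.lintegral_prod_right'
  have hFm' : Measurable fun b : (ℝ ∙ outerNormal X x₀)ᗮ => F b :=
    hFm.comp measurable_subtype_coe
  have hFQ : ∀ x, F (Q x) = F x := by
    intro x
    have hx := obliqueProj_add_smul huv x
    simp only [hF]
    conv_rhs => rw [← lintegral_add_right_eq_self (μ := volume) _
      (-(⟪outerNormal X x₀, x⟫ / ⟪outerNormal X x₀, (v : Space n)⟫))]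
    refine lintegral_congr fun t => ?_
    rw [hQ, coe_obliqueProj, add_smul, neg_smul]
    congr 1
    abel
  have hm1 : (μHE[n - 1].restrict B).map Q ≤ (K : ℝ≥0∞) ^ (n - 1) • volume.restrict (Q '' B) := by
    refine Measure.le_iff.2 fun S hS => ?_
    rw [Measure.map_apply hQc.measurable hS, Measure.smul_apply, Measure.restrict_apply hS,
      Measure.restrict_apply (hQc.measurable hS), ← hvol, smul_eq_mul, inter_comm,
      inter_comm S, ← image_inter_preimage]
    exact le_euclideanHausdorffMeasure_image fun x hx y hy =>
      (hUX x (hBX x hx.1) y (hBX y hy.1)).2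
  have hm2 : volume.restrict (Q '' B) ≤ (K : ℝ≥0∞) ^ (n - 1) • (μHE[n - 1].restrict B).map Q := by
    refine Measure.le_iff.2 fun S hS => ?_
    rw [Measure.smul_apply, Measure.map_apply hQc.measurable hS, Measure.restrict_apply hS,
      Measure.restrict_apply (hQc.measurable hS), ← hvol, smul_eq_mul, inter_comm,
      inter_comm _ B, ← image_inter_preimage]
    exact euclideanHausdorffMeasure_image_le fun x hx y hy =>
      (hUX x (hBX x hx.1) y (hBX y hy.1)).1
  -- `F` is constant along the lines, so it does not see the projection
  have hmap : ∫⁻ b, F b ∂(μHE[n - 1].restrict B).map Q = ∫⁻ x in B, F x ∂μHE[n - 1] := by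
    rw [lintegral_map hFm' hQc.measurable]
    simp only [hFQ]
  have hwB : ∀ x ∈ B, inflowWeight X v x ≤ K * A ∧ A ≤ K * inflowWeight X v x :=
    fun x hx => hVX ⟨(hBU hx).1.2, (hBU hx).2.1⟩
  constructor
  · calc A * ∫⁻ b in Q '' B, F b
        ≤ A * ((K : ℝ≥0∞) ^ (n - 1) * ∫⁻ x in B, F x ∂μHE[n - 1]) := by
          gcongr
          rw [← hmap, ← smul_eq_mul, ← lintegral_smul_measure]
          exact lintegral_mono' hm2 le_rfl
      _ = (K : ℝ≥0∞) ^ (n - 1) * ∫⁻ x in B, A * F x ∂μHE[n - 1] := by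
          rw [lintegral_const_mul _ hFm]; ring
      _ ≤ (K : ℝ≥0∞) ^ (n - 1) * ∫⁻ x in B, K * (inflowWeight X v x * F x) ∂μHE[n - 1] := by
          gcongr 1
          refine setLIntegral_mono' hB fun x hx => ?_
          rw [← mul_assoc]
          gcongr
          exact (hwB x hx).2
      _ = _ := by
          rw [lintegral_const_mul' _ _ ENNReal.coe_ne_top, hKn]; ring
  · calc ∫⁻ x in B, inflowWeight X v x * F x ∂μHE[n - 1]
        ≤ ∫⁻ x in B, K * A * F x ∂μHE[n - 1] := by
          refine setLIntegral_mono' hB fun x hx => ?_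
          gcongr
          exact (hwB x hx).1
      _ = K * A * ∫⁻ x in B, F x ∂μHE[n - 1] := lintegral_const_mul _ hFm
      _ ≤ K * A * ((K : ℝ≥0∞) ^ (n - 1) * ∫⁻ b in Q '' B, F b) := by
          gcongr
          rw [← hmap, ← smul_eq_mul, ← lintegral_smul_measure]
          exact lintegral_mono' hm1 le_rfl
      _ = _ := by rw [hKn]; ring

/-- A line of direction `v` enters the convex set `X` at one point only. -/
theorem IsConvexDomain.eq_of_mem_inflow (hX : IsConvexDomain X) {v : Dir n} {x y : Space n}
    (hx : x ∈ inflow X v) (hy : y ∈ inflow X v) {r : ℝ} (h : y = x + r • (v : Space n)) :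
    x = y := by
  have h1 := hX.mem_iff_of_incoming hx
  have h2 := hX.mem_iff_of_incoming hy
  have hxp := hX.exitTime_pos hx
  have hyp := hX.exitTime_pos hy
  have h3 : ∀ s : ℝ, s ∈ Ioo 0 (exitTime X y v) ↔ r + s ∈ Ioo 0 (exitTime X x v) := by
    intro s
    rw [← h1, ← h2, h, add_smul, add_assoc]
  set p := exitTime X x v
  set q := exitTime X y v
  have hr : r = 0 := by
    rcases lt_trichotomy r 0 with h0 | h0 | h0
    · exfalso
      have := (h3 (min (-r) q / 2)).1 ⟨by have := lt_min (neg_pos.2 h0) hyp; linarith,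
        by have := min_le_right (-r) q; linarith⟩
      have h4 := min_le_left (-r) q
      linarith [this.1]
    · exact h0
    · exfalso
      have h5 := lt_min h0 hxp
      have h4 := min_le_left r p
      have h6 := min_le_right r p
      have := (h3 (min r p / 2 - r)).2 ⟨by linarith, by linarith⟩
      linarith [this.1]
  rw [h, hr, zero_smul, add_zero]

/-- The change of variables on all lines of direction `v` entering `X`: the inflow boundary is cut
into countably many pieces on which the formula holds up to a factor as close to `1` as desired. -/
theorem IsConvexDomain.lintegral_lineHull_inflow (hX : IsConvexDomain X) (hn : 1 ≤ n) (v : Dir n)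
    {f : Space n → ℝ≥0∞} (hf : Measurable f) :
    ∫⁻ x in lineHull (v : Space n) (inflow X v), f x = ∫⁻ x in inflow X v,
      inflowWeight X v x * (∫⁻ t : ℝ, f (x + t • (v : Space n))) ∂μHE[n - 1] := by
  set I := inflow X v with hI
  have hIm : MeasurableSet I := hX.measurableSet_inflow v
  have key : ∀ K : NNReal, 1 < K →
      (∫⁻ x in lineHull (v : Space n) I, f x ≤ (K : ℝ≥0∞) ^ n *
        ∫⁻ x in I, inflowWeight X v x * (∫⁻ t : ℝ, f (x + t • (v : Space n))) ∂μHE[n - 1]) ∧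
      (∫⁻ x in I, inflowWeight X v x * (∫⁻ t : ℝ, f (x + t • (v : Space n))) ∂μHE[n - 1] ≤
        (K : ℝ≥0∞) ^ n * ∫⁻ x in lineHull (v : Space n) I, f x) := by
    intro K hK
    rcases I.eq_empty_or_nonempty with h0 | hne
    · have : lineHull (v : Space n) I = ∅ := by
        rw [h0]; ext; simp [lineHull]
      rw [this, h0]; simp
    have hloc : ∀ x : Space n, ∃ U : Set (Space n), x ∈ I → U ∈ 𝓝 x ∧
        ∀ B : Set (Space n), MeasurableSet B → B ⊆ U ∩ I →
        MeasurableSet (lineHull (v : Space n) B) ∧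
        ∀ f : Space n → ℝ≥0∞, Measurable f →
        (∫⁻ x in lineHull (v : Space n) B, f x ≤ (K : ℝ≥0∞) ^ n *
          ∫⁻ x in B, inflowWeight X v x * (∫⁻ t : ℝ, f (x + t • (v : Space n))) ∂μHE[n - 1]) ∧
        (∫⁻ x in B, inflowWeight X v x * (∫⁻ t : ℝ, f (x + t • (v : Space n))) ∂μHE[n - 1] ≤
          (K : ℝ≥0∞) ^ n * ∫⁻ x in lineHull (v : Space n) B, f x) := by
      intro x
      by_cases hx : x ∈ I
      · obtain ⟨U, hU, h⟩ := hX.exists_nhds_lintegral_lineHull hn hx hK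
        exact ⟨U, fun _ => ⟨hU, h⟩⟩
      · exact ⟨univ, fun h => absurd h hx⟩
    choose U hU using hloc
    obtain ⟨T, hTI, hTc, hTU⟩ := TopologicalSpace.countable_cover_nhdsWithin
      (f := fun x => interior (U x)) (s := I)
      fun x hx => mem_nhdsWithin_of_mem_nhds (interior_mem_nhds.2 (hU x hx).1)
    have hTne : T.Nonempty := by
      obtain ⟨x, hx⟩ := hne
      obtain ⟨y, hy, -⟩ := mem_iUnion₂.1 (hTU hx)
      exact ⟨y, hy⟩
    obtain ⟨c, rfl⟩ := hTc.exists_eq_range hTne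
    set B : ℕ → Set (Space n) := disjointed fun i => interior (U (c i)) ∩ I with hB
    have hBm : ∀ i, MeasurableSet (B i) := fun i =>
      MeasurableSet.disjointed (fun i => isOpen_interior.measurableSet.inter hIm) i
    have hBsub : ∀ i, B i ⊆ U (c i) ∩ I := fun i =>
      (disjointed_subset _ i).trans (inter_subset_inter_left _ interior_subset)
    have hBU : ⋃ i, B i = I := by
      rw [hB, iUnion_disjointed]
      refine Subset.antisymm (iUnion_subset fun i => inter_subset_right) fun x hx => ?_
      obtain ⟨_, ⟨i, rfl⟩, hi⟩ := mem_iUnion₂.1 (hTU hx)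
      exact mem_iUnion.2 ⟨i, hi, hx⟩
    have hBd : Pairwise (Function.onFun Disjoint B) := disjoint_disjointed _
    have hLU : ⋃ i, lineHull (v : Space n) (B i) = lineHull (v : Space n) I := by
      rw [← hBU]
      ext z
      simp only [lineHull, mem_iUnion, mem_ofPred_eq]
      constructor
      · rintro ⟨i, x, hx, t, rfl⟩; exact ⟨x, ⟨i, hx⟩, t, rfl⟩
      · rintro ⟨x, ⟨i, hx⟩, t, rfl⟩; exact ⟨i, x, hx, t, rfl⟩
    -- distinct entry points lie on distinct lines
    have hLd : Pairwise (Function.onFun Disjoint fun i => lineHull (v : Space n) (B i)) := by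
      intro i j hij
      refine disjoint_left.2 ?_
      rintro z ⟨x, hx, t, rfl⟩ ⟨y, hy, s, h⟩
      have : x = y := hX.eq_of_mem_inflow (hBsub i hx).2 (hBsub j hy).2 (r := t - s) (by
        rw [sub_smul, ← add_sub_assoc, h, add_sub_cancel_right])
      exact disjoint_left.1 (hBd hij) hx (this ▸ hy)
    have hspec := fun i => (hU (c i) (hTI ⟨i, rfl⟩)).2 (B i) (hBm i) (hBsub i)
    rw [← hLU, lintegral_iUnion (fun i => (hspec i).1) hLd]
    conv => enter [1, 2, 2]; rw [← hBU]
    conv => enter [2, 1]; rw [← hBU]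
    rw [lintegral_iUnion hBm hBd, ← ENNReal.tsum_mul_left, ← ENNReal.tsum_mul_left]
    exact ⟨ENNReal.tsum_le_tsum fun i => ((hspec i).2 f hf).1,
      ENNReal.tsum_le_tsum fun i => ((hspec i).2 f hf).2⟩
  -- let the factor tend to `1`
  have hlim : ∀ a b : ℝ≥0∞, (∀ K : NNReal, 1 < K → a ≤ (K : ℝ≥0∞) ^ n * b) → a ≤ b := by
    intro a b h
    rcases eq_or_ne b ⊤ with rfl | hb
    · exact le_top
    have hc : Filter.Tendsto (fun K : NNReal => (K : ℝ≥0∞) ^ n * b) (𝓝[>] 1)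
        (𝓝 (((1 : NNReal) : ℝ≥0∞) ^ n * b)) := by
      refine ENNReal.Tendsto.mul_const ?_ (Or.inr hb)
      exact (((ENNReal.continuous_pow n).comp ENNReal.continuous_coe).tendsto 1).mono_left
        nhdsWithin_le_nhds
    rw [ENNReal.coe_one, one_pow, one_mul] at hc
    refine ge_of_tendsto hc ?_
    filter_upwards [self_mem_nhdsWithin] with K hK using h K hK
  exact le_antisymm (hlim _ _ fun K hK => (key K hK).1) (hlim _ _ fun K hK => (key K hK).2)

end Surface

/-! ### Disintegration of phase space along characteristics -/

section Disintegration

variable {n : ℕ} {X : Set (Space n)}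

theorem IsConvexDomain.isFiniteMeasure_boundaryMeasure (hX : IsConvexDomain X) (hn : 1 ≤ n) :
    IsFiniteMeasure (boundaryMeasure X) :=
  ⟨by
    rw [boundaryMeasure, Measure.restrict_apply_univ]
    exact hX.hausdorff_frontier_lt_top hn⟩

instance (X : Set (Space n)) : SigmaFinite (spaceMeasure X) := by
  unfold spaceMeasure; infer_instance

instance (X : Set (Space n)) : SigmaFinite (phaseMeasure X) := by
  unfold phaseMeasure; infer_instance

theorem measurable_advect : Measurable fun q : (Space n × Dir n) × ℝ =>
    (q.1.1 + q.2 • (q.1.2 : Space n), q.1.2) := by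
  have hc : Continuous fun q : (Space n × Dir n) × ℝ =>
    (q.1.1 + q.2 • (q.1.2 : Space n), q.1.2) := by fun_prop
  exact hc.measurable

theorem measurable_advect_line (x : Space n) (v : Dir n) :
    Measurable fun t : ℝ => x + t • (v : Space n) := by
  have hc : Continuous fun t : ℝ => x + t • (v : Space n) := by fun_prop
  exact hc.measurable

theorem IsConvexDomain.lintegral_line_indicator (hX : IsConvexDomain X) {x : Space n} {v : Dir n}
    (hp : (x, v) ∈ incoming X) (f : Space n → ℝ≥0∞) :
    ∫⁻ t : ℝ, X.indicator f (x + t • (v : Space n)) =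
      ∫⁻ t in Ioo 0 (exitTime X x v), f (x + t • (v : Space n)) := by
  rw [← lintegral_indicator measurableSet_Ioo]
  refine lintegral_congr fun t => ?_
  by_cases h : t ∈ Ioo 0 (exitTime X x v)
  · rw [indicator_of_mem h, indicator_of_mem ((hX.mem_iff_of_incoming hp t).2 h)]
  · rw [indicator_of_notMem h,
      indicator_of_notMem fun h' => h ((hX.mem_iff_of_incoming hp t).1 h')]

/-- For a fixed direction, `X` is the union of its chords, and Lebesgue measure is
`|v · ν| dμ dt` on them. -/
theorem IsConvexDomain.setLIntegral_eq_inflow (hX : IsConvexDomain X) (hn : 1 ≤ n) (v : Dir n)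
    {f : Space n → ℝ≥0∞} (hf : Measurable f) :
    ∫⁻ x in X, f x = ∫⁻ x in inflow X v, inflowWeight X v x *
      (∫⁻ t : ℝ, X.indicator f (x + t • (v : Space n))) ∂μHE[n - 1] := by
  have hXm := hX.isOpen.measurableSet
  rw [← hX.lintegral_lineHull_inflow hn v (hf.indicator hXm), lintegral_indicator hXm,
    Measure.restrict_restrict_of_subset]
  intro x hx
  exact ⟨_, hX.entryPoint_mem hx v, _, (entryPoint_add x v).symm⟩

theorem IsConvexDomain.lintegral_incomingMeasure (hX : IsConvexDomain X) (hn : 1 ≤ n)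
    {h : Space n × Dir n → ℝ≥0∞} (hh : Measurable h) :
    ∫⁻ p, h p ∂incomingMeasure X =
      ∫⁻ v, ∫⁻ x in inflow X v, inflowWeight X v x * h (x, v) ∂μHE[n - 1] ∂dirMeasure n := by
  have hfin := hX.isFiniteMeasure_boundaryMeasure hn
  have hI := hX.measurableSet_incoming
  have hc : ContinuousOn (fun p : Space n × Dir n =>
      ENNReal.ofReal |⟪(p.2 : Space n), outerNormal X p.1⟫|) (incoming X) := by
    refine ENNReal.continuous_ofReal.comp_continuousOn (ContinuousOn.abs ?_)
    refine ContinuousOn.inner (𝕜 := ℝ) (by fun_prop) ?_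
    exact hX.continuousOn_outerNormal.comp continuousOn_fst fun p hp => hp.1
  have hwm := hc.aemeasurable (μ := (boundaryMeasure X).prod (dirMeasure n)) hI
  have hm := (hwm.mul hh.aemeasurable)
  rw [incomingMeasure, lintegral_withDensity_eq_lintegral_mul₀ hwm hh.aemeasurable,
    ← lintegral_indicator hI, lintegral_prod_symm _ ((aemeasurable_indicator_iff hI).2 hm)]
  refine lintegral_congr fun v => ?_
  rw [← lintegral_indicator (hX.measurableSet_inflow v), boundaryMeasure,
    ← lintegral_indicator isClosed_frontier.measurableSet]
  refine lintegral_congr fun x => ?_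
  by_cases hx : (x, v) ∈ incoming X
  · rw [indicator_of_mem hx.1, indicator_of_mem hx,
      indicator_of_mem (show x ∈ inflow X v from hx)]
    rfl
  · rw [indicator_of_notMem (show x ∉ inflow X v from hx)]
    by_cases hx' : x ∈ frontier X
    · rw [indicator_of_mem hx', indicator_of_notMem hx]
    · rw [indicator_of_notMem hx']

theorem IsConvexDomain.ae_incoming (hX : IsConvexDomain X) :
    ∀ᵐ p ∂incomingMeasure X, p ∈ incoming X :=
  (withDensity_absolutelyContinuous _ _).ae_le (ae_restrict_mem hX.measurableSet_incoming)

/-- The phase space measure is the image of `dξ dt` under the free flow. -/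
theorem IsConvexDomain.lintegral_phaseMeasure (hX : IsConvexDomain X) (hn : 1 ≤ n)
    {g : Space n × Dir n → ℝ≥0∞} (hg : Measurable g) :
    ∫⁻ p, g p ∂phaseMeasure X = ∫⁻ p, (∫⁻ t in Ioo 0 (exitTime X p.1 p.2),
      g (p.1 + t • (p.2 : Space n), p.2)) ∂incomingMeasure X := by
  have hXm := hX.isOpen.measurableSet
  have hg' : Measurable fun p : Space n × Dir n => X.indicator (fun x => g (x, p.2)) p.1 := by
    have : (fun p : Space n × Dir n => X.indicator (fun x => g (x, p.2)) p.1)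
        = (Prod.fst ⁻¹' X).indicator g := by
      ext p; by_cases h : p.1 ∈ X <;> simp [h, indicator]
    rw [this]
    exact hg.indicator (measurable_fst hXm)
  have h1 : ∫⁻ p, (∫⁻ t in Ioo 0 (exitTime X p.1 p.2),
      g (p.1 + t • (p.2 : Space n), p.2)) ∂incomingMeasure X
      = ∫⁻ p, (∫⁻ t : ℝ, X.indicator (fun x => g (x, p.2)) (p.1 + t • (p.2 : Space n)))
        ∂incomingMeasure X := by
    refine lintegral_congr_ae ?_
    filter_upwards [hX.ae_incoming] with p hp
    exact (hX.lintegral_line_indicator hp (fun x => g (x, p.2))).symm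
  have h2 : Measurable fun q : (Space n × Dir n) × ℝ =>
      X.indicator (fun x => g (x, q.1.2)) (q.1.1 + q.2 • (q.1.2 : Space n)) := by
    have := hg'.comp measurable_advect
    exact this
  rw [h1, hX.lintegral_incomingMeasure hn h2.lintegral_prod_right', phaseMeasure,
    lintegral_prod_symm _ hg.aemeasurable]
  refine lintegral_congr fun v => ?_
  exact hX.setLIntegral_eq_inflow hn v (hg.comp measurable_prodMk_right)

/-- A property of almost every point of phase space holds almost everywhere on almost every
characteristic. -/
theorem IsConvexDomain.ae_incoming_of_ae_phase (hX : IsConvexDomain X) (hn : 1 ≤ n)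
    {P : Space n × Dir n → Prop} (h : ∀ᵐ p ∂phaseMeasure X, P p) :
    ∀ᵐ p ∂incomingMeasure X, ∀ᵐ t : ℝ, t ∈ Ioo 0 (exitTime X p.1 p.2) →
      P (p.1 + t • (p.2 : Space n), p.2) := by
  obtain ⟨s, hs, hsm, hs0⟩ := exists_measurable_superset_of_null (ae_iff.1 h)
  have h1 := hX.lintegral_phaseMeasure hn (measurable_one.indicator hsm)
  rw [lintegral_indicator_one hsm, hs0] at h1
  have hm : Measurable fun p : Space n × Dir n =>
      ∫⁻ t : ℝ, (Prod.fst ⁻¹' X ∩ s).indicator (1 : Space n × Dir n → ℝ≥0∞)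
        (p.1 + t • (p.2 : Space n), p.2) := by
    have h2 : Measurable ((Prod.fst ⁻¹' X ∩ s).indicator (1 : Space n × Dir n → ℝ≥0∞)) :=
      measurable_one.indicator ((measurable_fst hX.isOpen.measurableSet).inter hsm)
    have := h2.comp measurable_advect
    exact this.lintegral_prod_right'
  have h3 : ∀ᵐ p ∂incomingMeasure X, (∫⁻ t in Ioo 0 (exitTime X p.1 p.2),
      s.indicator (1 : Space n × Dir n → ℝ≥0∞) (p.1 + t • (p.2 : Space n), p.2)) =
      ∫⁻ t : ℝ, (Prod.fst ⁻¹' X ∩ s).indicator (1 : Space n × Dir n → ℝ≥0∞)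
        (p.1 + t • (p.2 : Space n), p.2) := by
    filter_upwards [hX.ae_incoming] with p hp
    rw [← hX.lintegral_line_indicator hp (fun x => s.indicator (1 : Space n × Dir n → ℝ≥0∞) (x, p.2))]
    refine lintegral_congr fun t => ?_
    by_cases h : p.1 + t • (p.2 : Space n) ∈ X <;>
      by_cases h' : (p.1 + t • (p.2 : Space n), p.2) ∈ s <;> simp [h, h', indicator]
  rw [lintegral_congr_ae h3, eq_comm, lintegral_eq_zero_iff hm] at h1
  filter_upwards [h1, h3] with p hp hp3
  rw [hp] at hp3
  have hmt : Measurable fun t : ℝ => s.indicator (1 : Space n × Dir n → ℝ≥0∞)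
      (p.1 + t • (p.2 : Space n), p.2) :=
    (measurable_one.indicator hsm).comp ((measurable_advect_line p.1 p.2).prodMk measurable_const)
  have h4 := (lintegral_eq_zero_iff hmt).1 hp3
  have h5 := (ae_restrict_iff' measurableSet_Ioo).1 h4
  filter_upwards [h5] with t ht htI
  by_contra hP
  have := ht htI
  rw [indicator_of_mem (hs hP)] at this
  simp at this

/-- The converse of `IsConvexDomain.ae_incoming_of_ae_phase`. -/
theorem IsConvexDomain.ae_phase_of_ae_incoming (hX : IsConvexDomain X) (hn : 1 ≤ n)
    {P : Space n × Dir n → Prop} (hP : NullMeasurableSet {p | P p} (phaseMeasure X))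
    (h : ∀ᵐ p ∂incomingMeasure X, ∀ᵐ t : ℝ, t ∈ Ioo 0 (exitTime X p.1 p.2) →
      P (p.1 + t • (p.2 : Space n), p.2)) : ∀ᵐ p ∂phaseMeasure X, P p := by
  obtain ⟨s, hsm, hs⟩ := hP.compl
  have hs' : ∀ᵐ p ∂phaseMeasure X, (p ∈ s ↔ ¬ P p) := by
    filter_upwards [hs.mem_iff] with p hp using hp.symm
  have h1 := hX.lintegral_phaseMeasure hn (measurable_one.indicator hsm)
  rw [lintegral_indicator_one hsm] at h1
  have h2 : phaseMeasure X s = 0 := by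
    rw [h1]
    refine lintegral_eq_zero_of_ae_eq_zero ?_
    filter_upwards [h, hX.ae_incoming_of_ae_phase hn hs'] with p hp hps
    refine lintegral_eq_zero_of_ae_eq_zero ((ae_restrict_iff' measurableSet_Ioo).2 ?_)
    filter_upwards [hp, hps] with t ht hts htI
    exact indicator_of_notMem (fun h => (hts htI).1 h (ht htI)) _
  have h3 : ∀ᵐ p ∂phaseMeasure X, p ∉ s := measure_eq_zero_iff_ae_notMem.1 h2
  filter_upwards [h3, hs'] with p hp hps
  by_contra hP
  exact hp (hps.2 hP)

theorem ae_phase_mem (hX : IsConvexDomain X) : ∀ᵐ p ∂phaseMeasure X, p.1 ∈ X := by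
  have : phaseMeasure X = ((volume : Measure (Space n)).prod (dirMeasure n)).restrict
      (X ×ˢ univ) := by
    rw [phaseMeasure, spaceMeasure, ← Measure.prod_restrict, Measure.restrict_univ]
  rw [this]
  filter_upwards [ae_restrict_mem (hX.isOpen.measurableSet.prod MeasurableSet.univ)] with p hp
  exact hp.1

/-- A property of almost every incoming datum holds at the entry point of almost every point of
phase space. -/
theorem IsConvexDomain.ae_phase_entryPoint (hX : IsConvexDomain X) (hn : 1 ≤ n)
    {P : Space n × Dir n → Prop} (h : ∀ᵐ p ∂incomingMeasure X, P p) :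
    ∀ᵐ p ∂phaseMeasure X, P (entryPoint X p.1 p.2, p.2) := by
  obtain ⟨s, hs, hsm, hs0⟩ := exists_measurable_superset_of_null (ae_iff.1 h)
  have hem : Measurable fun p : Space n × Dir n => (entryPoint X p.1 p.2, p.2) :=
    (measurable_entryPoint hX.isOpen).prodMk measurable_snd
  have h1 : ∀ᵐ p ∂phaseMeasure X, (entryPoint X p.1 p.2, p.2) ∉ s := by
    refine hX.ae_phase_of_ae_incoming hn (P := fun p => (entryPoint X p.1 p.2, p.2) ∉ s)
      (hem hsm.compl).nullMeasurableSet ?_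
    filter_upwards [measure_eq_zero_iff_ae_notMem.1 hs0, hX.ae_incoming] with p hp hpI
    refine .of_forall fun t ht => ?_
    rwa [hX.entryPoint_of_incoming (x := p.1) (v := p.2) hpI ht]
  filter_upwards [h1] with p hp
  by_contra hP
  exact hp (hs hP)

theorem IsConvexDomain.lintegral_entryPoint_le (hX : IsConvexDomain X) (hn : 1 ≤ n) {d : ℝ}
    (hd : ∀ x ∈ closure X, ∀ y ∈ closure X, dist x y ≤ d)
    {g : Space n × Dir n → ℝ≥0∞} (hg : Measurable g) :
    ∫⁻ p, g (entryPoint X p.1 p.2, p.2) ∂phaseMeasure X ≤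
      ENNReal.ofReal d * ∫⁻ p, g p ∂incomingMeasure X := by
  have hem : Measurable fun p : Space n × Dir n => (entryPoint X p.1 p.2, p.2) :=
    (measurable_entryPoint hX.isOpen).prodMk measurable_snd
  have h0 := hX.lintegral_phaseMeasure hn (hg.comp hem)
  simp only [Function.comp_def] at h0
  rw [h0, ← lintegral_const_mul _ hg]
  refine lintegral_mono_ae ?_
  filter_upwards [hX.ae_incoming] with p hp
  calc ∫⁻ t in Ioo 0 (exitTime X p.1 p.2),
        g (entryPoint X (p.1 + t • (p.2 : Space n)) p.2, p.2)
      = ∫⁻ t in Ioo 0 (exitTime X p.1 p.2), g p := by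
        refine setLIntegral_congr_fun measurableSet_Ioo fun t ht => ?_
        rw [hX.entryPoint_of_incoming (x := p.1) (v := p.2) hp ht]
    _ = g p * ENNReal.ofReal (exitTime X p.1 p.2) := by
        rw [setLIntegral_const, Real.volume_Ioo, sub_zero]
    _ ≤ ENNReal.ofReal d * g p := by
        rw [mul_comm]
        gcongr
        exact hX.exitTime_le hd (x := p.1) (v := p.2) hp

end Disintegration

/-! ### Integral operators on `L¹` -/

section KernelOperators

variable {α β S : Type*} [MeasurableSpace α] [MeasurableSpace β] [MeasurableSpace S]

/-- The data of the integral operator `f ↦ (b ↦ ∫ κ(b, s) f(θ(b, s)) dm(s))`, bounded from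
`L¹(μ)` to `L¹(ν)` with norm at most `C`. -/
structure IsTransferKernel (μ : Measure α) (ν : Measure β) (m : Measure S) (C : NNReal)
    (κ : β × S → ℝ) (θ : β × S → α) : Prop where
  measurable_weight : Measurable κ
  measurable_map : Measurable θ
  bound : ∀ g : α → ℝ≥0∞, Measurable g →
    ∫⁻ b, ∫⁻ s, ‖κ (b, s)‖ₑ * g (θ (b, s)) ∂m ∂ν ≤ C * ∫⁻ a, g a ∂μ

variable {μ : Measure α} {ν : Measure β} {m : Measure S} {C : NNReal}
  {κ : β × S → ℝ} {θ : β × S → α} [SFinite m]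

namespace IsTransferKernel

theorem lintegral_prod_le (h : IsTransferKernel μ ν m C κ θ) {g : α → ℝ≥0∞} (hg : Measurable g) :
    ∫⁻ q, ‖κ q‖ₑ * g (θ q) ∂(ν.prod m) ≤ C * ∫⁻ a, g a ∂μ := by
  have hm : Measurable fun q => ‖κ q‖ₑ * g (θ q) :=
    h.measurable_weight.enorm.mul (hg.comp h.measurable_map)
  rw [lintegral_prod _ hm.aemeasurable]
  exact h.bound g hg

theorem ae_of_ae (h : IsTransferKernel μ ν m C κ θ) {P : α → Prop} (hP : ∀ᵐ a ∂μ, P a) :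
    ∀ᵐ q ∂(ν.prod m), κ q ≠ 0 → P (θ q) := by
  obtain ⟨s, hs, hsm, hs0⟩ := exists_measurable_superset_of_null (ae_iff.1 hP)
  have h1 := h.lintegral_prod_le (measurable_one.indicator hsm)
  have hm : Measurable fun q => ‖κ q‖ₑ * s.indicator (1 : α → ℝ≥0∞) (θ q) :=
    h.measurable_weight.enorm.mul ((measurable_one.indicator hsm).comp h.measurable_map)
  rw [lintegral_indicator_one hsm, hs0, mul_zero, nonpos_iff_eq_zero,
    lintegral_eq_zero_iff hm] at h1
  filter_upwards [h1] with q hq hκ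
  by_contra hPq
  rw [indicator_of_mem (hs hPq)] at hq
  simp at hq
  exact hκ hq

theorem ae_eq (h : IsTransferKernel μ ν m C κ θ) {f f' : α → ℝ} (hf : f =ᵐ[μ] f') :
    (fun q => κ q * f (θ q)) =ᵐ[ν.prod m] fun q => κ q * f' (θ q) := by
  filter_upwards [h.ae_of_ae hf] with q hq
  by_cases h0 : κ q = 0
  · simp [h0]
  · rw [hq h0]

theorem integrable_prod (h : IsTransferKernel μ ν m C κ θ) {f : α → ℝ} (hf : Integrable f μ) :
    Integrable (fun q => κ q * f (θ q)) (ν.prod m) := by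
  have hsm := hf.aestronglyMeasurable.stronglyMeasurable_mk
  have hae := h.ae_eq hf.aestronglyMeasurable.ae_eq_mk
  refine Integrable.congr ?_ hae.symm
  refine ⟨(h.measurable_weight.mul (hsm.measurable.comp h.measurable_map)).aestronglyMeasurable, ?_⟩
  have h1 := h.lintegral_prod_le hsm.measurable.enorm
  refine lt_of_le_of_lt ?_ (h1.trans_lt (ENNReal.mul_lt_top ENNReal.coe_lt_top
    (hf.congr hf.aestronglyMeasurable.ae_eq_mk).2))
  exact (lintegral_congr fun q => enorm_mul _ _).le

theorem integrable_integral (h : IsTransferKernel μ ν m C κ θ) {f : α → ℝ} (hf : Integrable f μ) :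
    Integrable (fun b => ∫ s, κ (b, s) * f (θ (b, s)) ∂m) ν :=
  (h.integrable_prod hf).integral_prod_left

theorem ae_integrable [SFinite ν] (h : IsTransferKernel μ ν m C κ θ) {f : α → ℝ} (hf : Integrable f μ) :
    ∀ᵐ b ∂ν, Integrable (fun s => κ (b, s) * f (θ (b, s))) m :=
  (h.integrable_prod hf).prod_right_ae

theorem integral_ae_eq (h : IsTransferKernel μ ν m C κ θ) {f f' : α → ℝ} (hf : f =ᵐ[μ] f') :
    (fun b => ∫ s, κ (b, s) * f (θ (b, s)) ∂m) =ᵐ[ν]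
      fun b => ∫ s, κ (b, s) * f' (θ (b, s)) ∂m := by
  filter_upwards [Measure.ae_ae_of_ae_prod (h.ae_eq hf)] with b hb
  exact integral_congr_ae hb

theorem lintegral_enorm_integral_le (h : IsTransferKernel μ ν m C κ θ) {f : α → ℝ}
    (hf : Integrable f μ) :
    ∫⁻ b, ‖∫ s, κ (b, s) * f (θ (b, s)) ∂m‖ₑ ∂ν ≤ C * ∫⁻ a, ‖f a‖ₑ ∂μ := by
  have hae := hf.aestronglyMeasurable.ae_eq_mk
  have hsm := hf.aestronglyMeasurable.stronglyMeasurable_mk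
  have h2 := h.integral_ae_eq hae
  calc ∫⁻ b, ‖∫ s, κ (b, s) * f (θ (b, s)) ∂m‖ₑ ∂ν
      = ∫⁻ b, ‖∫ s, κ (b, s) * hf.aestronglyMeasurable.mk f (θ (b, s)) ∂m‖ₑ ∂ν := by
        refine lintegral_congr_ae ?_
        filter_upwards [h2] with b hb
        rw [hb]
    _ ≤ ∫⁻ b, ∫⁻ s, ‖κ (b, s)‖ₑ * ‖hf.aestronglyMeasurable.mk f (θ (b, s))‖ₑ ∂m ∂ν := by
        refine lintegral_mono fun b => (enorm_integral_le_lintegral_enorm _).trans ?_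
        exact (lintegral_congr fun s => enorm_mul _ _).le
    _ ≤ C * ∫⁻ a, ‖hf.aestronglyMeasurable.mk f a‖ₑ ∂μ := h.bound _ hsm.measurable.enorm
    _ = C * ∫⁻ a, ‖f a‖ₑ ∂μ := by
        congr 1
        refine lintegral_congr_ae ?_
        filter_upwards [hae] with a ha
        rw [ha]

variable [SFinite ν]

/-- The bounded operator `L¹(μ) → L¹(ν)` of a transfer kernel. -/
def toCLM (h : IsTransferKernel μ ν m C κ θ) : Lp ℝ 1 μ →L[ℝ] Lp ℝ 1 ν :=
  LinearMap.mkContinuous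
    { toFun := fun f => (h.integrable_integral (L1.integrable_coeFn f)).toL1 _
      map_add' := fun f g => by
        rw [← Integrable.toL1_add, Integrable.toL1_eq_toL1_iff]
        refine (h.integral_ae_eq (Lp.coeFn_add f g)).trans ?_
        filter_upwards [h.ae_integrable (L1.integrable_coeFn f),
          h.ae_integrable (L1.integrable_coeFn g)] with b hf hg
        simp only [Pi.add_apply, mul_add]
        exact integral_add hf hg
      map_smul' := fun c f => by
        rw [RingHom.id_apply, ← Integrable.toL1_smul, Integrable.toL1_eq_toL1_iff]
        refine (h.integral_ae_eq (Lp.coeFn_smul c f)).trans (.of_forall fun b => ?_)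
        simp only [Pi.smul_apply, smul_eq_mul, mul_left_comm _ c]
        exact integral_const_mul c _ } C
    fun f => by
      change ‖(h.integrable_integral (L1.integrable_coeFn f)).toL1 _‖ ≤ C * ‖f‖
      rw [L1.norm_eq_integral_norm f, Integrable.norm_toL1_eq_lintegral_norm,
        integral_norm_eq_lintegral_enorm (L1.integrable_coeFn f).aestronglyMeasurable,
        ← ENNReal.coe_toReal, ← ENNReal.toReal_mul]
      simp only [ofReal_norm]
      exact ENNReal.toReal_mono (ENNReal.mul_ne_top ENNReal.coe_ne_top
        (L1.integrable_coeFn f).2.ne) (h.lintegral_enorm_integral_le (L1.integrable_coeFn f))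

theorem coeFn_toCLM (h : IsTransferKernel μ ν m C κ θ) (f : Lp ℝ 1 μ) :
    h.toCLM f =ᵐ[ν] fun b => ∫ s, κ (b, s) * f (θ (b, s)) ∂m :=
  (h.integrable_integral (L1.integrable_coeFn f)).coeFn_toL1

end IsTransferKernel

theorem lintegral_enorm_coeFn (f : Lp ℝ 1 μ) : ∫⁻ a, ‖f a‖ₑ ∂μ = ENNReal.ofReal ‖f‖ := by
  rw [L1.norm_eq_integral_norm f, ofReal_integral_norm_eq_lintegral_enorm (L1.integrable_coeFn f)]

end KernelOperators

/-! ### Attenuation along a line -/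

section Attenuation

/-- Optical depth of a line up to the parameter `t`, for the attenuation `a`. -/
def lineDepth (a : ℝ → ℝ) (t : ℝ) : ℝ := ∫ s in Iic t, a s

variable {a : ℝ → ℝ} {M : ℝ}

theorem lineDepth_sub (ha : Integrable a) (s t : ℝ) :
    lineDepth a t - lineDepth a s = ∫ r in s..t, a r :=
  intervalIntegral.integral_Iic_sub_Iic ha.integrableOn ha.integrableOn

theorem lineDepth_mono (ha : Integrable a) (h0 : ∀ t, 0 ≤ a t) : Monotone (lineDepth a) := by
  intro s t hst
  have h1 := lineDepth_sub ha s t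
  have h2 : 0 ≤ ∫ r in s..t, a r := intervalIntegral.integral_nonneg hst fun r _ => h0 r
  linarith

theorem lineDepth_nonneg (h0 : ∀ t, 0 ≤ a t) (t : ℝ) : 0 ≤ lineDepth a t :=
  integral_nonneg h0

theorem lineDepth_le_integral (ha : Integrable a) (h0 : ∀ t, 0 ≤ a t) (t : ℝ) :
    lineDepth a t ≤ ∫ s, a s :=
  setIntegral_le_integral ha (.of_forall h0)

theorem lipschitzWith_lineDepth (ha : Integrable a) (h0 : ∀ t, 0 ≤ a t) (hM : ∀ t, a t ≤ M) :
    LipschitzWith M.toNNReal (lineDepth a) := by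
  refine LipschitzWith.of_dist_le_mul fun t s => ?_
  rw [Real.dist_eq, Real.dist_eq, lineDepth_sub ha, Real.coe_toNNReal _ ((h0 0).trans (hM 0)),
    ← Real.norm_eq_abs (∫ r in s..t, a r)]
  exact intervalIntegral.norm_integral_le_of_norm_le_const fun r _ => by
    rw [Real.norm_of_nonneg (h0 r)]; exact hM r

theorem absolutelyContinuous_exp_comp {β : ℝ → ℝ} {K : NNReal} (hβ : LipschitzWith K β) (s t : ℝ) :
    AbsolutelyContinuousOnInterval (fun r => Real.exp (β r)) s t := by
  obtain ⟨B, hB⟩ := isCompact_uIcc.exists_bound_of_continuousOn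
    (f := β) (s := uIcc s t) hβ.continuous.continuousOn
  obtain ⟨L, hL⟩ := (Real.contDiff_exp (n := 1)).contDiffOn.exists_lipschitzOnWith (s := Icc (-B) B)
    (by decide) (convex_Icc _ _) isCompact_Icc
  have h1 : LipschitzOnWith (L * K) (Real.exp ∘ β) (uIcc s t) :=
    hL.comp hβ.lipschitzOnWith fun r hr => abs_le.1 (hB r hr)
  exact h1.absolutelyContinuousOnInterval

theorem ae_hasDerivAt_lineDepth (ha : Integrable a) :
    ∀ᵐ t : ℝ, HasDerivAt (lineDepth a) (a t) t := by
  filter_upwards [LocallyIntegrable.ae_hasDerivAt_integral ha.locallyIntegrable] with t ht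
  have h1 : lineDepth a = fun r => lineDepth a 0 + ∫ s in (0 : ℝ)..r, a s := by
    ext r
    rw [← lineDepth_sub ha]; ring
  rw [h1]
  exact (ht 0).const_add _

theorem integral_mul_exp_neg_lineDepth (ha : Integrable a) (h0 : ∀ t, 0 ≤ a t)
    (hM : ∀ t, a t ≤ M) (s t : ℝ) :
    ∫ r in s..t, a r * Real.exp (-lineDepth a r) =
      Real.exp (-lineDepth a s) - Real.exp (-lineDepth a t) := by
  have hL := (lipschitzWith_lineDepth ha h0 hM).neg
  have hAC := absolutelyContinuous_exp_comp hL s t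
  have h1 := hAC.integral_deriv_eq_sub
  have h2 : ∫ r in s..t, deriv (fun r => Real.exp ((-lineDepth a) r)) r
      = ∫ r in s..t, -(a r * Real.exp (-lineDepth a r)) := by
    refine intervalIntegral.integral_congr_ae ?_
    filter_upwards [ae_hasDerivAt_lineDepth ha] with r hr _
    rw [hr.neg.exp.deriv]
    simp; ring
  rw [h2, intervalIntegral.integral_neg] at h1
  simp only [Pi.neg_apply] at h1
  linarith

/-- The absorbed fraction of a beam is at most one. -/
theorem lintegral_mul_exp_neg_lineDepth_le (ha : Integrable a) (h0 : ∀ t, 0 ≤ a t)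
    (hM : ∀ t, a t ≤ M) :
    ∫⁻ s in Ioi 0, ENNReal.ofReal (a s * Real.exp (-lineDepth a s)) ≤
      ENNReal.ofReal (Real.exp (-lineDepth a 0)) := by
  have hc : Continuous fun s => Real.exp (-lineDepth a s) :=
    Real.continuous_exp.comp (lipschitzWith_lineDepth ha h0 hM).continuous.neg
  have hint : Integrable fun s => a s * Real.exp (-lineDepth a s) := by
    refine ha.mono (ha.aestronglyMeasurable.mul hc.aestronglyMeasurable) (.of_forall fun s => ?_)
    rw [norm_mul, Real.norm_of_nonneg (Real.exp_nonneg _)]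
    refine mul_le_of_le_one_right (norm_nonneg _) (Real.exp_le_one_iff.2 ?_)
    linarith [lineDepth_nonneg h0 s]
  rw [← ofReal_integral_eq_lintegral_ofReal hint.integrableOn
    (.of_forall fun s => mul_nonneg (h0 s) (Real.exp_nonneg _))]
  refine ENNReal.ofReal_le_ofReal ?_
  have ht := intervalIntegral_tendsto_integral_Ioi 0 hint.integrableOn Filter.tendsto_id
  refine le_of_tendsto' ht fun t => ?_
  rw [id, integral_mul_exp_neg_lineDepth ha h0 hM]
  linarith [Real.exp_nonneg (-lineDepth a t)]

/-- Variation of constants: the solution of `w' = -a w + q`. -/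
def lineSolution (a q : ℝ → ℝ) (φ t : ℝ) : ℝ :=
  Real.exp (-lineDepth a t) * (φ + ∫ s in (0 : ℝ)..t, q s / Real.exp (-lineDepth a s))

variable {q : ℝ → ℝ} {τ : ℝ}

theorem intervalIntegrable_div_exp (ha : Integrable a) (h0 : ∀ t, 0 ≤ a t)
    (hM : ∀ t, a t ≤ M) (hq : IntervalIntegrable q volume 0 τ) :
    IntervalIntegrable (fun s => q s / Real.exp (-lineDepth a s)) volume 0 τ := by
  have hc : Continuous fun s => (Real.exp (-lineDepth a s))⁻¹ :=
    (Real.continuous_exp.comp (lipschitzWith_lineDepth ha h0 hM).continuous.neg).inv₀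
      fun s => Real.exp_ne_zero _
  exact hq.mul_continuousOn hc.continuousOn

theorem absolutelyContinuous_lineSolution (ha : Integrable a) (h0 : ∀ t, 0 ≤ a t)
    (hM : ∀ t, a t ≤ M) (hq : IntervalIntegrable q volume 0 τ) (φ : ℝ) :
    AbsolutelyContinuousOnInterval (lineSolution a q φ) 0 τ := by
  have h1 := absolutelyContinuous_exp_comp (lipschitzWith_lineDepth ha h0 hM).neg 0 τ
  have h2 := (intervalIntegrable_div_exp ha h0 hM hq).absolutelyContinuousOnInterval_intervalIntegral
    (c := 0) left_mem_uIcc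
  have h3 : AbsolutelyContinuousOnInterval (fun _ : ℝ => φ) 0 τ :=
    ((LipschitzWith.const φ).lipschitzOnWith (s := uIcc 0 τ)).absolutelyContinuousOnInterval
  exact h1.mul (h3.add h2)

theorem ae_hasDerivAt_lineSolution (ha : Integrable a) (h0 : ∀ t, 0 ≤ a t)
    (hM : ∀ t, a t ≤ M) (hq : IntervalIntegrable q volume 0 τ) (φ : ℝ) :
    ∀ᵐ t : ℝ, t ∈ uIcc 0 τ →
      HasDerivAt (lineSolution a q φ) (-(a t * lineSolution a q φ t) + q t) t := by
  filter_upwards [ae_hasDerivAt_lineDepth ha,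
    (intervalIntegrable_div_exp ha h0 hM hq).ae_hasDerivAt_integral] with t h1 h2 ht
  have h3 := h1.neg.exp.mul ((h2 ht 0 left_mem_uIcc).const_add φ)
  refine h3.congr_deriv ?_
  have := Real.exp_ne_zero (-lineDepth a t)
  simp only [lineSolution, Pi.neg_apply]
  field_simp

theorem lineSolution_zero (φ : ℝ) (h : lineDepth a 0 = 0) : lineSolution a q φ 0 = φ := by
  simp [lineSolution, h]

/-- Uniqueness for the attenuation equation among absolutely continuous functions. -/
theorem eq_lineSolution (ha : Integrable a) (h0 : ∀ t, 0 ≤ a t)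
    (hM : ∀ t, a t ≤ M) (hq : IntervalIntegrable q volume 0 τ) (hτ : 0 ≤ τ)
    (hz : lineDepth a 0 = 0) {w : ℝ → ℝ}
    (hw : AbsolutelyContinuousOnInterval w 0 τ)
    (hw' : ∀ᵐ t : ℝ, t ∈ Ioo 0 τ → HasDerivAt w (-(a t * w t) + q t) t) {t : ℝ}
    (ht : t ∈ Icc 0 τ) : w t = lineSolution a q (w 0) t := by
  set z : ℝ → ℝ := fun s => Real.exp (lineDepth a s) * (w s - lineSolution a q (w 0) s) with hzdef
  have h1 := absolutelyContinuous_exp_comp (lipschitzWith_lineDepth ha h0 hM) 0 τ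
  have hzAC : AbsolutelyContinuousOnInterval z 0 τ :=
    h1.mul (hw.sub (absolutelyContinuous_lineSolution ha h0 hM hq (w 0)))
  have hne : ∀ c : ℝ, ∀ᵐ t : ℝ, t ≠ c := fun c => by simp [ae_iff, measure_singleton]
  have hz' : ∀ᵐ s : ℝ, s ∈ uIcc 0 τ → HasDerivAt z 0 s := by
    filter_upwards [hw', ae_hasDerivAt_lineSolution ha h0 hM hq (w 0), ae_hasDerivAt_lineDepth ha,
      hne 0, hne τ] with s e1 e2 e3 e4 e5 hs
    have hs' := hs
    rw [uIcc_of_le hτ] at hs'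
    have hsI : s ∈ Ioo 0 τ := ⟨lt_of_le_of_ne hs'.1 (Ne.symm e4), lt_of_le_of_ne hs'.2 e5⟩
    refine (e3.exp.mul ((e1 hsI).sub (e2 hs))).congr_deriv ?_
    simp only [Pi.sub_apply]
    ring
  obtain ⟨C, hC⟩ := hzAC.const_of_ae_hasDerivAt_zero hz'
  have hz0 : z 0 = 0 := by simp [hzdef, lineSolution_zero _ hz]
  have hzt : z t = 0 := by
    rw [hC t (by rwa [uIcc_of_le hτ]), ← hC 0 left_mem_uIcc, hz0]
  have := (mul_eq_zero.1 hzt).resolve_left (Real.exp_ne_zero _)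
  linarith

end Attenuation

/-! ### The transport operators -/

section Operators

variable {n : ℕ} {X : Set (Space n)} {M σ₀ d : ℝ} {c : Coeffs n}

/-- Coefficients satisfying the bounds everywhere, with an attenuation that vanishes outside `X`,
so that optical depths can be computed on whole lines. -/
structure Coeffs.IsRegular (X : Set (Space n)) (M : ℝ) (c : Coeffs n) : Prop where
  measurable_sigma : Measurable fun p : Space n × Dir n => c.sigma p.1 p.2
  measurable_k : Measurable fun p : Space n × Dir n × Dir n => c.k p.1 p.2.1 p.2.2
  sigma_nonneg : ∀ x v, 0 ≤ c.sigma x v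
  sigma_le : ∀ x v, c.sigma x v ≤ M
  k_nonneg : ∀ x v w, 0 ≤ c.k x v w
  k_le : ∀ x v w, c.k x v w ≤ M
  sigma_eq_zero : ∀ x v, x ∉ X → c.sigma x v = 0

/-- The attenuation along the line `t ↦ x + t v`. -/
def Coeffs.alongLine (c : Coeffs n) (x : Space n) (v : Dir n) (t : ℝ) : ℝ :=
  c.sigma (x + t • (v : Space n)) v

/-- The fraction of the radiation which arrives at `x` in the direction `v` unabsorbed. -/
def Coeffs.transmission (c : Coeffs n) (p : Space n × Dir n) : ℝ :=
  Real.exp (-lineDepth (c.alongLine p.1 p.2) 0)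

theorem volume_line_le (hd : ∀ x ∈ closure X, ∀ y ∈ closure X, dist x y ≤ d)
    (x : Space n) (v : Dir n) :
    volume {t : ℝ | x + t • (v : Space n) ∈ X} ≤ ENNReal.ofReal d := by
  refine (Real.volume_le_diam _).trans (ediam_le fun s hs t ht => ?_)
  rw [edist_dist]
  refine ENNReal.ofReal_le_ofReal ?_
  have := hd _ (subset_closure hs) _ (subset_closure ht)
  rwa [dist_add_left, dist_eq_norm, ← sub_smul, norm_smul, norm_dir, mul_one] at this

theorem Coeffs.measurable_alongLine (hm : Measurable fun p : Space n × Dir n => c.sigma p.1 p.2) :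
    Measurable fun q : (Space n × Dir n) × ℝ => c.alongLine q.1.1 q.1.2 q.2 := by
  have := hm.comp measurable_advect
  exact this

theorem Coeffs.measurable_transmission
    (hm : Measurable fun p : Space n × Dir n => c.sigma p.1 p.2) :
    Measurable c.transmission := by
  have h1 := (c.measurable_alongLine hm).stronglyMeasurable.integral_prod_right'
    (ν := volume.restrict (Iic (0 : ℝ)))
  have h2 := h1.measurable.neg.exp
  exact h2

theorem IsConvexDomain.integrable_of_line_bound (hX : IsConvexDomain X) {x : Space n} {v : Dir n}
    {a : ℝ → ℝ} (ham : Measurable a) {B : ℝ} (hB : ∀ t, |a t| ≤ B)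
    (h0 : ∀ t : ℝ, x + t • (v : Space n) ∉ X → a t = 0) : Integrable a := by
  obtain ⟨d, -, hd⟩ := hX.exists_diam_bound
  have hsub : Function.support a ⊆ {t : ℝ | x + t • (v : Space n) ∈ X} := by
    intro t ht
    by_contra h
    exact ht (h0 t h)
  rw [← integrableOn_iff_integrable_of_support_subset hsub]
  exact Measure.integrableOn_of_bounded
    ((volume_line_le hd x v).trans_lt ENNReal.ofReal_lt_top).ne
    ham.aestronglyMeasurable (.of_forall hB)

namespace Coeffs.IsRegular

variable (hc : c.IsRegular X M) (hX : IsConvexDomain X)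
include hc

theorem measurable_alongLine_right (x : Space n) (v : Dir n) : Measurable (c.alongLine x v) := by
  have := hc.measurable_sigma.comp ((measurable_advect_line x v).prodMk
    (measurable_const (a := v)))
  exact this

include hX in
theorem integrable_alongLine (x : Space n) (v : Dir n) : Integrable (c.alongLine x v) :=
  hX.integrable_of_line_bound (hc.measurable_alongLine_right x v) (B := M)
    (fun t => by
      rw [Coeffs.alongLine, abs_of_nonneg (hc.sigma_nonneg _ _)]
      exact hc.sigma_le _ _)
    fun t ht => hc.sigma_eq_zero _ _ ht

omit hc in
theorem lineDepth_translate (x : Space n) (v : Dir n) (s t : ℝ) :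
    lineDepth (c.alongLine (x + s • (v : Space n)) v) t = lineDepth (c.alongLine x v) (s + t) := by
  have h1 : ∀ r, c.alongLine (x + s • (v : Space n)) v r = c.alongLine x v (s + r) := by
    intro r
    rw [Coeffs.alongLine, Coeffs.alongLine, add_smul, add_assoc]
  rw [lineDepth, lineDepth, ← integral_indicator measurableSet_Iic,
    ← integral_indicator measurableSet_Iic,
    ← integral_add_left_eq_self ((Iic (s + t)).indicator (c.alongLine x v)) s]
  refine integral_congr_ae (.of_forall fun r => ?_)
  by_cases hr : r ≤ t
  · have h2 : s + r ∈ Iic (s + t) := by simpa using hr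
    simp only [indicator_of_mem h2, indicator_of_mem (mem_Iic.2 hr), h1]
  · have h2 : s + r ∉ Iic (s + t) := by simpa using hr
    simp only [indicator_of_notMem h2, indicator_of_notMem (show r ∉ Iic t from hr)]

omit hc in
theorem transmission_line (x : Space n) (v : Dir n) (t : ℝ) :
    c.transmission (x + t • (v : Space n), v) = Real.exp (-lineDepth (c.alongLine x v) t) := by
  rw [Coeffs.transmission, lineDepth_translate, add_zero]

omit hc in
theorem transmission_pos (p : Space n × Dir n) : 0 < c.transmission p := Real.exp_pos _

theorem transmission_le_one (p : Space n × Dir n) : c.transmission p ≤ 1 := by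
  refine Real.exp_le_one_iff.2 ?_
  have := lineDepth_nonneg (a := c.alongLine p.1 p.2) (fun t => hc.sigma_nonneg _ _) 0
  linarith

include hX in
theorem transmission_div_le_one (x : Space n) (v : Dir n) {s : ℝ} (hs : 0 ≤ s) :
    c.transmission (x, v) / c.transmission (x - s • (v : Space n), v) ≤ 1 := by
  refine div_le_one_of_le₀ ?_ (transmission_pos _).le
  have h1 := transmission_line (c := c) x v (-s)
  have h2 := transmission_line (c := c) x v 0
  rw [zero_smul, add_zero] at h2
  rw [neg_smul, ← sub_eq_add_neg] at h1
  rw [h1, h2, Real.exp_le_exp, neg_le_neg_iff]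
  exact lineDepth_mono (hc.integrable_alongLine hX x v) (fun t => hc.sigma_nonneg _ _)
    (by linarith)

end Coeffs.IsRegular

/-- Translation along the characteristics preserves `dx dv`. -/
theorem lintegral_translate {m : Measure ℝ} [SFinite m]
    {F : (Space n × Dir n) × ℝ → ℝ≥0∞} (hF : Measurable F) :
    ∫⁻ p, ∫⁻ s, F ((p.1 - s • (p.2 : Space n), p.2), s) ∂m
        ∂((volume : Measure (Space n)).prod (dirMeasure n)) =
      ∫⁻ p, ∫⁻ s, F (p, s) ∂m ∂((volume : Measure (Space n)).prod (dirMeasure n)) := by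
  have hc : Continuous fun q : (Space n × Dir n) × ℝ =>
    ((q.1.1 - q.2 • (q.1.2 : Space n), q.1.2), q.2) := by fun_prop
  have h1 : Measurable fun q : (Space n × Dir n) × ℝ =>
      F ((q.1.1 - q.2 • (q.1.2 : Space n), q.1.2), q.2) := hF.comp hc.measurable
  rw [lintegral_lintegral_swap h1.aemeasurable,
    lintegral_lintegral_swap (f := fun p s => F (p, s)) hF.aemeasurable]
  refine lintegral_congr fun s => ?_
  have h2 : Measurable fun p : Space n × Dir n => F ((p.1 - s • (p.2 : Space n), p.2), s) :=
    h1.comp measurable_prodMk_right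
  have h3 : Measurable fun p : Space n × Dir n => F (p, s) := hF.comp measurable_prodMk_right
  rw [lintegral_prod_symm _ h2.aemeasurable, lintegral_prod_symm _ h3.aemeasurable]
  refine lintegral_congr fun v => ?_
  exact lintegral_sub_right_eq_self (fun x => F ((x, v), s)) (s • (v : Space n))

theorem phaseMeasure_eq_restrict (X : Set (Space n)) :
    phaseMeasure X = ((volume : Measure (Space n)).prod (dirMeasure n)).restrict
      (Prod.fst ⁻¹' X) := by
  rw [phaseMeasure, spaceMeasure, ← prod_univ, ← Measure.prod_restrict, Measure.restrict_univ]

theorem lintegral_phaseMeasure_eq (hX : IsOpen X) (g : Space n × Dir n → ℝ≥0∞) :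
    ∫⁻ p, g p ∂phaseMeasure X = ∫⁻ p, (Prod.fst ⁻¹' X).indicator g p
      ∂((volume : Measure (Space n)).prod (dirMeasure n)) := by
  rw [phaseMeasure_eq_restrict, lintegral_indicator (measurable_fst hX.measurableSet)]

/-- The weight of the integral operator solving the transport equation without boundary
radiation. -/
def Coeffs.streamWeight (X : Set (Space n)) (c : Coeffs n) (q : (Space n × Dir n) × ℝ) : ℝ :=
  (Prod.fst ⁻¹' X).indicator (fun p => c.transmission q.1 / c.transmission p)
    (q.1.1 - q.2 • (q.1.2 : Space n), q.1.2)

/-- The point from which the radiation arriving at `(x, v)` was emitted a time `s` before. -/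
def upstream (q : (Space n × Dir n) × ℝ) : Space n × Dir n :=
  (q.1.1 - q.2 • (q.1.2 : Space n), q.1.2)

theorem continuous_upstream : Continuous (upstream (n := n)) := by
  unfold upstream; fun_prop

theorem measurable_upstream : Measurable (upstream (n := n)) := continuous_upstream.measurable

namespace Coeffs.IsRegular

theorem measurable_streamWeight (hc : c.IsRegular X M) (hX : IsOpen X) :
    Measurable (c.streamWeight X) := by
  have hE := c.measurable_transmission hc.measurable_sigma
  have h1 : Measurable fun q : (Space n × Dir n) × ℝ =>
      c.transmission q.1 / c.transmission (upstream q) :=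
    (hE.comp measurable_fst).div (hE.comp measurable_upstream)
  have h2 : c.streamWeight X = (upstream ⁻¹' (Prod.fst ⁻¹' X)).indicator
      fun q => c.transmission q.1 / c.transmission (upstream q) := by
    ext q
    rfl
  rw [h2]
  exact h1.indicator (measurable_upstream (measurable_fst hX.measurableSet))

theorem streamWeight_nonneg (q : (Space n × Dir n) × ℝ) : 0 ≤ c.streamWeight X q :=
  indicator_nonneg (fun _ _ => (div_pos (transmission_pos _) (transmission_pos _)).le) _

theorem streamWeight_le_one (hc : c.IsRegular X M) (hX : IsConvexDomain X)
    (p : Space n × Dir n) {s : ℝ} (hs : 0 ≤ s) : c.streamWeight X (p, s) ≤ 1 := by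
  rw [Coeffs.streamWeight]
  by_cases h : (p.1 - s • (p.2 : Space n), p.2) ∈ Prod.fst ⁻¹' X
  · rw [indicator_of_mem h]
    exact hc.transmission_div_le_one hX p.1 p.2 hs
  · rw [indicator_of_notMem h]
    exact zero_le_one

theorem streamWeight_eq_zero {q : (Space n × Dir n) × ℝ} (h : (upstream q).1 ∉ X) :
    c.streamWeight X q = 0 :=
  indicator_of_notMem (s := Prod.fst ⁻¹' X) h _

end Coeffs.IsRegular

/-- Upper bound for an integral over the upstream points by means of the downstream ones. -/
theorem lintegral_upstream_le (hX : IsOpen X) {m : Measure ℝ} [SFinite m]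
    {H : (Space n × Dir n) × ℝ → ℝ≥0∞} (hH : Measurable H)
    (hH0 : ∀ q, (upstream q).1 ∉ X → H q = 0) {g : Space n × Dir n → ℝ≥0∞} (hg : Measurable g) :
    ∫⁻ p, ∫⁻ s, H (p, s) * g (upstream (p, s)) ∂m ∂phaseMeasure X ≤
      ∫⁻ p, g p * ∫⁻ s, H ((p.1 + s • (p.2 : Space n), p.2), s) ∂m ∂phaseMeasure X := by
  have hc : Continuous fun q : (Space n × Dir n) × ℝ =>
    ((q.1.1 + q.2 • (q.1.2 : Space n), q.1.2), q.2) := by fun_prop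
  have hH1 : Measurable fun q : (Space n × Dir n) × ℝ =>
      H ((q.1.1 + q.2 • (q.1.2 : Space n), q.1.2), q.2) := hH.comp hc.measurable
  have hF : Measurable fun q : (Space n × Dir n) × ℝ =>
      H ((q.1.1 + q.2 • (q.1.2 : Space n), q.1.2), q.2) * g q.1 :=
    hH1.mul (hg.comp measurable_fst)
  have h1 := lintegral_translate (m := m) hF
  simp only [sub_add_cancel] at h1
  calc ∫⁻ p, ∫⁻ s, H (p, s) * g (upstream (p, s)) ∂m ∂phaseMeasure X
      ≤ ∫⁻ p, ∫⁻ s, H (p, s) * g (upstream (p, s)) ∂m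
          ∂((volume : Measure (Space n)).prod (dirMeasure n)) := by
        rw [phaseMeasure_eq_restrict]
        exact lintegral_mono' Measure.restrict_le_self le_rfl
    _ = ∫⁻ p, ∫⁻ s, H ((p.1 + s • (p.2 : Space n), p.2), s) * g p ∂m
          ∂((volume : Measure (Space n)).prod (dirMeasure n)) := h1
    _ = _ := by
        rw [lintegral_phaseMeasure_eq hX]
        refine lintegral_congr fun p => ?_
        have h2 : Measurable fun s : ℝ => H ((p.1 + s • (p.2 : Space n), p.2), s) :=
          hH1.comp measurable_prodMk_left
        rw [lintegral_mul_const _ h2, mul_comm]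
        by_cases hp : p.1 ∈ X
        · rw [indicator_of_mem (show p ∈ Prod.fst ⁻¹' X from hp)]
        · rw [indicator_of_notMem (show p ∉ Prod.fst ⁻¹' X from hp)]
          have : ∀ s : ℝ, H ((p.1 + s • (p.2 : Space n), p.2), s) = 0 := by
            intro s
            refine hH0 _ ?_
            simpa [upstream] using hp
          simp [this]

namespace Coeffs.IsRegular

theorem lintegral_streamWeight_le (hc : c.IsRegular X M) (hX : IsConvexDomain X)
    (hd : ∀ x ∈ closure X, ∀ y ∈ closure X, dist x y ≤ d) {g : Space n × Dir n → ℝ≥0∞}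
    (hg : Measurable g) :
    ∫⁻ p, (∫⁻ s in Ioi (0 : ℝ), ‖c.streamWeight X (p, s)‖ₑ * g (upstream (p, s)))
      ∂phaseMeasure X ≤
      ENNReal.ofReal d * ∫⁻ p, g p ∂phaseMeasure X := by
  have hXm := hX.isOpen.measurableSet
  set H : (Space n × Dir n) × ℝ → ℝ≥0∞ := fun q =>
    (Prod.fst ⁻¹' (Prod.fst ⁻¹' X)).indicator (fun q => ‖c.streamWeight X q‖ₑ) q with hHdef
  have hH : Measurable H := (hc.measurable_streamWeight hX.isOpen).enorm.indicator
    (measurable_fst (measurable_fst hXm))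
  have h1 := lintegral_upstream_le (X := X) (m := volume.restrict (Ioi (0 : ℝ))) hX.isOpen hH
    (fun q hq => by
      simp only [hHdef, indicator]
      rw [streamWeight_eq_zero hq]; simp) hg
  have h2 : ∫⁻ p, (∫⁻ s in Ioi (0 : ℝ), ‖c.streamWeight X (p, s)‖ₑ * g (upstream (p, s)))
      ∂phaseMeasure X = ∫⁻ p, (∫⁻ s in Ioi (0 : ℝ), H (p, s) * g (upstream (p, s)))
      ∂phaseMeasure X := by
    refine lintegral_congr_ae ?_
    filter_upwards [ae_phase_mem hX] with p hp
    refine lintegral_congr fun s => ?_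
    rw [hHdef]
    simp only
    rw [indicator_of_mem (show (p, s) ∈ Prod.fst ⁻¹' (Prod.fst ⁻¹' X) from hp)]
  rw [h2]
  refine h1.trans ?_
  rw [← lintegral_const_mul _ hg]
  refine lintegral_mono fun p => ?_
  rw [mul_comm]
  gcongr
  calc ∫⁻ s in Ioi (0 : ℝ), H ((p.1 + s • (p.2 : Space n), p.2), s)
      ≤ ∫⁻ s in Ioi (0 : ℝ), {t : ℝ | p.1 + t • (p.2 : Space n) ∈ X}.indicator 1 s := by
        refine setLIntegral_mono' measurableSet_Ioi fun s hs => ?_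
        rw [hHdef]
        simp only
        by_cases h : p.1 + s • (p.2 : Space n) ∈ X
        · rw [indicator_of_mem (show s ∈ {t : ℝ | p.1 + t • (p.2 : Space n) ∈ X} from h)]
          refine (indicator_le_self _ _ _).trans ?_
          rw [Real.enorm_of_nonneg (streamWeight_nonneg _)]
          exact ENNReal.ofReal_le_one.2 (hc.streamWeight_le_one hX _ (le_of_lt hs))
        · rw [indicator_of_notMem]
          · exact zero_le
          · exact h
    _ ≤ ∫⁻ s, {t : ℝ | p.1 + t • (p.2 : Space n) ∈ X}.indicator 1 s :=
        lintegral_mono' Measure.restrict_le_self le_rfl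
    _ = volume {t : ℝ | p.1 + t • (p.2 : Space n) ∈ X} :=
        lintegral_indicator_one (measurable_advect_line p.1 p.2 hXm)
    _ ≤ ENNReal.ofReal d := volume_line_le hd _ _

/-- Particles are absorbed at most once: the total absorption of the streamed radiation is at most
its source. -/
theorem lintegral_sigma_streamWeight_le (hc : c.IsRegular X M) (hX : IsConvexDomain X)
    {g : Space n × Dir n → ℝ≥0∞} (hg : Measurable g) :
    ∫⁻ p, ENNReal.ofReal (c.sigma p.1 p.2) * (∫⁻ s in Ioi (0 : ℝ),
      ‖c.streamWeight X (p, s)‖ₑ * g (upstream (p, s))) ∂phaseMeasure X ≤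
      ∫⁻ p, g p ∂phaseMeasure X := by
  have hκ := hc.measurable_streamWeight hX.isOpen
  set H : (Space n × Dir n) × ℝ → ℝ≥0∞ := fun q =>
    ENNReal.ofReal (c.sigma q.1.1 q.1.2) * ‖c.streamWeight X q‖ₑ with hHdef
  have hH : Measurable H :=
    (hc.measurable_sigma.comp measurable_fst).ennreal_ofReal.mul hκ.enorm
  have h1 := lintegral_upstream_le (X := X) (m := volume.restrict (Ioi (0 : ℝ))) hX.isOpen hH
    (fun q hq => by
      simp only [hHdef]
      rw [streamWeight_eq_zero hq]; simp) hg
  have h2 : ∫⁻ p, ENNReal.ofReal (c.sigma p.1 p.2) * (∫⁻ s in Ioi (0 : ℝ),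
      ‖c.streamWeight X (p, s)‖ₑ * g (upstream (p, s))) ∂phaseMeasure X =
      ∫⁻ p, (∫⁻ s in Ioi (0 : ℝ), H (p, s) * g (upstream (p, s))) ∂phaseMeasure X := by
    refine lintegral_congr fun p => ?_
    rw [← lintegral_const_mul' _ _ ENNReal.ofReal_ne_top]
    exact lintegral_congr fun s => (mul_assoc _ _ _).symm
  rw [h2]
  refine h1.trans (lintegral_mono fun p => ?_)
  refine mul_le_of_le_one_right' ?_
  have hE := transmission_pos (c := c) p
  calc ∫⁻ s in Ioi (0 : ℝ), H ((p.1 + s • (p.2 : Space n), p.2), s)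
      ≤ ∫⁻ s in Ioi (0 : ℝ), ENNReal.ofReal (c.transmission p)⁻¹ * ENNReal.ofReal
          (c.alongLine p.1 p.2 s * Real.exp (-lineDepth (c.alongLine p.1 p.2) s)) := by
        refine lintegral_mono fun s => ?_
        have h4 : c.streamWeight X ((p.1 + s • (p.2 : Space n), p.2), s) ≤
            Real.exp (-lineDepth (c.alongLine p.1 p.2) s) * (c.transmission p)⁻¹ := by
          rw [Coeffs.streamWeight, transmission_line, add_sub_cancel_right]
          exact indicator_le_self' (s := Prod.fst ⁻¹' X)
            (f := fun p' => Real.exp (-lineDepth (c.alongLine p.1 p.2) s) / c.transmission p')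
            (fun p' _ => (div_pos (Real.exp_pos _) (transmission_pos _)).le) p
        have h5 : c.sigma (p.1 + s • (p.2 : Space n)) p.2 = c.alongLine p.1 p.2 s := rfl
        simp only [hHdef]
        rw [Real.enorm_of_nonneg (streamWeight_nonneg _), h5,
          ← ENNReal.ofReal_mul (show 0 ≤ c.alongLine p.1 p.2 s from hc.sigma_nonneg _ _),
          ← ENNReal.ofReal_mul (inv_pos.2 hE).le]
        refine ENNReal.ofReal_le_ofReal ?_
        calc _ ≤ c.alongLine p.1 p.2 s *
              (Real.exp (-lineDepth (c.alongLine p.1 p.2) s) * (c.transmission p)⁻¹) :=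
              mul_le_mul_of_nonneg_left h4 (hc.sigma_nonneg _ _)
          _ = _ := by ring
    _ = ENNReal.ofReal (c.transmission p)⁻¹ * ∫⁻ s in Ioi (0 : ℝ), ENNReal.ofReal
          (c.alongLine p.1 p.2 s * Real.exp (-lineDepth (c.alongLine p.1 p.2) s)) :=
        lintegral_const_mul' _ _ ENNReal.ofReal_ne_top
    _ ≤ ENNReal.ofReal (c.transmission p)⁻¹ * ENNReal.ofReal (c.transmission p) := by
        gcongr
        exact lintegral_mul_exp_neg_lineDepth_le (hc.integrable_alongLine hX p.1 p.2)
          (fun t => hc.sigma_nonneg _ _) (fun t => hc.sigma_le _ _)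
    _ = 1 := by
        rw [← ENNReal.ofReal_mul (inv_pos.2 hE).le, inv_mul_cancel₀ hE.ne', ENNReal.ofReal_one]

theorem isTransferKernel_stream (hc : c.IsRegular X M) (hX : IsConvexDomain X)
    (hd : ∀ x ∈ closure X, ∀ y ∈ closure X, dist x y ≤ d) :
    IsTransferKernel (phaseMeasure X) (phaseMeasure X) (volume.restrict (Ioi (0 : ℝ)))
      d.toNNReal (c.streamWeight X) upstream :=
  ⟨hc.measurable_streamWeight hX.isOpen, measurable_upstream,
    fun _ hg => hc.lintegral_streamWeight_le hX hd hg⟩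

theorem isTransferKernel_ballistic (hc : c.IsRegular X M) (hX : IsConvexDomain X) (hn : 1 ≤ n)
    (hd : ∀ x ∈ closure X, ∀ y ∈ closure X, dist x y ≤ d) :
    IsTransferKernel (incomingMeasure X) (phaseMeasure X) (Measure.dirac ())
      d.toNNReal (fun q => c.transmission q.1) (fun q => (entryPoint X q.1.1 q.1.2, q.1.2)) where
  measurable_weight := (c.measurable_transmission hc.measurable_sigma).comp measurable_fst
  measurable_map := ((measurable_entryPoint hX.isOpen).comp measurable_fst).prodMk
    (measurable_snd.comp measurable_fst)
  bound g hg := by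
    refine le_trans ?_ (hX.lintegral_entryPoint_le hn hd hg)
    refine lintegral_mono fun p => ?_
    rw [lintegral_dirac, Real.enorm_of_nonneg (transmission_pos p).le]
    exact mul_le_of_le_one_left' (ENNReal.ofReal_le_one.2 (hc.transmission_le_one p))

theorem isTransferKernel_scattering (hc : c.IsRegular X M) :
    IsTransferKernel (phaseMeasure X) (phaseMeasure X) (dirMeasure n)
      (M.toNNReal * (dirMeasure n univ).toNNReal) (fun q => c.k q.1.1 q.2 q.1.2)
      (fun q => (q.1.1, q.2)) where
  measurable_weight := by
    have h : Measurable fun q : (Space n × Dir n) × Dir n => (q.1.1, q.2, q.1.2) := by fun_prop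
    exact hc.measurable_k.comp h
  measurable_map := by fun_prop
  bound g hg := by
    have hg' : Measurable fun x => ∫⁻ v, g (x, v) ∂dirMeasure n := hg.lintegral_prod_right'
    calc ∫⁻ p, ∫⁻ v', ‖c.k p.1 v' p.2‖ₑ * g (p.1, v') ∂dirMeasure n ∂phaseMeasure X
        ≤ ∫⁻ p, ENNReal.ofReal M * ∫⁻ v', g (p.1, v') ∂dirMeasure n ∂phaseMeasure X := by
          refine lintegral_mono fun p => ?_
          rw [← lintegral_const_mul' _ _ ENNReal.ofReal_ne_top]
          refine lintegral_mono fun v' => ?_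
          gcongr
          rw [Real.enorm_of_nonneg (hc.k_nonneg _ _ _)]
          exact ENNReal.ofReal_le_ofReal (hc.k_le _ _ _)
      _ = ENNReal.ofReal M * (∫⁻ x, (∫⁻ v', g (x, v') ∂dirMeasure n) * dirMeasure n univ
            ∂spaceMeasure X) := by
          have h2 : Measurable fun p : Space n × Dir n => ∫⁻ v, g (p.1, v) ∂dirMeasure n :=
            hg'.comp measurable_fst
          rw [lintegral_const_mul' _ _ ENNReal.ofReal_ne_top, phaseMeasure,
            lintegral_prod _ h2.aemeasurable]
          simp
      _ = _ := by
          rw [lintegral_mul_const _ hg', phaseMeasure, lintegral_prod _ hg.aemeasurable,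
            ENNReal.coe_mul, ENNReal.coe_toNNReal (measure_ne_top _ _)]
          change _ = ENNReal.ofReal M * _ * _
          ring

theorem sigmaS_nonneg (hc : c.IsRegular X M) (x : Space n) (v : Dir n) : 0 ≤ c.sigmaS x v :=
  integral_nonneg fun w => hc.k_nonneg x v w

theorem sigmaS_le (hc : c.IsRegular X M) (x : Space n) (v : Dir n) :
    c.sigmaS x v ≤ M * (dirMeasure n).real univ := by
  have := norm_integral_le_of_norm_le_const (μ := dirMeasure n) (f := fun w => c.k x v w) (C := M)
    (.of_forall fun w => by
      rw [Real.norm_of_nonneg (hc.k_nonneg x v w)]; exact hc.k_le x v w)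
  exact (le_abs_self _).trans this

theorem measurable_sigmaA (hc : c.IsRegular X M) :
    Measurable fun p : Space n × Dir n => c.sigmaA p.1 p.2 := by
  have h : Measurable fun q : (Space n × Dir n) × Dir n => (q.1.1, q.1.2, q.2) := by fun_prop
  have h1 := (hc.measurable_k.comp h).stronglyMeasurable.integral_prod_right'
    (ν := dirMeasure n)
  exact hc.measurable_sigma.sub h1.measurable

theorem abs_sigmaA_le (hc : c.IsRegular X M) (x : Space n) (v : Dir n) :
    |c.sigmaA x v| ≤ M + M * (dirMeasure n).real univ := by
  have h1 := hc.sigmaS_nonneg x v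
  have h2 := hc.sigmaS_le x v
  have h3 := hc.sigma_nonneg x v
  have h4 := hc.sigma_le x v
  rw [Coeffs.sigmaA, abs_le]
  constructor <;> linarith

theorem isTransferKernel_absorption (hc : c.IsRegular X M) :
    IsTransferKernel (phaseMeasure X) (spaceMeasure X) (dirMeasure n)
      (M + M * (dirMeasure n).real univ).toNNReal (fun q => c.sigmaA q.1 q.2) id where
  measurable_weight := hc.measurable_sigmaA
  measurable_map := measurable_id
  bound g hg := by
    rw [phaseMeasure, lintegral_prod _ hg.aemeasurable,
      ← lintegral_const_mul' _ _ ENNReal.coe_ne_top]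
    refine lintegral_mono fun x => ?_
    rw [← lintegral_const_mul' _ _ ENNReal.coe_ne_top]
    refine lintegral_mono fun v => ?_
    gcongr
    · rw [← ofReal_norm, Real.norm_eq_abs]
      exact ENNReal.ofReal_le_ofReal (hc.abs_sigmaA_le x v)
    · rfl

end Coeffs.IsRegular

end Operators

/-! ### Solvability of the transport equation -/

section Solvability

variable {n : ℕ} {X : Set (Space n)} {M σ₀ : ℝ} {c : Coeffs n}

/-- An upper bound for the length of the chords of `X`. -/
def chordBound (X : Set (Space n)) : ℝ := diam (closure X) + 1

theorem chordBound_pos (X : Set (Space n)) : 0 < chordBound X := by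
  unfold chordBound; positivity

theorem IsConvexDomain.dist_le_chordBound (hX : IsConvexDomain X) :
    ∀ x ∈ closure X, ∀ y ∈ closure X, dist x y ≤ chordBound X := fun x hx y hy => by
  have := dist_le_diam_of_mem hX.isBounded.closure hx hy
  rw [chordBound]; linarith

theorem IsConvexDomain.aemeasurable_lintegral_chord (hX : IsConvexDomain X)
    {g : Space n × Dir n → ℝ≥0∞} (hg : Measurable g) :
    AEMeasurable (fun p : Space n × Dir n => ∫⁻ t in Ioo 0 (exitTime X p.1 p.2),
      g (p.1 + t • (p.2 : Space n), p.2)) (incomingMeasure X) := by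
  have h2 : Measurable ((Prod.fst ⁻¹' X).indicator g) :=
    hg.indicator (measurable_fst hX.isOpen.measurableSet)
  have h3 := (h2.comp measurable_advect).lintegral_prod_right' (ν := volume)
  refine ⟨_, h3, ?_⟩
  filter_upwards [hX.ae_incoming] with p hp
  exact (hX.lintegral_line_indicator hp (fun x => g (x, p.2))).symm

theorem IsConvexDomain.ae_integrableOn_chord (hX : IsConvexDomain X) (hn : 1 ≤ n)
    (q : L1Phase X) : ∀ᵐ p ∂incomingMeasure X,
      IntegrableOn (fun t : ℝ => q (p.1 + t • (p.2 : Space n), p.2))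
        (Ioo 0 (exitTime X p.1 p.2)) := by
  have hq := Lp.stronglyMeasurable q
  have h1 := hX.lintegral_phaseMeasure hn hq.measurable.enorm
  have h2 := ae_lt_top' (hX.aemeasurable_lintegral_chord hq.measurable.enorm)
    (by rw [← h1]; exact (L1.integrable_coeFn q).2.ne)
  filter_upwards [h2] with p hp
  refine ⟨?_, hp⟩
  have hm : Measurable fun t : ℝ => (p.1 + t • (p.2 : Space n), p.2) :=
    (measurable_advect_line p.1 p.2).prodMk measurable_const
  exact (hq.measurable.comp hm).aestronglyMeasurable

namespace Coeffs.IsRegular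

theorem lineDepth_zero_of_incoming (hc : c.IsRegular X M) (hX : IsConvexDomain X) {x : Space n}
    {v : Dir n} (hp : (x, v) ∈ incoming X) : lineDepth (c.alongLine x v) 0 = 0 := by
  refine setIntegral_eq_zero_of_forall_eq_zero fun t ht => ?_
  refine hc.sigma_eq_zero _ _ fun h => ?_
  exact absurd ((hX.mem_iff_of_incoming hp t).1 h).1 (not_lt.2 ht)

theorem integral_streamWeight_line (hX : IsConvexDomain X) {x : Space n}
    {v : Dir n} (hp : (x, v) ∈ incoming X) {t : ℝ} (ht : t ∈ Ioo 0 (exitTime X x v))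
    (f : Space n × Dir n → ℝ) :
    ∫ s in Ioi (0 : ℝ), c.streamWeight X ((x + t • (v : Space n), v), s) *
        f (upstream ((x + t • (v : Space n), v), s)) =
      Real.exp (-lineDepth (c.alongLine x v) t) * ∫ r in (0 : ℝ)..t,
        f (x + r • (v : Space n), v) / Real.exp (-lineDepth (c.alongLine x v) r) := by
  have hup : ∀ s : ℝ, upstream ((x + t • (v : Space n), v), s) =
      (x + (t - s) • (v : Space n), v) := by
    intro s
    rw [upstream, sub_smul, add_sub_assoc]
  have hmem : ∀ s : ℝ, (upstream ((x + t • (v : Space n), v), s)).1 ∈ X ↔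
      t - s ∈ Ioo 0 (exitTime X x v) := by
    intro s
    rw [hup, hX.mem_iff_of_incoming hp]
  have hsub := intervalIntegral.integral_comp_sub_left (fun r =>
    Real.exp (-lineDepth (c.alongLine x v) t) * (f (x + r • (v : Space n), v) /
      Real.exp (-lineDepth (c.alongLine x v) r))) (a := 0) (b := t) t
  rw [sub_self, sub_zero] at hsub
  rw [← intervalIntegral.integral_const_mul, ← hsub, intervalIntegral.integral_of_le ht.1.le,
    integral_Ioc_eq_integral_Ioo,
    setIntegral_eq_of_subset_of_forall_sdiff_eq_zero (s := Ioo 0 t) (t := Ioi (0 : ℝ))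
      measurableSet_Ioi (fun s hs => hs.1)]
  · refine setIntegral_congr_fun measurableSet_Ioo fun s hs => ?_
    have h1 : t - s ∈ Ioo 0 (exitTime X x v) := ⟨by linarith [hs.2], by linarith [hs.1, ht.2]⟩
    have h2 : c.streamWeight X ((x + t • (v : Space n), v), s) =
        Real.exp (-lineDepth (c.alongLine x v) t) /
          Real.exp (-lineDepth (c.alongLine x v) (t - s)) := by
      have h3 : c.streamWeight X ((x + t • (v : Space n), v), s) =
          c.transmission (x + t • (v : Space n), v) /
            c.transmission (upstream ((x + t • (v : Space n), v), s)) :=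
        indicator_of_mem (s := Prod.fst ⁻¹' X) ((hmem s).2 h1) _
      rw [h3, hup, transmission_line, transmission_line]
    rw [h2, hup]
    ring
  · intro s hs
    have h1 : (upstream ((x + t • (v : Space n), v), s)).1 ∉ X := by
      rw [hmem]
      intro h
      exact hs.2 ⟨hs.1, by linarith [h.1]⟩
    rw [streamWeight_eq_zero h1, zero_mul]

variable (hc : c.IsRegular X M) (hX : IsConvexDomain X) (hn : 1 ≤ n)

/-- The operator of free flight from the boundary: it solves `v · ∇u + σ u = 0` with `u = φ` on
`Γ_-`. -/
def ballisticOp : L1In X →L[ℝ] L1Phase X :=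
  (hc.isTransferKernel_ballistic hX hn hX.dist_le_chordBound).toCLM

/-- The operator solving `v · ∇u + σ u = q` with `u = 0` on `Γ_-`. -/
def streamOp : L1Phase X →L[ℝ] L1Phase X :=
  (hc.isTransferKernel_stream hX hX.dist_le_chordBound).toCLM

/-- The scattering operator `u ↦ ∫ k(x, v', v) u(x, v') dv'`. -/
def scatterOp : L1Phase X →L[ℝ] L1Phase X := (hc.isTransferKernel_scattering (X := X)).toCLM

/-- The operator `u ↦ ∫ σ_a(x, v) u(x, v) dv`. -/
def absorbOp : L1Phase X →L[ℝ] L1Space X := (hc.isTransferKernel_absorption (X := X)).toCLM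

theorem coeFn_ballisticOp (φ : L1In X) : hc.ballisticOp hX hn φ =ᵐ[phaseMeasure X]
    fun p => c.transmission p * φ (entryPoint X p.1 p.2, p.2) := by
  refine (IsTransferKernel.coeFn_toCLM _ φ).trans (.of_forall fun p => ?_)
  exact integral_dirac (fun _ : Unit => c.transmission p * φ (entryPoint X p.1 p.2, p.2)) ()

theorem coeFn_streamOp (q : L1Phase X) : hc.streamOp hX q =ᵐ[phaseMeasure X]
    fun p => ∫ s in Ioi (0 : ℝ), c.streamWeight X (p, s) * q (upstream (p, s)) :=
  IsTransferKernel.coeFn_toCLM _ q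

theorem coeFn_scatterOp (u : L1Phase X) : hc.scatterOp u =ᵐ[phaseMeasure X]
    fun p => ∫ v', c.k p.1 v' p.2 * u (p.1, v') ∂dirMeasure n :=
  IsTransferKernel.coeFn_toCLM _ u

theorem coeFn_absorbOp (u : L1Phase X) : hc.absorbOp u =ᵐ[spaceMeasure X]
    fun x => ∫ v, c.sigmaA x v * u (x, v) ∂dirMeasure n :=
  IsTransferKernel.coeFn_toCLM _ u

/-- Along almost every characteristic, the solution of `v · ∇u + σ u = q` with `u = φ` on `Γ_-` is
given by the variation of constants formula. -/
theorem ae_line_ballistic_add_stream (φ : L1In X) (q : L1Phase X) :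
    ∀ᵐ p ∂incomingMeasure X, ∀ᵐ t : ℝ, t ∈ Ioo 0 (exitTime X p.1 p.2) →
      (hc.ballisticOp hX hn φ + hc.streamOp hX q : L1Phase X) (p.1 + t • (p.2 : Space n), p.2) =
        lineSolution (c.alongLine p.1 p.2) (fun t => q (p.1 + t • (p.2 : Space n), p.2)) (φ p)
          t := by
  have h1 : (hc.ballisticOp hX hn φ + hc.streamOp hX q : L1Phase X) =ᵐ[phaseMeasure X]
      fun p => c.transmission p * φ (entryPoint X p.1 p.2, p.2) +
        ∫ s in Ioi (0 : ℝ), c.streamWeight X (p, s) * q (upstream (p, s)) := by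
    filter_upwards [Lp.coeFn_add (hc.ballisticOp hX hn φ) (hc.streamOp hX q),
      hc.coeFn_ballisticOp hX hn φ, hc.coeFn_streamOp hX q] with p h1 h2 h3
    rw [h1, Pi.add_apply, h2, h3]
  filter_upwards [hX.ae_incoming_of_ae_phase hn h1, hX.ae_incoming] with p hp hpI
  filter_upwards [hp] with t ht htI
  rw [ht htI, transmission_line, hX.entryPoint_of_incoming (x := p.1) (v := p.2) hpI htI,
    integral_streamWeight_line (c := c) (x := p.1) (v := p.2) hX hpI htI q, lineSolution]
  ring

/-- The transport problem is equivalent to its integral form. -/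
theorem isTransportSolution_iff (φ : L1In X) (u : L1Phase X) :
    IsTransportSolution X c φ u ↔
      u = hc.ballisticOp hX hn φ + hc.streamOp hX (hc.scatterOp u) := by
  set q := hc.scatterOp u with hq
  have hline := hc.ae_line_ballistic_add_stream hX hn φ q
  have hqline := hX.ae_incoming_of_ae_phase hn (hc.coeFn_scatterOp u)
  have hqint := hX.ae_integrableOn_chord hn q
  constructor
  · intro h
    refine Lp.ext ?_
    refine hX.ae_phase_of_ae_incoming hn (nullMeasurableSet_eq_fun
      (Lp.stronglyMeasurable _).measurable.aemeasurable
      (Lp.stronglyMeasurable _).measurable.aemeasurable) ?_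
    filter_upwards [h, hline, hqline, hqint, hX.ae_incoming] with p h1 h2 h3 h4 hpI
    obtain ⟨w, hwAC, hw0, hw⟩ := h1
    have hτ := hX.exitTime_pos (x := p.1) (v := p.2) hpI
    have h4' : IntervalIntegrable (fun t : ℝ => q (p.1 + t • (p.2 : Space n), p.2)) volume 0
        (exitTime X p.1 p.2) := by
      rw [intervalIntegrable_iff_integrableOn_Ioo_of_le hτ.le]
      exact h4
    have hw' : ∀ᵐ t : ℝ, t ∈ Ioo 0 (exitTime X p.1 p.2) → HasDerivAt w
        (-(c.alongLine p.1 p.2 t * w t) + q (p.1 + t • (p.2 : Space n), p.2)) t := by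
      filter_upwards [hw, h3] with t e1 e2 ht
      have := (e1 ht).2
      rw [(e1 ht).1] at this
      rw [e2 ht]
      exact this
    filter_upwards [hw, h2] with t e1 e2 ht
    rw [e2 ht, (e1 ht).1, ← hw0]
    exact eq_lineSolution (hc.integrable_alongLine hX p.1 p.2) (fun t => hc.sigma_nonneg _ _)
      (fun t => hc.sigma_le _ _) h4' hτ.le (hc.lineDepth_zero_of_incoming hX hpI) hwAC hw'
      ⟨ht.1.le, ht.2.le⟩
  · intro h
    filter_upwards [hline, hqline, hqint, hX.ae_incoming] with p h2 h3 h4 hpI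
    have hτ := hX.exitTime_pos (x := p.1) (v := p.2) hpI
    have h4' : IntervalIntegrable (fun t : ℝ => q (p.1 + t • (p.2 : Space n), p.2)) volume 0
        (exitTime X p.1 p.2) := by
      rw [intervalIntegrable_iff_integrableOn_Ioo_of_le hτ.le]
      exact h4
    have ha := hc.integrable_alongLine hX p.1 p.2
    have ha0 : ∀ t, 0 ≤ c.alongLine p.1 p.2 t := fun t => hc.sigma_nonneg _ _
    have haM : ∀ t, c.alongLine p.1 p.2 t ≤ M := fun t => hc.sigma_le _ _
    refine ⟨_, absolutelyContinuous_lineSolution ha ha0 haM h4' (φ p),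
      lineSolution_zero _ (hc.lineDepth_zero_of_incoming hX hpI), ?_⟩
    rw [← h] at h2
    filter_upwards [h2, h3, ae_hasDerivAt_lineSolution ha ha0 haM h4' (φ p)] with t e1 e2 e3 ht
    refine ⟨e1 ht, ?_⟩
    have := e3 (by rw [uIcc_of_le hτ.le]; exact ⟨ht.1.le, ht.2.le⟩)
    rw [e2 ht, ← e1 ht] at this
    exact this

end Coeffs.IsRegular

end Solvability

/-! ### The albedo operator -/

section Albedo

variable {n : ℕ} {X : Set (Space n)} {M σ₀ : ℝ} {c c' : Coeffs n}

namespace Coeffs.IsRegular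

/-- The scattered radiation is at most the radiation lost from the beam by scattering. -/
theorem lintegral_scatterOp_le (hc : c.IsRegular X M) (u : L1Phase X) :
    ∫⁻ p, ‖hc.scatterOp u p‖ₑ ∂phaseMeasure X ≤
      ∫⁻ p, ENNReal.ofReal (c.sigmaS p.1 p.2) * ‖u p‖ₑ ∂phaseMeasure X := by
  have hu : Measurable fun p => ‖u p‖ₑ := (Lp.stronglyMeasurable u).measurable.enorm
  have hk : Measurable fun q : Space n × Dir n × Dir n =>
      ENNReal.ofReal (c.k q.1 q.2.1 q.2.2) * ‖u (q.1, q.2.1)‖ₑ := by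
    refine hc.measurable_k.ennreal_ofReal.mul ?_
    have h : Measurable fun q : Space n × Dir n × Dir n => (q.1, q.2.1) := by fun_prop
    exact hu.comp h
  have h1 : Measurable fun p : Space n × Dir n =>
      ∫⁻ v', ENNReal.ofReal (c.k p.1 v' p.2) * ‖u (p.1, v')‖ₑ ∂dirMeasure n := by
    have h : Measurable fun q : (Space n × Dir n) × Dir n => (q.1.1, q.2, q.1.2) := by fun_prop
    have := (hk.comp h).lintegral_prod_right' (ν := dirMeasure n)
    exact this
  have hint : ∀ x v', ∫⁻ v, ENNReal.ofReal (c.k x v' v) ∂dirMeasure n =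
      ENNReal.ofReal (c.sigmaS x v') := by
    intro x v'
    have hm : Measurable fun v => c.k x v' v := by
      have h : Measurable fun v : Dir n => (x, v', v) := by fun_prop
      exact hc.measurable_k.comp h
    refine (ofReal_integral_eq_lintegral_ofReal ?_
      (.of_forall fun v => hc.k_nonneg x v' v)).symm
    refine Integrable.of_bound hm.aestronglyMeasurable M (.of_forall fun v => ?_)
    rw [Real.norm_of_nonneg (hc.k_nonneg x v' v)]
    exact hc.k_le x v' v
  calc ∫⁻ p, ‖hc.scatterOp u p‖ₑ ∂phaseMeasure X
      = ∫⁻ p, ‖∫ v', c.k p.1 v' p.2 * u (p.1, v') ∂dirMeasure n‖ₑ ∂phaseMeasure X := by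
        refine lintegral_congr_ae ?_
        filter_upwards [hc.coeFn_scatterOp u] with p hp
        rw [hp]
    _ ≤ ∫⁻ p, ∫⁻ v', ENNReal.ofReal (c.k p.1 v' p.2) * ‖u (p.1, v')‖ₑ ∂dirMeasure n
          ∂phaseMeasure X := by
        refine lintegral_mono fun p => (enorm_integral_le_lintegral_enorm _).trans ?_
        refine (lintegral_congr fun v' => ?_).le
        rw [enorm_mul, Real.enorm_of_nonneg (hc.k_nonneg _ _ _)]
    _ = ∫⁻ x, ∫⁻ v', ENNReal.ofReal (c.sigmaS x v') * ‖u (x, v')‖ₑ ∂dirMeasure n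
          ∂spaceMeasure X := by
        refine (lintegral_prod (μ := spaceMeasure X) (ν := dirMeasure n) _ h1.aemeasurable).trans
          (lintegral_congr fun x => ?_)
        have h2 : Measurable fun q : Dir n × Dir n =>
            ENNReal.ofReal (c.k x q.2 q.1) * ‖u (x, q.2)‖ₑ := by
          have h : Measurable fun q : Dir n × Dir n => (x, q.2, q.1) := by fun_prop
          have := hk.comp h
          exact this
        simp only
        rw [lintegral_lintegral_swap (f := fun v v' =>
          ENNReal.ofReal (c.k x v' v) * ‖u (x, v')‖ₑ) h2.aemeasurable]
        refine lintegral_congr fun v' => ?_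
        rw [lintegral_mul_const' _ _ enorm_ne_top, hint]
    _ = _ := by
        have h3 : Measurable fun p : Space n × Dir n =>
            ENNReal.ofReal (c.sigmaS p.1 p.2) * ‖u p‖ₑ := by
          have h4 := hc.measurable_sigma.sub hc.measurable_sigmaA
          have h6 : (fun p : Space n × Dir n => c.sigmaS p.1 p.2) =
              (fun p => c.sigma p.1 p.2) - fun p => c.sigmaA p.1 p.2 := by
            funext p
            rw [Pi.sub_apply, Coeffs.sigmaA, sub_sub_cancel]
          have h5 : Measurable fun p : Space n × Dir n => c.sigmaS p.1 p.2 := by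
            rw [h6]
            exact h4
          exact h5.ennreal_ofReal.mul hu
        exact (lintegral_prod (μ := spaceMeasure X) (ν := dirMeasure n) _ h3.aemeasurable).symm

variable (hc : c.IsRegular X M) (hX : IsConvexDomain X)

/-- Scattering after streaming is a contraction of `L¹`: the stream loses at most its source to
attenuation, and at most a fixed fraction of that loss is scattered rather than absorbed. -/
theorem norm_scatterOp_comp_streamOp_le (hσ₀ : 0 < σ₀)
    (hσ : ∀ᵐ p ∂phaseMeasure X, σ₀ ≤ c.sigmaA p.1 p.2) :
    ‖(hc.scatterOp).comp (hc.streamOp hX)‖ ≤ 1 - σ₀ / max M σ₀ := by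
  have hmax : 0 < max M σ₀ := lt_max_of_lt_right hσ₀
  have hθ : 0 ≤ 1 - σ₀ / max M σ₀ := sub_nonneg.2 ((div_le_one hmax).2 (le_max_right _ _))
  refine ContinuousLinearMap.opNorm_le_bound _ hθ fun q => ?_
  have hq : Measurable fun p => ‖q p‖ₑ := (Lp.stronglyMeasurable q).measurable.enorm
  rw [← ENNReal.ofReal_le_ofReal_iff (by positivity), ENNReal.ofReal_mul hθ,
    ← lintegral_enorm_coeFn, ← lintegral_enorm_coeFn]
  calc ∫⁻ p, ‖hc.scatterOp (hc.streamOp hX q) p‖ₑ ∂phaseMeasure X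
      ≤ ∫⁻ p, ENNReal.ofReal (c.sigmaS p.1 p.2) * ‖hc.streamOp hX q p‖ₑ ∂phaseMeasure X :=
        hc.lintegral_scatterOp_le _
    _ ≤ ∫⁻ p, ENNReal.ofReal (1 - σ₀ / max M σ₀) * (ENNReal.ofReal (c.sigma p.1 p.2) *
          (∫⁻ s in Ioi (0 : ℝ), ‖c.streamWeight X (p, s)‖ₑ * ‖q (upstream (p, s))‖ₑ))
          ∂phaseMeasure X := by
        refine lintegral_mono_ae ?_
        filter_upwards [hσ, hc.coeFn_streamOp hX q] with p h1 h2
        rw [← mul_assoc, ← ENNReal.ofReal_mul hθ, h2]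
        refine mul_le_mul' (ENNReal.ofReal_le_ofReal ?_)
          ((enorm_integral_le_lintegral_enorm _).trans_eq
            (lintegral_congr fun s => enorm_mul _ _))
        rw [Coeffs.sigmaA] at h1
        -- `σ_s = σ - σ_a ≤ σ - σ₀`, and `σ ≤ max M σ₀`
        have h3 : c.sigma p.1 p.2 * (σ₀ / max M σ₀) ≤ σ₀ := by
          rw [← mul_div_assoc, div_le_iff₀ hmax, mul_comm]
          exact mul_le_mul_of_nonneg_left ((hc.sigma_le _ _).trans (le_max_left _ _)) hσ₀.le
        nlinarith
    _ ≤ _ := by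
        rw [lintegral_const_mul' _ _ ENNReal.ofReal_ne_top]
        exact mul_le_mul_right (hc.lintegral_sigma_streamWeight_le hX hq) _

variable (hn : 1 ≤ n)

/-- The transport problem is uniquely solvable, by a bounded operator. -/
theorem exists_solutionOp (hσ₀ : 0 < σ₀)
    (hσ : ∀ᵐ p ∂phaseMeasure X, σ₀ ≤ c.sigmaA p.1 p.2) :
    ∃ W : L1In X →L[ℝ] L1Phase X, ∀ (φ : L1In X) (u : L1Phase X),
      u = hc.ballisticOp hX hn φ + hc.streamOp hX (hc.scatterOp u) ↔ u = W φ := by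
  set K := hc.scatterOp (X := X)
  set T := hc.streamOp hX
  set J := hc.ballisticOp hX hn
  have hlt : ‖K.comp T‖ < 1 := by
    refine (hc.norm_scatterOp_comp_streamOp_le hX hσ₀ hσ).trans_lt ?_
    have : 0 < σ₀ / max M σ₀ := div_pos hσ₀ (lt_max_of_lt_right hσ₀)
    linarith
  -- `K u` solves `(1 - K T) (K u) = K J φ`, which is inverted by a Neumann series
  set R := Units.oneSub (K.comp T) hlt with hR
  have h1 : ∀ q, (↑R⁻¹ : L1Phase X →L[ℝ] L1Phase X) (q - K (T q)) = q := fun q => by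
    have := congrArg (fun L : L1Phase X →L[ℝ] L1Phase X => L q) R.inv_mul
    exact this
  have h2 : ∀ q, (↑R⁻¹ : L1Phase X →L[ℝ] L1Phase X) q -
      K (T ((↑R⁻¹ : L1Phase X →L[ℝ] L1Phase X) q)) = q := fun q => by
    have := congrArg (fun L : L1Phase X →L[ℝ] L1Phase X => L q) R.mul_inv
    exact this
  refine ⟨J + T.comp ((↑R⁻¹ : L1Phase X →L[ℝ] L1Phase X).comp (K.comp J)), fun φ u => ?_⟩
  simp only [_root_.add_apply, ContinuousLinearMap.comp_apply]
  constructor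
  · intro h
    have h3 : K u - K (T (K u)) = K (J φ) := by
      conv_lhs => enter [1]; rw [h]
      rw [map_add, add_sub_cancel_right]
    rw [← h3, h1]
    exact h
  · intro h
    have h3 : K u = (↑R⁻¹ : L1Phase X →L[ℝ] L1Phase X) (K (J φ)) := by
      conv_lhs => rw [h]
      rw [map_add, ← sub_eq_iff_eq_add.1 (h2 (K (J φ)))]
    rw [h3]
    exact h

/-- The albedo operator splits into the contribution of the ballistic radiation and that of the
radiation scattered at least once. -/
theorem exists_albedoOp (hσ₀ : 0 < σ₀) (hσ : ∀ᵐ p ∂phaseMeasure X, σ₀ ≤ c.sigmaA p.1 p.2) :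
    ∃ W : L1In X →L[ℝ] L1Phase X, ∀ A : L1In X →L[ℝ] L1Space X, IsAlbedoOperator X c A ↔
      A = hc.absorbOp.comp (hc.ballisticOp hX hn +
        (hc.streamOp hX).comp (hc.scatterOp.comp W)) := by
  obtain ⟨W, hW⟩ := hc.exists_solutionOp hX hn hσ₀ hσ
  refine ⟨W, fun A => ⟨fun h => ?_, fun h φ => ⟨W φ, ?_, ?_⟩⟩⟩
  · ext1 φ
    obtain ⟨u, hu, hA⟩ := h φ
    have h1 := (hW φ u).1 ((hc.isTransportSolution_iff hX hn φ u).1 hu)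
    have h2 := (hW φ u).2 h1
    have h3 : A φ = hc.absorbOp u := Lp.ext (.trans
      (g := fun x => ∫ v, c.sigmaA x v * u (x, v) ∂dirMeasure n) hA (hc.coeFn_absorbOp u).symm)
    rw [h3]
    conv_lhs => rw [h2, h1]
    rfl
  · exact (hc.isTransportSolution_iff hX hn φ _).2 ((hW φ _).2 rfl)
  · have h1 : A φ = hc.absorbOp (W φ) := by
      rw [h]
      conv_rhs => rw [(hW φ _).2 rfl]
      rfl
    rw [h1]
    exact hc.coeFn_absorbOp _

end Coeffs.IsRegular

/-! ### Coefficients up to null sets -/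

/-- Coefficients which agree almost everywhere in `X`, and hence have the same albedo operator. -/
structure Coeffs.AEEq (X : Set (Space n)) (c c' : Coeffs n) : Prop where
  sigma : ∀ᵐ p ∂phaseMeasure X, c.sigma p.1 p.2 = c'.sigma p.1 p.2
  k : ∀ᵐ p ∂((spaceMeasure X).prod ((dirMeasure n).prod (dirMeasure n))),
    c.k p.1 p.2.1 p.2.2 = c'.k p.1 p.2.1 p.2.2

namespace Coeffs.AEEq

theorem symm (h : c.AEEq X c') : c'.AEEq X c :=
  ⟨h.sigma.mono fun _ hp => hp.symm, h.k.mono fun _ hp => hp.symm⟩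

theorem ae_k_left (h : c.AEEq X c') : ∀ᵐ p ∂phaseMeasure X, ∀ᵐ v' ∂dirMeasure n,
    c.k p.1 p.2 v' = c'.k p.1 p.2 v' := by
  have h1 := (measurePreserving_prodAssoc (spaceMeasure X) (dirMeasure n)
    (dirMeasure n)).quasiMeasurePreserving.ae h.k
  exact Measure.ae_ae_of_ae_prod h1

theorem ae_k_right (h : c.AEEq X c') : ∀ᵐ p ∂phaseMeasure X, ∀ᵐ v' ∂dirMeasure n,
    c.k p.1 v' p.2 = c'.k p.1 v' p.2 := by
  have h0 : MeasurePreserving (Prod.map id Prod.swap)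
      ((spaceMeasure X).prod ((dirMeasure n).prod (dirMeasure n)))
      ((spaceMeasure X).prod ((dirMeasure n).prod (dirMeasure n))) :=
    (MeasurePreserving.id _).prod Measure.measurePreserving_swap
  have h1 := (measurePreserving_prodAssoc (spaceMeasure X) (dirMeasure n)
    (dirMeasure n)).quasiMeasurePreserving.ae (h0.quasiMeasurePreserving.ae h.k)
  exact Measure.ae_ae_of_ae_prod h1

theorem sigmaA (h : c.AEEq X c') : ∀ᵐ p ∂phaseMeasure X, c.sigmaA p.1 p.2 = c'.sigmaA p.1 p.2 := by
  filter_upwards [h.sigma, h.ae_k_left] with p h1 h2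
  rw [Coeffs.sigmaA, Coeffs.sigmaA, h1, Coeffs.sigmaS, Coeffs.sigmaS, integral_congr_ae h2]

theorem isTransportSolution (h : c.AEEq X c') (hX : IsConvexDomain X) (hn : 1 ≤ n)
    {φ u : Space n × Dir n → ℝ} (hu : IsTransportSolution X c φ u) :
    IsTransportSolution X c' φ u := by
  filter_upwards [hu, hX.ae_incoming_of_ae_phase hn h.sigma,
    hX.ae_incoming_of_ae_phase hn h.ae_k_right] with p ⟨w, h1, h2, h3⟩ h4 h5
  refine ⟨w, h1, h2, ?_⟩
  filter_upwards [h3, h4, h5] with t h6 h7 h8 ht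
  refine ⟨(h6 ht).1, ?_⟩
  have h9 := (h6 ht).2
  rw [h7 ht] at h9
  have h10 : ∫ v', c.k (p.1 + t • (p.2 : Space n)) v' p.2 * u (p.1 + t • (p.2 : Space n), v')
      ∂(dirMeasure n) = ∫ v', c'.k (p.1 + t • (p.2 : Space n)) v' p.2 *
        u (p.1 + t • (p.2 : Space n), v') ∂(dirMeasure n) := by
    refine integral_congr_ae ?_
    filter_upwards [h8 ht] with v' hv'
    have hv'' : c.k (p.1 + t • (p.2 : Space n)) v' p.2 = c'.k (p.1 + t • (p.2 : Space n)) v' p.2 :=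
      hv'
    rw [hv'']
  rwa [h10] at h9

theorem isAlbedoOperator (h : c.AEEq X c') (hX : IsConvexDomain X) (hn : 1 ≤ n)
    {A : L1In X →L[ℝ] L1Space X} (hA : IsAlbedoOperator X c A) : IsAlbedoOperator X c' A := by
  intro φ
  obtain ⟨u, hu, h1⟩ := hA φ
  refine ⟨u, h.isTransportSolution hX hn hu, ?_⟩
  filter_upwards [h1, Measure.ae_ae_of_ae_prod h.sigmaA] with x h2 h3
  rw [h2]
  refine integral_congr_ae ?_
  filter_upwards [h3] with v h4
  have h5 : c.sigmaA x v = c'.sigmaA x v := h4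
  rw [h5]

end Coeffs.AEEq

open Classical in
/-- The coefficients `c`, modified so as to satisfy the bounds `0 ≤ σ, k ≤ max M 0` everywhere and
to vanish outside of `X`. -/
def Coeffs.regularize (X : Set (Space n)) (M : ℝ) (c : Coeffs n) : Coeffs n where
  sigma x v := if x ∈ X then max 0 (min (c.sigma x v) (max M 0)) else 0
  k x v w := max 0 (min (c.k x v w) (max M 0))

theorem Coeffs.Admissible.isRegular_regularize (hc : c.Admissible X M σ₀) (hX : IsOpen X) :
    (c.regularize X M).IsRegular X (max M 0) where
  measurable_sigma := by
    refine Measurable.ite (measurable_fst hX.measurableSet) ?_ measurable_const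
    exact measurable_const.max (hc.measurable_sigma.min measurable_const)
  measurable_k := measurable_const.max (hc.measurable_k.min measurable_const)
  sigma_nonneg x v := by
    rw [Coeffs.regularize]; dsimp only; split_ifs
    · exact le_max_left _ _
    · exact le_rfl
  sigma_le x v := by
    rw [Coeffs.regularize]; dsimp only; split_ifs
    · exact max_le (le_max_right _ _) (min_le_right _ _)
    · exact le_max_right _ _
  k_nonneg _ _ _ := le_max_left _ _
  k_le _ _ _ := max_le (le_max_right _ _) (min_le_right _ _)
  sigma_eq_zero x v hx := if_neg hx

theorem Coeffs.Admissible.aeEq_regularize (hc : c.Admissible X M σ₀) (hX : IsConvexDomain X) :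
    c.AEEq X (c.regularize X M) where
  sigma := by
    filter_upwards [hc.sigma_mem, ae_phase_mem hX] with p h1 h2
    simp only [Coeffs.regularize, if_pos h2]
    rw [min_eq_left (h1.2.trans (le_max_left _ _)), max_eq_right h1.1]
  k := by
    filter_upwards [hc.k_mem] with p h1
    simp only [Coeffs.regularize]
    rw [min_eq_left (h1.2.trans (le_max_left _ _)), max_eq_right h1.1]

theorem Coeffs.Admissible.existsUnique_isAlbedoOperator (hc : c.Admissible X M σ₀)
    (hX : IsConvexDomain X) (hn : 1 ≤ n) (hσ₀ : 0 < σ₀) : ∃! A, IsAlbedoOperator X c A := by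
  have hae := hc.aeEq_regularize hX
  have hσ : ∀ᵐ p ∂phaseMeasure X, σ₀ ≤ (c.regularize X M).sigmaA p.1 p.2 := by
    filter_upwards [hc.le_sigmaA, hae.sigmaA] with p h1 h2
    rwa [← h2]
  obtain ⟨W, hW⟩ := (hc.isRegular_regularize hX.isOpen).exists_albedoOp hX hn hσ₀ hσ
  refine ⟨_, hae.symm.isAlbedoOperator hX hn ((hW _).2 rfl), fun A hA => ?_⟩
  exact (hW A).1 (hae.isAlbedoOperator hX hn hA)

end Albedo

/-! ### Scattered radiation is equi-integrable -/

section EquiIntegrability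

variable {n : ℕ} {X : Set (Space n)} {M σ₀ d : ℝ} {c : Coeffs n}

/-- Polar coordinates. -/
theorem lintegral_polar (hn : 1 ≤ n) {f : Space n → ℝ≥0∞} (hf : Measurable f) :
    ∫⁻ x, f x = ∫⁻ v, (∫⁻ r in Ioi (0 : ℝ), ENNReal.ofReal (r ^ (n - 1)) *
      f (r • (v : Space n))) ∂dirMeasure n := by
  have : Nonempty (Fin n) := ⟨⟨0, hn⟩⟩
  have hdim : Module.finrank ℝ (Space n) = n := by simp
  have hmp := (volume : Measure (Space n)).measurePreserving_homeomorphUnitSphereProd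
  rw [hdim] at hmp
  have hm : Measurable fun q : Dir n × Ioi (0 : ℝ) => f (q.2.1 • (q.1 : Space n)) := by
    refine hf.comp ?_
    fun_prop
  calc ∫⁻ x, f x = ∫⁻ x : ({(0 : Space n)}ᶜ : Set (Space n)), f x ∂(volume.comap Subtype.val) := by
        rw [lintegral_subtype_comap (measurableSet_singleton _).compl,
          restrict_compl_singleton]
    _ = ∫⁻ q, f (q.2.1 • (q.1 : Space n)) ∂((dirMeasure n).prod (Measure.volumeIoiPow (n - 1))) := by
        rw [dirMeasure, ← hmp.lintegral_comp_emb (Homeomorph.measurableEmbedding _)]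
        refine lintegral_congr fun x => ?_
        have := homeomorphUnitSphereProd_symm_apply_coe (Space n)
          (homeomorphUnitSphereProd (Space n) x)
        rw [Homeomorph.symm_apply_apply] at this
        rw [← this]
    _ = ∫⁻ v, ∫⁻ r, f (r.1 • (v : Space n)) ∂(Measure.volumeIoiPow (n - 1)) ∂dirMeasure n :=
        lintegral_prod _ hm.aemeasurable
    _ = _ := by
        refine lintegral_congr fun v => ?_
        have h1 : Measurable fun r : Ioi (0 : ℝ) => ENNReal.ofReal (r.1 ^ (n - 1)) := by fun_prop
        have h2 : Measurable fun r : Ioi (0 : ℝ) => f (r.1 • (v : Space n)) :=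
          hm.comp measurable_prodMk_left
        rw [Measure.volumeIoiPow, lintegral_withDensity_eq_lintegral_mul _ h1 h2]
        exact lintegral_subtype_comap measurableSet_Ioi
          (fun r : ℝ => ENNReal.ofReal (r ^ (n - 1)) * f (r • (v : Space n)))

/-- Seen from any point, a set of small measure occupies few directions and times, up to
the times less than `η`. -/
theorem lintegral_dir_line_le (hn : 1 ≤ n) {η : ℝ} (hη : 0 < η) {U : Set (Space n)}
    (hU : MeasurableSet U) (y : Space n) (d : ℝ) :
    ∫⁻ v, (∫⁻ s in Ioc 0 d, U.indicator (1 : Space n → ℝ≥0∞) (y + s • (v : Space n)))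
      ∂dirMeasure n ≤
      ENNReal.ofReal η * dirMeasure n univ + (ENNReal.ofReal (η ^ (n - 1)))⁻¹ * volume U := by
  set κ := (ENNReal.ofReal (η ^ (n - 1)))⁻¹ with hκ
  have hpow : ENNReal.ofReal (η ^ (n - 1)) ≠ 0 := by
    rw [Ne, ENNReal.ofReal_eq_zero, not_le]; positivity
  have hκt : κ ≠ ⊤ := ENNReal.inv_ne_top.2 hpow
  have hm : Measurable fun x : Space n => U.indicator (1 : Space n → ℝ≥0∞) (y + x) :=
    (measurable_one.indicator hU).comp (measurable_const_add y)
  have hpolar := lintegral_polar hn hm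
  rw [lintegral_add_left_eq_self (fun x => U.indicator (1 : Space n → ℝ≥0∞) x),
    lintegral_indicator_one hU] at hpolar
  rw [hpolar, ← lintegral_const_mul' _ _ hκt, ← lintegral_const,
    ← lintegral_add_left measurable_const]
  refine lintegral_mono fun v => ?_
  -- beyond the time `η` the factor `s ^ (n - 1)` of polar coordinates is bounded below
  have h1 : ∀ s ∈ Ioi (0 : ℝ), U.indicator (1 : Space n → ℝ≥0∞) (y + s • (v : Space n)) ≤
      (Ioc 0 η).indicator 1 s + κ * (ENNReal.ofReal (s ^ (n - 1)) *
        U.indicator (1 : Space n → ℝ≥0∞) (y + s • (v : Space n))) := by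
    intro s hs
    by_cases h : s ≤ η
    · rw [indicator_of_mem (show s ∈ Ioc 0 η from ⟨hs, h⟩)]
      exact (indicator_le_self' (fun _ _ => zero_le) _).trans le_self_add
    · refine le_trans ?_ le_add_self
      rw [← mul_assoc]
      refine le_mul_of_one_le_left' ?_
      rw [← ENNReal.inv_mul_cancel hpow ENNReal.ofReal_ne_top]
      gcongr
      exact (not_le.1 h).le
  calc ∫⁻ s in Ioc 0 d, U.indicator (1 : Space n → ℝ≥0∞) (y + s • (v : Space n))
      ≤ ∫⁻ s in Ioi (0 : ℝ), U.indicator (1 : Space n → ℝ≥0∞) (y + s • (v : Space n)) :=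
        lintegral_mono_set fun s hs => hs.1
    _ ≤ ∫⁻ s in Ioi (0 : ℝ), ((Ioc 0 η).indicator 1 s + κ * (ENNReal.ofReal (s ^ (n - 1)) *
        U.indicator (1 : Space n → ℝ≥0∞) (y + s • (v : Space n)))) :=
        setLIntegral_mono' measurableSet_Ioi h1
    _ = (∫⁻ s in Ioi (0 : ℝ), (Ioc 0 η).indicator 1 s) + κ * ∫⁻ s in Ioi (0 : ℝ),
          (ENNReal.ofReal (s ^ (n - 1)) *
            U.indicator (1 : Space n → ℝ≥0∞) (y + s • (v : Space n))) := by
        rw [lintegral_add_left (measurable_one.indicator measurableSet_Ioc),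
          lintegral_const_mul' _ _ hκt]
    _ ≤ _ := by
        gcongr
        refine (lintegral_mono' Measure.restrict_le_self le_rfl).trans_eq ?_
        rw [lintegral_indicator_one measurableSet_Ioc, Real.volume_Ioc, sub_zero]

namespace Coeffs.IsRegular

/-- The radiation scattered at least once which is found in `U` is small if `U` is small. -/
theorem lintegral_streamOp_scatterOp_le (hc : c.IsRegular X M) (hX : IsConvexDomain X)
    {U : Set (Space n)} (hU : MeasurableSet U) {κ : ℝ≥0∞}
    (hκ : ∀ y, ∫⁻ v, (∫⁻ s in Ioc 0 (chordBound X),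
      U.indicator (1 : Space n → ℝ≥0∞) (y + s • (v : Space n))) ∂dirMeasure n ≤ κ)
    (w : L1Phase X) :
    ∫⁻ p, U.indicator 1 p.1 * ‖hc.streamOp hX (hc.scatterOp w) p‖ₑ ∂phaseMeasure X ≤
      ENNReal.ofReal M * κ * ENNReal.ofReal ‖w‖ := by
  have hXm := hX.isOpen.measurableSet
  have hw : Measurable fun p => ‖w p‖ₑ := (Lp.stronglyMeasurable w).measurable.enorm
  set q := hc.scatterOp w with hq
  have hqm : Measurable fun p => ‖q p‖ₑ := (Lp.stronglyMeasurable q).measurable.enorm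
  have hUm : Measurable (U.indicator (1 : Space n → ℝ≥0∞)) := measurable_one.indicator hU
  set H : (Space n × Dir n) × ℝ → ℝ≥0∞ := fun r =>
    U.indicator 1 r.1.1 * (X.indicator 1 r.1.1 * ‖c.streamWeight X r‖ₑ) with hHdef
  have hH : Measurable H := (hUm.comp (measurable_fst.comp measurable_fst)).mul
    (((measurable_one.indicator hXm).comp (measurable_fst.comp measurable_fst)).mul
      (hc.measurable_streamWeight hX.isOpen).enorm)
  have h1 := lintegral_upstream_le (X := X) (m := volume.restrict (Ioi (0 : ℝ))) hX.isOpen hH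
    (fun r hr => by
      simp only [hHdef]
      rw [streamWeight_eq_zero hr]; simp) hqm
  -- a chord through `p` stays in `X` for times at most `chordBound X` only
  have hHle : ∀ p : Space n × Dir n, p.1 ∈ X →
      ∫⁻ s in Ioi (0 : ℝ), H ((p.1 + s • (p.2 : Space n), p.2), s) ≤
        ∫⁻ s in Ioc 0 (chordBound X), U.indicator 1 (p.1 + s • (p.2 : Space n)) := by
    intro p hp
    rw [← lintegral_indicator measurableSet_Ioi, ← lintegral_indicator measurableSet_Ioc]
    refine lintegral_mono fun s => ?_
    by_cases hs : 0 < s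
    · rw [indicator_of_mem (mem_Ioi.2 hs)]
      by_cases hs2 : p.1 + s • (p.2 : Space n) ∈ X
      · have h3 := hX.dist_le_chordBound _ (subset_closure hs2) _ (subset_closure hp)
        rw [dist_eq_norm, add_sub_cancel_left, norm_smul, norm_dir, mul_one, Real.norm_eq_abs,
          abs_of_pos hs] at h3
        rw [indicator_of_mem (show s ∈ Ioc 0 (chordBound X) from ⟨hs, h3⟩)]
        simp only [hHdef]
        rw [indicator_of_mem hs2]
        refine mul_le_of_le_one_right' ?_
        rw [Pi.one_apply, one_mul, Real.enorm_of_nonneg (streamWeight_nonneg _)]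
        exact ENNReal.ofReal_le_one.2 (hc.streamWeight_le_one hX _ hs.le)
      · simp only [hHdef]
        rw [indicator_of_notMem hs2]
        simp
    · rw [indicator_of_notMem (show s ∉ Ioi (0 : ℝ) from hs)]
      exact zero_le
  have hm1 : Measurable fun x => ∫⁻ v', ‖w (x, v')‖ₑ ∂dirMeasure n := hw.lintegral_prod_right'
  have hm2 : Measurable fun p : Space n × Dir n => ∫⁻ s in Ioc 0 (chordBound X),
      U.indicator (1 : Space n → ℝ≥0∞) (p.1 + s • (p.2 : Space n)) := by
    have := ((hUm.comp measurable_fst).comp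
      (measurable_advect (n := n))).lintegral_prod_right'
        (ν := volume.restrict (Ioc 0 (chordBound X)))
    exact this
  calc ∫⁻ p, U.indicator 1 p.1 * ‖hc.streamOp hX q p‖ₑ ∂phaseMeasure X
      ≤ ∫⁻ p, (∫⁻ s in Ioi (0 : ℝ), H (p, s) * ‖q (upstream (p, s))‖ₑ) ∂phaseMeasure X := by
        refine lintegral_mono_ae ?_
        filter_upwards [hc.coeFn_streamOp hX q, ae_phase_mem hX] with p h2 h3
        have h4 : U.indicator (1 : Space n → ℝ≥0∞) p.1 ≠ ⊤ := by
          by_cases h : p.1 ∈ U <;> simp [h]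
        simp only [hHdef]
        rw [h2, indicator_of_mem h3, Pi.one_apply]
        simp only [one_mul, mul_assoc]
        rw [lintegral_const_mul' _ _ h4]
        gcongr
        exact (enorm_integral_le_lintegral_enorm _).trans_eq
          (lintegral_congr fun s => enorm_mul _ _)
    _ ≤ _ := h1
    _ ≤ ∫⁻ p, (ENNReal.ofReal M * ∫⁻ v', ‖w (p.1, v')‖ₑ ∂dirMeasure n) *
          (∫⁻ s in Ioc 0 (chordBound X), U.indicator 1 (p.1 + s • (p.2 : Space n)))
          ∂phaseMeasure X := by
        refine lintegral_mono_ae ?_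
        filter_upwards [hc.coeFn_scatterOp w, ae_phase_mem hX] with p h2 h3
        refine mul_le_mul' ?_ (hHle p h3)
        rw [h2, ← lintegral_const_mul' _ _ ENNReal.ofReal_ne_top]
        refine (enorm_integral_le_lintegral_enorm _).trans (lintegral_mono fun v' => ?_)
        rw [enorm_mul, Real.enorm_of_nonneg (hc.k_nonneg _ _ _)]
        gcongr
        exact hc.k_le _ _ _
    _ = ∫⁻ x, (ENNReal.ofReal M * ∫⁻ v', ‖w (x, v')‖ₑ ∂dirMeasure n) *
          (∫⁻ v, (∫⁻ s in Ioc 0 (chordBound X), U.indicator 1 (x + s • (v : Space n)))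
            ∂dirMeasure n) ∂spaceMeasure X := by
        refine (lintegral_prod (μ := spaceMeasure X) (ν := dirMeasure n) _
          (((hm1.comp measurable_fst).const_mul _).mul hm2).aemeasurable).trans ?_
        refine lintegral_congr fun x => ?_
        have hm3 := hm2.comp (measurable_prodMk_left (x := x))
        have h5 := lintegral_const_mul (μ := dirMeasure n)
          (ENNReal.ofReal M * ∫⁻ v', ‖w (x, v')‖ₑ ∂dirMeasure n) hm3
        exact h5
    _ ≤ ∫⁻ x, (ENNReal.ofReal M * ∫⁻ v', ‖w (x, v')‖ₑ ∂dirMeasure n) * κ ∂spaceMeasure X := by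
        gcongr with x
        exact hκ x
    _ = _ := by
        have h5 := lintegral_prod (μ := spaceMeasure X) (ν := dirMeasure n) _ hw.aemeasurable
        rw [lintegral_mul_const _ (hm1.const_mul _), lintegral_const_mul _ hm1, ← h5]
        have h6 : ∫⁻ p, ‖w p‖ₑ ∂(spaceMeasure X).prod (dirMeasure n) = ENNReal.ofReal ‖w‖ :=
          lintegral_enorm_coeFn w
        rw [h6]
        ring

end Coeffs.IsRegular

end EquiIntegrability

/-! ### Comparison of the ballistic parts -/

section Comparison

/-- A countable cover reduces the comparison of two measures to small sets. -/
theorem measure_le_of_locally_le {α : Type*} [TopologicalSpace α] [SecondCountableTopology α]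
    [MeasurableSpace α] [OpensMeasurableSpace α] {μ ν : Measure α}
    (h : ∀ x, ∃ N ∈ 𝓝 x, ∀ B, B ⊆ N → MeasurableSet B → μ B ≤ ν B) : μ ≤ ν := by
  choose N hN hle using h
  obtain ⟨s, hs, hsU⟩ := TopologicalSpace.countable_cover_nhds
    (fun x => interior_mem_nhds.2 (hN x))
  refine Measure.le_iff.2 fun B hB => ?_
  rcases s.eq_empty_or_nonempty with rfl | hne
  · simp only [mem_empty_iff_false, iUnion_of_empty, iUnion_empty] at hsU
    have : B = ∅ := by
      rw [eq_empty_iff_forall_notMem]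
      intro x _
      exact (hsU ▸ mem_univ x : x ∈ (∅ : Set α))
    simp [this]
  obtain ⟨f, rfl⟩ := hs.exists_eq_range hne
  have hm : ∀ i, MeasurableSet (disjointed (fun i => interior (N (f i))) i) :=
    fun i => MeasurableSet.disjointed (fun i => isOpen_interior.measurableSet) i
  have hU : B = ⋃ i, B ∩ disjointed (fun i => interior (N (f i))) i := by
    rw [← inter_iUnion, iUnion_disjointed, ← biUnion_range (f := f)
      (g := fun x => interior (N x)), hsU, inter_univ]
  have hd : Pairwise (Function.onFun Disjoint
      fun i => B ∩ disjointed (fun i => interior (N (f i))) i) := fun i j hij =>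
    (disjoint_disjointed (fun i => interior (N (f i))) hij).mono inter_subset_right
      inter_subset_right
  rw [hU, measure_iUnion hd fun i => hB.inter (hm i), measure_iUnion hd fun i => hB.inter (hm i)]
  refine ENNReal.tsum_le_tsum fun i => hle (f i) _ ?_ (hB.inter (hm i))
  exact inter_subset_right.trans ((disjointed_subset _ i).trans interior_subset)

variable {n : ℕ} {X : Set (Space n)} {M σ₀ d : ℝ} {c c' : Coeffs n}

/-- The map sending a point of phase space to the point of `Γ_-` where its characteristic
starts. -/
def entryMap (X : Set (Space n)) (p : Space n × Dir n) : Space n × Dir n :=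
  (entryPoint X p.1 p.2, p.2)

theorem IsConvexDomain.measurable_entryMap (hX : IsConvexDomain X) : Measurable (entryMap X) :=
  (measurable_entryPoint hX.isOpen).prodMk measurable_snd

theorem IsConvexDomain.isFiniteMeasure_incomingMeasure (hX : IsConvexDomain X) (hn : 1 ≤ n) :
    IsFiniteMeasure (incomingMeasure X) := by
  have := hX.isFiniteMeasure_boundaryMeasure hn
  refine isFiniteMeasure_withDensity (ne_of_lt ?_)
  calc ∫⁻ p in incoming X, ENNReal.ofReal |⟪(p.2 : Space n), outerNormal X p.1⟫|
        ∂(boundaryMeasure X).prod (dirMeasure n)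
      ≤ ∫⁻ p in incoming X, 1 ∂(boundaryMeasure X).prod (dirMeasure n) := by
        refine setLIntegral_mono' hX.measurableSet_incoming fun p hp => ?_
        refine ENNReal.ofReal_le_one.2 ((abs_real_inner_le_norm _ _).trans ?_)
        rw [norm_dir, hX.norm_outerNormal hp.1, one_mul]
    _ < ⊤ := by
        rw [setLIntegral_one]
        exact measure_lt_top _ _

theorem IsConvexDomain.isFiniteMeasure_spaceMeasure (hX : IsConvexDomain X) :
    IsFiniteMeasure (spaceMeasure X) :=
  ⟨by rw [spaceMeasure, Measure.restrict_apply_univ]; exact hX.isBounded.measure_lt_top⟩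

theorem IsConvexDomain.isFiniteMeasure_phaseMeasure (hX : IsConvexDomain X) :
    IsFiniteMeasure (phaseMeasure X) := by
  have := hX.isFiniteMeasure_spaceMeasure
  unfold phaseMeasure
  infer_instance

/-- The absorption per unit of radiation entering along the characteristic. -/
def Coeffs.ballisticDensity (c : Coeffs n) (p : Space n × Dir n) : ℝ :=
  c.sigmaA p.1 p.2 * c.transmission p

/-- A bound for `|σ_a|`, also on the null set where `σ_a` may be negative. -/
def absorptionBound (n : ℕ) (M : ℝ) : ℝ := M + M * (dirMeasure n).real univ

namespace Coeffs.IsRegular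

theorem measurable_ballisticDensity (hc : c.IsRegular X M) : Measurable c.ballisticDensity :=
  hc.measurable_sigmaA.mul (c.measurable_transmission hc.measurable_sigma)

theorem abs_ballisticDensity_le (hc : c.IsRegular X M) (p : Space n × Dir n) :
    |c.ballisticDensity p| ≤ absorptionBound n M := by
  rw [Coeffs.ballisticDensity, abs_mul, abs_of_pos (transmission_pos p)]
  have h1 := hc.abs_sigmaA_le p.1 p.2
  have h2 := mul_le_of_le_one_right (abs_nonneg (c.sigmaA p.1 p.2)) (hc.transmission_le_one p)
  exact h2.trans h1

theorem integral_mul_absorbOp (hc : c.IsRegular X M) {ψ : Space n → ℝ} (hψ : Measurable ψ)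
    (hψ1 : ∀ x, |ψ x| ≤ 1) (u : L1Phase X) :
    Integrable (fun p => ψ p.1 * (c.sigmaA p.1 p.2 * u p)) (phaseMeasure X) ∧
    ∫ x, ψ x * hc.absorbOp u x ∂spaceMeasure X =
      ∫ p, ψ p.1 * (c.sigmaA p.1 p.2 * u p) ∂phaseMeasure X := by
  have h1 : Integrable (fun p => c.sigmaA p.1 p.2 * u p) (phaseMeasure X) :=
    (L1.integrable_coeFn u).bdd_mul hc.measurable_sigmaA.aestronglyMeasurable
      (.of_forall fun p => hc.abs_sigmaA_le p.1 p.2)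
  have h2 : Integrable (fun p => ψ p.1 * (c.sigmaA p.1 p.2 * u p)) (phaseMeasure X) :=
    h1.bdd_mul (hψ.comp measurable_fst).aestronglyMeasurable (.of_forall fun p => hψ1 p.1)
  refine ⟨h2, ?_⟩
  have h3 := integral_prod (μ := spaceMeasure X) (ν := dirMeasure n) _ h2
  refine Eq.trans ?_ h3.symm
  refine integral_congr_ae ?_
  filter_upwards [hc.coeFn_absorbOp u] with x hx
  rw [hx, ← integral_const_mul]

/-- Tested against functions supported in a small set, the albedo operator is close to its
ballistic part. -/
theorem exists_enorm_integral_sub_le (hc : c.IsRegular X M) (hX : IsConvexDomain X) (hn : 1 ≤ n)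
    (hσ₀ : 0 < σ₀) (hσ : ∀ᵐ p ∂phaseMeasure X, σ₀ ≤ c.sigmaA p.1 p.2)
    {A : L1In X →L[ℝ] L1Space X} (hA : IsAlbedoOperator X c A) :
    ∃ C : NNReal, ∀ (φ : L1In X) (ψ : Space n → ℝ) (U : Set (Space n)) (κ : ℝ≥0∞),
      Measurable ψ → (∀ x, |ψ x| ≤ 1) → (∀ x, x ∉ U → ψ x = 0) → MeasurableSet U →
      (∀ y, ∫⁻ v, (∫⁻ s in Ioc 0 (chordBound X),
        U.indicator (1 : Space n → ℝ≥0∞) (y + s • (v : Space n))) ∂dirMeasure n ≤ κ) →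
      ‖∫ x, ψ x * A φ x ∂spaceMeasure X -
        ∫ p, ψ p.1 * (c.ballisticDensity p * φ (entryMap X p)) ∂phaseMeasure X‖ₑ ≤
        C * κ * ENNReal.ofReal ‖φ‖ := by
  obtain ⟨W, hW⟩ := hc.exists_albedoOp hX hn hσ₀ hσ
  refine ⟨(absorptionBound n M).toNNReal * M.toNNReal * ‖W‖.toNNReal,
    fun φ ψ U κ hψ hψ1 hψU hU hκ => ?_⟩
  set N : L1Phase X := hc.streamOp hX (hc.scatterOp (W φ)) with hN
  have h1 : A φ = hc.absorbOp (hc.ballisticOp hX hn φ) + hc.absorbOp N := by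
    rw [(hW A).1 hA, ← map_add]
    rfl
  have h2 : ∀ u : L1Phase X, Integrable (fun x => ψ x * hc.absorbOp u x) (spaceMeasure X) :=
    fun u => (L1.integrable_coeFn _).bdd_mul hψ.aestronglyMeasurable (.of_forall hψ1)
  have h3 : ∫ x, ψ x * A φ x ∂spaceMeasure X =
      ∫ p, ψ p.1 * (c.sigmaA p.1 p.2 * hc.ballisticOp hX hn φ p) ∂phaseMeasure X +
        ∫ p, ψ p.1 * (c.sigmaA p.1 p.2 * N p) ∂phaseMeasure X := by
    rw [← (hc.integral_mul_absorbOp hψ hψ1 _).2, ← (hc.integral_mul_absorbOp hψ hψ1 _).2,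
      ← integral_add (h2 _) (h2 _), h1]
    refine integral_congr_ae ?_
    filter_upwards [Lp.coeFn_add (hc.absorbOp (hc.ballisticOp hX hn φ)) (hc.absorbOp N)] with x hx
    rw [hx, Pi.add_apply, mul_add]
  have h4 : ∫ p, ψ p.1 * (c.sigmaA p.1 p.2 * hc.ballisticOp hX hn φ p) ∂phaseMeasure X =
      ∫ p, ψ p.1 * (c.ballisticDensity p * φ (entryMap X p)) ∂phaseMeasure X := by
    refine integral_congr_ae ?_
    filter_upwards [hc.coeFn_ballisticOp hX hn φ] with p hp
    rw [hp, Coeffs.ballisticDensity, mul_assoc]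
    rfl
  rw [h3, h4, add_sub_cancel_left]
  calc ‖∫ p, ψ p.1 * (c.sigmaA p.1 p.2 * N p) ∂phaseMeasure X‖ₑ
      ≤ ∫⁻ p, ENNReal.ofReal (absorptionBound n M) * (U.indicator 1 p.1 * ‖N p‖ₑ)
          ∂phaseMeasure X := by
        refine (enorm_integral_le_lintegral_enorm _).trans (lintegral_mono fun p => ?_)
        rw [enorm_mul, enorm_mul, mul_left_comm]
        refine mul_le_mul' ?_ (mul_le_mul' ?_ le_rfl)
        · rw [← ofReal_norm]
          exact ENNReal.ofReal_le_ofReal (hc.abs_sigmaA_le _ _)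
        · by_cases h : p.1 ∈ U
          · rw [indicator_of_mem h, Pi.one_apply, ← ofReal_norm]
            exact ENNReal.ofReal_le_one.2 (hψ1 p.1)
          · rw [hψU _ h, enorm_zero]
            exact zero_le
    _ ≤ ENNReal.ofReal (absorptionBound n M) *
          (ENNReal.ofReal M * κ * ENNReal.ofReal ‖W φ‖) := by
        rw [lintegral_const_mul' _ _ ENNReal.ofReal_ne_top]
        gcongr
        exact hc.lintegral_streamOp_scatterOp_le hX hU hκ _
    _ ≤ ENNReal.ofReal (absorptionBound n M) *
          (ENNReal.ofReal M * κ * (ENNReal.ofReal ‖W‖ * ENNReal.ofReal ‖φ‖)) := by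
        gcongr
        rw [← ENNReal.ofReal_mul (norm_nonneg _)]
        exact ENNReal.ofReal_le_ofReal (W.le_opNorm φ)
    _ = _ := by
        push_cast
        simp only [ENNReal.ofReal]
        ring

end Coeffs.IsRegular

/-- The neighbourhoods of a segment are eventually negligible for the scattered radiation. -/
theorem exists_cthickening_segment (hn : 2 ≤ n) (x : Space n) (v : Dir n) (d : ℝ) {ε : ℝ≥0∞}
    (hε : ε ≠ 0) : ∃ r > 0, ∀ y : Space n, ∫⁻ w, (∫⁻ s in Ioc 0 d,
      (cthickening r ((fun t : ℝ => x + t • (v : Space n)) '' Icc (-d) d)).indicator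
        (1 : Space n → ℝ≥0∞) (y + s • (w : Space n))) ∂dirMeasure n ≤ ε := by
  set S := (fun t : ℝ => x + t • (v : Space n)) '' Icc (-d) d with hS
  have hScomp : IsCompact S := isCompact_Icc.image (by fun_prop)
  have hS0 : volume S = 0 := by
    have h1 : volume ((Submodule.span ℝ {(v : Space n)} : Submodule ℝ (Space n)) : Set (Space n))
        = 0 := by
      refine Measure.addHaar_submodule _ _ fun h => ?_
      have h2 := finrank_span_le_card (R := ℝ) ({(v : Space n)} : Set (Space n))
      rw [h, finrank_top] at h2
      simp at h2
      omega
    have h2 : S ⊆ (fun y => -x + y) ⁻¹'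
        ((Submodule.span ℝ {(v : Space n)} : Submodule ℝ (Space n)) : Set (Space n)) := by
      rintro _ ⟨t, -, rfl⟩
      simp only [mem_preimage, neg_add_cancel_left, SetLike.mem_coe]
      exact Submodule.smul_mem _ _ (Submodule.mem_span_singleton_self _)
    refine measure_mono_null h2 ?_
    rw [measure_preimage_add, h1]
  obtain ⟨η, hη, hηε⟩ : ∃ η : ℝ, 0 < η ∧ ENNReal.ofReal η * dirMeasure n univ ≤ ε / 2 := by
    by_cases h0 : dirMeasure n univ = 0
    · exact ⟨1, one_pos, by simp [h0]⟩
    have h1 : 0 < min 1 (ε / 2 / dirMeasure n univ) :=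
      lt_min one_pos (ENNReal.div_pos (ENNReal.half_pos hε).ne' (measure_ne_top _ _))
    have ht : min 1 (ε / 2 / dirMeasure n univ) ≠ ⊤ :=
      ((min_le_left _ _).trans_lt ENNReal.one_lt_top).ne
    refine ⟨(min 1 (ε / 2 / dirMeasure n univ)).toReal, ENNReal.toReal_pos h1.ne' ht, ?_⟩
    rw [ENNReal.ofReal_toReal ht]
    calc _ ≤ (ε / 2 / dirMeasure n univ) * dirMeasure n univ := by
          gcongr
          exact min_le_right _ _
      _ ≤ ε / 2 := (ENNReal.div_mul_cancel h0 (measure_ne_top _ _)).le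
  have hlim := tendsto_measure_cthickening_of_isCompact (μ := (volume : Measure (Space n))) hScomp
  rw [hS0] at hlim
  have hpow : ENNReal.ofReal (η ^ (n - 1)) ≠ 0 := by
    rw [Ne, ENNReal.ofReal_eq_zero, not_le]; positivity
  have h3 : ∀ᶠ r in 𝓝[>] (0 : ℝ), volume (cthickening r S) <
      ENNReal.ofReal (η ^ (n - 1)) * (ε / 2) := by
    refine (hlim.mono_left nhdsWithin_le_nhds).eventually (gt_mem_nhds ?_)
    exact ENNReal.mul_pos hpow (ENNReal.half_pos hε).ne'
  obtain ⟨r, hr, hr0⟩ := (h3.and self_mem_nhdsWithin).exists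
  refine ⟨r, hr0, fun y => ?_⟩
  refine (lintegral_dir_line_le (by omega) hη isClosed_cthickening.measurableSet y d).trans ?_
  calc _ ≤ ε / 2 + (ENNReal.ofReal (η ^ (n - 1)))⁻¹ * (ENNReal.ofReal (η ^ (n - 1)) * (ε / 2)) := by
        gcongr
    _ = ε := by
        rw [← mul_assoc, ENNReal.inv_mul_cancel hpow ENNReal.ofReal_ne_top, one_mul,
          ENNReal.add_halves]

/-- A characteristic of `X` starting close to `(x, v)` stays close to the segment from `x` in the
direction `v`. -/
theorem dist_entryPoint_line (hX : IsConvexDomain X) {p : Space n × Dir n} (hp : p.1 ∈ X)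
    (x : Space n) (v : Dir n) {ρ : ℝ} (h : dist (entryMap X p) (x, v) ≤ ρ) :
    p.1 ∈ cthickening ((1 + chordBound X) * ρ)
      ((fun t : ℝ => x + t • (v : Space n)) '' Icc (-chordBound X) (chordBound X)) := by
  set t := chordLength X p.1 (-p.2) with ht
  have h1 := entryPoint_add (X := X) p.1 p.2
  rw [← ht] at h1
  have h2 : |t| ≤ chordBound X := by
    have h3 := hX.dist_le_chordBound _ (subset_closure hp) _
      (frontier_subset_closure (hX.entryPoint_mem hp p.2).1)
    have h4 : p.1 - entryPoint X p.1 p.2 = t • (p.2 : Space n) := by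
      rw [sub_eq_iff_eq_add', h1]
    rwa [dist_eq_norm, h4, norm_smul, norm_dir, mul_one] at h3
  refine mem_cthickening_of_dist_le _ (x + t • (v : Space n)) _ _ ⟨t, abs_le.1 h2, rfl⟩ ?_
  have h4 : dist (entryPoint X p.1 p.2) x ≤ ρ := (le_max_left _ _).trans h
  have h5 : dist (p.2 : Space n) v ≤ ρ := (le_max_right _ _).trans h
  calc dist p.1 (x + t • (v : Space n))
      = dist (entryPoint X p.1 p.2 + t • (p.2 : Space n)) (x + t • (v : Space n)) := by rw [h1]
    _ ≤ dist (entryPoint X p.1 p.2) x + dist (t • (p.2 : Space n)) (t • (v : Space n)) :=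
        dist_add_add_le _ _ _ _
    _ = dist (entryPoint X p.1 p.2) x + |t| * dist (p.2 : Space n) v := by
        rw [dist_smul₀, Real.norm_eq_abs]
    _ ≤ ρ + chordBound X * ρ := by
        gcongr
        exact (chordBound_pos X).le
    _ = _ := by ring

variable (hc : c.IsRegular X M) (hc' : c'.IsRegular X M) (hX : IsConvexDomain X)
  {A A' : L1In X →L[ℝ] L1Space X}

include hc hc' in
theorem abs_ballisticDensity_sub_le (p : Space n × Dir n) :
    |c.ballisticDensity p - c'.ballisticDensity p| ≤ 2 * absorptionBound n M := by
  have h1 := hc.abs_ballisticDensity_le p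
  have h2 := hc'.abs_ballisticDensity_le p
  have h3 := abs_sub (c.ballisticDensity p) (c'.ballisticDensity p)
  linarith

include hc hX in
theorem integrable_ballisticDensity : Integrable c.ballisticDensity (phaseMeasure X) :=
  have := hX.isFiniteMeasure_phaseMeasure
  .of_bound hc.measurable_ballisticDensity.aestronglyMeasurable _
    (.of_forall hc.abs_ballisticDensity_le)

include hc hc' hX in
/-- The difference of the albedo operators, tested against the radiation entering through `B`. -/
theorem exists_setIntegral_ballisticDensity_le (hn : 1 ≤ n) (hσ₀ : 0 < σ₀)
    (hσ : ∀ᵐ p ∂phaseMeasure X, σ₀ ≤ c.sigmaA p.1 p.2)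
    (hσ' : ∀ᵐ p ∂phaseMeasure X, σ₀ ≤ c'.sigmaA p.1 p.2)
    (hA : IsAlbedoOperator X c A) (hA' : IsAlbedoOperator X c' A') :
    ∃ C : NNReal, ∀ (B : Set (Space n × Dir n)) (ψ : Space n → ℝ) (U : Set (Space n))
      (κ : NNReal), MeasurableSet B →
      Measurable ψ → (∀ x, |ψ x| ≤ 1) → (∀ x, x ∉ U → ψ x = 0) → MeasurableSet U →
      (∀ y, ∫⁻ v, (∫⁻ s in Ioc 0 (chordBound X),
        U.indicator (1 : Space n → ℝ≥0∞) (y + s • (v : Space n))) ∂dirMeasure n ≤ κ) →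
      ∫ p in entryMap X ⁻¹' B, ψ p.1 * (c.ballisticDensity p - c'.ballisticDensity p)
        ∂phaseMeasure X ≤ (‖A - A'‖ + C * κ) * (incomingMeasure X).real B := by
  have hfin := hX.isFiniteMeasure_incomingMeasure hn
  obtain ⟨C, hC⟩ := hc.exists_enorm_integral_sub_le hX hn hσ₀ hσ hA
  obtain ⟨C', hC'⟩ := hc'.exists_enorm_integral_sub_le hX hn hσ₀ hσ' hA'
  refine ⟨C + C', fun B ψ U κ hB hψ hψ1 hψU hU hκ => ?_⟩
  have hBe := hX.measurable_entryMap hB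
  set φ : L1In X := indicatorConstLp 1 hB (measure_ne_top _ _) (1 : ℝ) with hφ
  have hφn : ‖φ‖ = (incomingMeasure X).real B := by
    rw [hφ, norm_indicatorConstLp one_ne_zero ENNReal.one_ne_top]
    simp
  have hφe : ∀ᵐ p ∂phaseMeasure X, φ (entryMap X p) = (entryMap X ⁻¹' B).indicator 1 p := by
    filter_upwards [hX.ae_phase_entryPoint hn (indicatorConstLp_coeFn (p := 1) (hs := hB)
      (hμs := measure_ne_top (incomingMeasure X) B) (c := (1 : ℝ)))] with p hp
    exact hp
  have hint : ∀ c : Coeffs n, c.IsRegular X M →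
      Integrable (fun p => ψ p.1 * c.ballisticDensity p) (phaseMeasure X) := fun c hc =>
    (integrable_ballisticDensity hc hX).bdd_mul (hψ.comp measurable_fst).aestronglyMeasurable
      (.of_forall fun p => hψ1 p.1)
  have hball : ∀ c : Coeffs n, ∫ p, ψ p.1 * (c.ballisticDensity p * φ (entryMap X p))
      ∂phaseMeasure X = ∫ p in entryMap X ⁻¹' B, ψ p.1 * c.ballisticDensity p
        ∂phaseMeasure X := by
    intro c
    rw [← integral_indicator hBe]
    refine integral_congr_ae ?_
    filter_upwards [hφe] with p hp
    rw [hp]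
    by_cases h : p ∈ entryMap X ⁻¹' B
    · simp [indicator_of_mem h]
    · simp [indicator_of_notMem h]
  have key : ∀ {a b : ℝ} {C : NNReal}, ‖a - b‖ₑ ≤ C * κ * ENNReal.ofReal ‖φ‖ →
      |a - b| ≤ C * κ * ‖φ‖ := by
    intro a b C h
    rw [← ofReal_norm, ← ENNReal.ofReal_coe_nnreal, ← ENNReal.ofReal_coe_nnreal,
      ← ENNReal.ofReal_mul (by positivity), ← ENNReal.ofReal_mul (by positivity),
      ENNReal.ofReal_le_ofReal_iff (by positivity)] at h
    exact h
  have h1 := key (hC φ ψ U κ hψ hψ1 hψU hU hκ)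
  have h2 := key (hC' φ ψ U κ hψ hψ1 hψU hU hκ)
  rw [hball] at h1 h2
  have h3 : |∫ x, ψ x * A φ x ∂spaceMeasure X - ∫ x, ψ x * A' φ x ∂spaceMeasure X| ≤
      ‖A - A'‖ * ‖φ‖ := by
    have h4 : ∀ f : L1Space X, Integrable (fun x => ψ x * f x) (spaceMeasure X) :=
      fun f => (L1.integrable_coeFn _).bdd_mul hψ.aestronglyMeasurable (.of_forall hψ1)
    rw [← integral_sub (h4 _) (h4 _)]
    refine le_trans ?_ ((A - A').le_opNorm φ)
    rw [L1.norm_eq_integral_norm]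
    refine (abs_integral_le_integral_abs).trans (integral_mono_ae ?_ ?_ ?_)
    · exact ((h4 _).sub (h4 _)).abs
    · exact (L1.integrable_coeFn _).norm
    · filter_upwards [Lp.coeFn_sub (A φ) (A' φ)] with x hx
      have h5 : (A - A') φ = A φ - A' φ := rfl
      rw [h5, hx, Pi.sub_apply, ← mul_sub, abs_mul]
      exact mul_le_of_le_one_left (abs_nonneg _) (hψ1 x)
  simp only [mul_sub]
  rw [integral_sub (hint c hc).integrableOn (hint c' hc').integrableOn, ← hφn]
  rw [abs_le] at h1 h2 h3
  push_cast
  nlinarith [h1.1, h1.2, h2.1, h2.2, h3.1, h3.2]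

/-- The radiation absorbed on the characteristics issued from `B`, weighted by `f`. -/
theorem IsConvexDomain.setLIntegral_entryMap (hX : IsConvexDomain X) (hn : 1 ≤ n)
    {f : Space n × Dir n → ℝ≥0∞} (hf : Measurable f) {B : Set (Space n × Dir n)}
    (hB : MeasurableSet B) :
    ∫⁻ p in entryMap X ⁻¹' B, f p ∂phaseMeasure X =
      ∫⁻ p in B, (∫⁻ t in Ioo 0 (exitTime X p.1 p.2), f (p.1 + t • (p.2 : Space n), p.2))
        ∂incomingMeasure X := by
  have hBe := hX.measurable_entryMap hB
  rw [← lintegral_indicator hBe, ← lintegral_indicator hB,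
    hX.lintegral_phaseMeasure hn (hf.indicator hBe)]
  refine lintegral_congr_ae ?_
  filter_upwards [hX.ae_incoming] with p hp
  have h1 : ∀ t ∈ Ioo 0 (exitTime X p.1 p.2),
      entryMap X (p.1 + t • (p.2 : Space n), p.2) = p := fun t ht => by
    rw [entryMap, hX.entryPoint_of_incoming hp ht]
  by_cases h : p ∈ B
  · rw [indicator_of_mem h]
    refine setLIntegral_congr_fun measurableSet_Ioo fun t ht => ?_
    exact indicator_of_mem (by rw [mem_preimage, h1 t ht]; exact h) f
  · rw [indicator_of_notMem h]
    refine (setLIntegral_congr_fun (g := fun _ => 0) measurableSet_Ioo fun t ht => ?_).trans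
      (by simp)
    exact indicator_of_notMem (by rw [mem_preimage, h1 t ht]; exact h) f

include hc hc' hX in
/-- Radiation entering near a point runs along a thin tube, which the scattered
radiation does not see. The constant `2 * absorptionBound n M` is added to both sides in order to
keep the integrand nonnegative. -/
theorem exists_nhds_setLIntegral_ballisticDensity_le (hn : 2 ≤ n) (hσ₀ : 0 < σ₀)
    (hσ : ∀ᵐ p ∂phaseMeasure X, σ₀ ≤ c.sigmaA p.1 p.2)
    (hσ' : ∀ᵐ p ∂phaseMeasure X, σ₀ ≤ c'.sigmaA p.1 p.2)
    (hA : IsAlbedoOperator X c A) (hA' : IsAlbedoOperator X c' A')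
    {s : Space n × Dir n → ℝ} (hs : UniformContinuous s) (hs1 : ∀ p, |s p| ≤ 1)
    {ε : ℝ} (hε : 0 < ε) (p₀ : Space n × Dir n) :
    ∃ N ∈ 𝓝 p₀, ∀ B, B ⊆ N → MeasurableSet B →
      ∫⁻ p in entryMap X ⁻¹' B, ENNReal.ofReal (s p *
        (c.ballisticDensity p - c'.ballisticDensity p) + 2 * absorptionBound n M)
        ∂phaseMeasure X ≤
      ENNReal.ofReal (‖A - A'‖ + ε) * incomingMeasure X B +
        ENNReal.ofReal (2 * absorptionBound n M) * phaseMeasure X (entryMap X ⁻¹' B) := by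
  have hn1 : 1 ≤ n := by omega
  have hfin := hX.isFiniteMeasure_incomingMeasure hn1
  have hfin' := hX.isFiniteMeasure_phaseMeasure
  obtain ⟨C, hC⟩ := exists_setIntegral_ballisticDensity_le hc hc' hX hn1 hσ₀ hσ hσ' hA hA'
  set K := 2 * absorptionBound n M with hK
  have hDK := abs_ballisticDensity_sub_le hc hc'
  rw [← hK] at hDK
  have hK0 : 0 ≤ K := (abs_nonneg _).trans (hDK p₀)
  set d := chordBound X with hd
  have hd0 : 0 < d := chordBound_pos X
  -- half of `ε` is for the scattered radiation, half for the oscillation of `s` across the tube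
  set κ : NNReal := (ε / 2 / (C + 1)).toNNReal with hκ
  have hκ0 : 0 < κ := Real.toNNReal_pos.2 (by positivity)
  have hCκ : C * κ ≤ ε / 2 := by
    rw [hκ, Real.coe_toNNReal _ (by positivity), ← mul_div_assoc, div_le_iff₀ (by positivity)]
    nlinarith
  set ε' := ε / 2 / (K * d + 1) with hε'
  have hε'0 : 0 < ε' := by positivity
  have hε'K : ε' * K * d ≤ ε / 2 := by
    rw [hε', div_mul_eq_mul_div, div_mul_eq_mul_div, div_le_iff₀ (by positivity)]
    nlinarith
  obtain ⟨r, hr0, hr⟩ := exists_cthickening_segment hn p₀.1 p₀.2 d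
    (ε := (κ : ℝ≥0∞)) (by simpa using hκ0.ne')
  obtain ⟨ρ', hρ'0, hρ'⟩ := Metric.uniformContinuous_iff.1 hs ε' hε'0
  set ρ := min (r / (1 + d)) (ρ' / 2) with hρ
  have hρ0 : 0 < ρ := lt_min (by positivity) (by positivity)
  have hρr : (1 + d) * ρ ≤ r := by
    rw [mul_comm, ← le_div_iff₀ (by positivity)]
    exact min_le_left _ _
  set U := cthickening r ((fun t : ℝ => p₀.1 + t • (p₀.2 : Space n)) '' Icc (-d) d) with hU
  have hUm : MeasurableSet U := isClosed_cthickening.measurableSet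
  refine ⟨closedBall p₀ ρ, closedBall_mem_nhds _ hρ0, fun B hBN hB => ?_⟩
  have hBe := hX.measurable_entryMap hB
  have hsψ : Measurable fun x => s (x, p₀.2) := by
    have h : Continuous fun x : Space n => s (x, p₀.2) := hs.continuous.comp (by fun_prop)
    exact h.measurable
  -- the test function may not depend on the direction, so `s` is frozen at the direction of `p₀`
  set ψ := U.indicator fun x => s (x, p₀.2) with hψ
  have hψ1 : ∀ x, |ψ x| ≤ 1 := fun x => by
    rw [hψ]
    by_cases h : x ∈ U
    · rw [indicator_of_mem h]; exact hs1 _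
    · rw [indicator_of_notMem h, abs_zero]; exact zero_le_one
  have h1 := hC B ψ U κ hB (hsψ.indicator hUm) hψ1 (fun x hx => indicator_of_notMem hx _) hUm hr
  have hDint : Integrable (fun p => c.ballisticDensity p - c'.ballisticDensity p)
      (phaseMeasure X) :=
    (integrable_ballisticDensity hc hX).sub (integrable_ballisticDensity hc' hX)
  have hψD : Integrable (fun p => ψ p.1 * (c.ballisticDensity p - c'.ballisticDensity p))
      (phaseMeasure X) :=
    hDint.bdd_mul ((hsψ.indicator hUm).comp measurable_fst).aestronglyMeasurable
      (.of_forall fun p => hψ1 p.1)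
  have hsD : Integrable (fun p => s p * (c.ballisticDensity p - c'.ballisticDensity p))
      (phaseMeasure X) :=
    hDint.bdd_mul hs.continuous.measurable.aestronglyMeasurable (.of_forall hs1)
  have h2 : (phaseMeasure X).real (entryMap X ⁻¹' B) ≤ d * (incomingMeasure X).real B := by
    have h3 := hX.lintegral_entryPoint_le hn1 hX.dist_le_chordBound
      (measurable_one.indicator hB)
    rw [lintegral_indicator_one hB] at h3
    have h4 : ∫⁻ p, B.indicator (1 : Space n × Dir n → ℝ≥0∞) (entryPoint X p.1 p.2, p.2)
        ∂phaseMeasure X = phaseMeasure X (entryMap X ⁻¹' B) := by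
      rw [← lintegral_indicator_one hBe]
      rfl
    rw [h4] at h3
    have h5 := ENNReal.toReal_mono (ENNReal.mul_ne_top ENNReal.ofReal_ne_top
      (measure_ne_top _ _)) h3
    rwa [ENNReal.toReal_mul, ENNReal.toReal_ofReal hd0.le] at h5
  have h6 : ∀ᵐ p ∂(phaseMeasure X).restrict (entryMap X ⁻¹' B),
      s p * (c.ballisticDensity p - c'.ballisticDensity p) + K ≤
        ψ p.1 * (c.ballisticDensity p - c'.ballisticDensity p) + (ε' * K + K) := by
    filter_upwards [ae_restrict_mem hBe, ae_restrict_of_ae (ae_phase_mem hX)] with p hpB hpX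
    have h7 : dist (entryMap X p) (p₀.1, p₀.2) ≤ ρ := hBN hpB
    have h8 : p.1 ∈ U := cthickening_mono hρr _ (dist_entryPoint_line hX hpX p₀.1 p₀.2 h7)
    have h9 : dist p (p.1, p₀.2) < ρ' := by
      have h10 : dist p.2 p₀.2 ≤ ρ := (le_max_right _ _).trans h7
      have h11 : ρ ≤ ρ' / 2 := min_le_right _ _
      rw [Prod.dist_eq, dist_self, max_eq_right dist_nonneg]
      linarith
    have h12 := hρ' h9
    rw [Real.dist_eq] at h12
    have h13 : ψ p.1 = s (p.1, p₀.2) := indicator_of_mem h8 _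
    rw [h13]
    have h14 : (s p - s (p.1, p₀.2)) * (c.ballisticDensity p - c'.ballisticDensity p) ≤ ε' * K := by
      refine (le_abs_self _).trans ?_
      rw [abs_mul]
      exact mul_le_mul h12.le (hDK p) (abs_nonneg _) hε'0.le
    linarith
  have h15 : ∫ p in entryMap X ⁻¹' B, (s p * (c.ballisticDensity p - c'.ballisticDensity p) + K)
      ∂phaseMeasure X ≤ (‖A - A'‖ + ε) * (incomingMeasure X).real B +
        K * (phaseMeasure X).real (entryMap X ⁻¹' B) := by
    refine (integral_mono_ae (hsD.integrableOn.add (integrable_const _))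
      (hψD.integrableOn.add (integrable_const _)) h6).trans ?_
    rw [integral_add' hψD.integrableOn (integrable_const _), setIntegral_const, smul_eq_mul]
    have h16 : ε' * K * (phaseMeasure X).real (entryMap X ⁻¹' B) ≤
        ε / 2 * (incomingMeasure X).real B := by
      calc _ ≤ ε' * K * (d * (incomingMeasure X).real B) := by gcongr
        _ = (ε' * K * d) * (incomingMeasure X).real B := by ring
        _ ≤ _ := by gcongr
    have h17 : C * κ * (incomingMeasure X).real B ≤ ε / 2 * (incomingMeasure X).real B := by
      gcongr
    nlinarith
  rw [← ofReal_integral_eq_lintegral_ofReal (f := fun p => s p *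
    (c.ballisticDensity p - c'.ballisticDensity p) + K)
    (hsD.integrableOn.add (integrable_const _))]
  · refine (ENNReal.ofReal_le_ofReal h15).trans_eq ?_
    rw [ENNReal.ofReal_add (by positivity) (by positivity), ENNReal.ofReal_mul (by positivity),
      ENNReal.ofReal_mul hK0, ofReal_measureReal, ofReal_measureReal]
  · refine .of_forall fun p => ?_
    have h18 : |s p * (c.ballisticDensity p - c'.ballisticDensity p)| ≤ K := by
      rw [abs_mul]
      exact (mul_le_of_le_one_left (abs_nonneg _) (hs1 p)).trans (hDK p)
    have := (abs_le.1 h18).1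
    simp only [Pi.zero_apply]
    linarith

include hc hc' hX in
/-- The local estimate holds for all Borel sets, since both sides are measures in `B`, and without
the error `ε`. -/
theorem setLIntegral_ballisticDensity_le (hn : 2 ≤ n) (hσ₀ : 0 < σ₀)
    (hσ : ∀ᵐ p ∂phaseMeasure X, σ₀ ≤ c.sigmaA p.1 p.2)
    (hσ' : ∀ᵐ p ∂phaseMeasure X, σ₀ ≤ c'.sigmaA p.1 p.2)
    (hA : IsAlbedoOperator X c A) (hA' : IsAlbedoOperator X c' A')
    {s : Space n × Dir n → ℝ} (hs : UniformContinuous s) (hs1 : ∀ p, |s p| ≤ 1)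
    {B : Set (Space n × Dir n)} (hB : MeasurableSet B) :
    ∫⁻ p in entryMap X ⁻¹' B, ENNReal.ofReal (s p *
      (c.ballisticDensity p - c'.ballisticDensity p) + 2 * absorptionBound n M)
      ∂phaseMeasure X ≤
    ENNReal.ofReal ‖A - A'‖ * incomingMeasure X B +
      ENNReal.ofReal (2 * absorptionBound n M) * phaseMeasure X (entryMap X ⁻¹' B) := by
  have hfin := hX.isFiniteMeasure_incomingMeasure (by omega)
  set f : Space n × Dir n → ℝ≥0∞ := fun p => ENNReal.ofReal (s p *
      (c.ballisticDensity p - c'.ballisticDensity p) + 2 * absorptionBound n M) with hf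
  have he := hX.measurable_entryMap
  have h1 : ∀ ε : ℝ, 0 < ε → ((phaseMeasure X).withDensity f).map (entryMap X) ≤
      ENNReal.ofReal (‖A - A'‖ + ε) • incomingMeasure X +
        ENNReal.ofReal (2 * absorptionBound n M) • (phaseMeasure X).map (entryMap X) := by
    intro ε hε
    refine measure_le_of_locally_le fun p₀ => ?_
    obtain ⟨N, hN, hle⟩ := exists_nhds_setLIntegral_ballisticDensity_le hc hc' hX hn hσ₀ hσ hσ'
      hA hA' hs hs1 hε p₀
    refine ⟨N, hN, fun B hBN hB => ?_⟩
    rw [Measure.map_apply he hB, withDensity_apply _ (he hB), Measure.add_apply,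
      Measure.smul_apply, Measure.smul_apply, Measure.map_apply he hB]
    exact hle B hBN hB
  refine ENNReal.le_of_forall_pos_le_add fun η hη _ => ?_
  set ε : ℝ := η / ((incomingMeasure X).real B + 1) with hε
  have hε0 : 0 < ε := by positivity
  have h2 := h1 ε hε0 B
  rw [Measure.map_apply he hB, withDensity_apply _ (he hB), Measure.add_apply,
    Measure.smul_apply, Measure.smul_apply, Measure.map_apply he hB] at h2
  refine h2.trans ?_
  rw [ENNReal.ofReal_add (norm_nonneg _) hε0.le, add_smul, smul_eq_mul, smul_eq_mul, smul_eq_mul,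
    add_right_comm]
  gcongr
  rw [← ofReal_measureReal, ← ENNReal.ofReal_mul hε0.le, ← ENNReal.ofReal_coe_nnreal]
  refine ENNReal.ofReal_le_ofReal ?_
  rw [hε, div_mul_eq_mul_div, div_le_iff₀ (by positivity)]
  nlinarith [η.coe_nonneg]

/-- A bounded measurable function is approximated by uniformly continuous ones with the same
bound. -/
theorem exists_uniformContinuous_approx (hX : IsConvexDomain X) {f : Space n × Dir n → ℝ}
    (hf : Measurable f) (hf1 : ∀ p, |f p| ≤ 1) {η : ℝ≥0∞} (hη : η ≠ 0) :
    ∃ s : Space n × Dir n → ℝ, UniformContinuous s ∧ (∀ p, |s p| ≤ 1) ∧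
      ∫⁻ p, ‖f p - s p‖ₑ ∂phaseMeasure X ≤ η := by
  have hfin := hX.isFiniteMeasure_phaseMeasure
  have hf' : MemLp f 1 (phaseMeasure X) := .of_bound hf.aestronglyMeasurable 1 (.of_forall hf1)
  obtain ⟨g, hg1, hg2, hg3, -⟩ := hf'.exists_hasCompactSupport_eLpNorm_sub_le ENNReal.one_ne_top hη
  have hg4 := hg1.uniformContinuous_of_continuous hg3
  refine ⟨fun p => max (-1) (min 1 (g p)), ?_, fun p => abs_le.2 ⟨le_max_left _ _,
    max_le (by norm_num) (min_le_left _ _)⟩, ?_⟩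
  · have h1 : LipschitzWith 1 fun t : ℝ => max (-1) (min 1 t) :=
      (LipschitzWith.id.const_min 1).const_max (-1)
    exact h1.uniformContinuous.comp hg4
  · rw [eLpNorm_one_eq_lintegral_enorm] at hg2
    refine (lintegral_mono fun p => ?_).trans hg2
    rw [← ofReal_norm, ← ofReal_norm]
    refine ENNReal.ofReal_le_ofReal ?_
    have h2 := abs_le.1 (hf1 p)
    have h1 : f p = max (-1) (min 1 (f p)) := by
      rw [min_eq_right h2.2, max_eq_right h2.1]
    have h3 : LipschitzWith 1 fun t : ℝ => max (-1) (min 1 t) :=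
      (LipschitzWith.id.const_min 1).const_max (-1)
    have h4 := h3.dist_le_mul (f p) (g p)
    simp only [← h1] at h4
    rw [Real.dist_eq, Real.dist_eq, NNReal.coe_one, one_mul] at h4
    exact h4

include hc hc' hX in
/-- The albedo operator controls the ballistic absorption along almost every characteristic. -/
theorem ae_lintegral_ballisticDensity_sub_le (hn : 2 ≤ n) (hσ₀ : 0 < σ₀)
    (hσ : ∀ᵐ p ∂phaseMeasure X, σ₀ ≤ c.sigmaA p.1 p.2)
    (hσ' : ∀ᵐ p ∂phaseMeasure X, σ₀ ≤ c'.sigmaA p.1 p.2)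
    (hA : IsAlbedoOperator X c A) (hA' : IsAlbedoOperator X c' A') :
    ∀ᵐ p ∂incomingMeasure X, ∫⁻ t in Ioo 0 (exitTime X p.1 p.2),
      ‖c.ballisticDensity (p.1 + t • (p.2 : Space n), p.2) -
        c'.ballisticDensity (p.1 + t • (p.2 : Space n), p.2)‖ₑ ≤ ENNReal.ofReal ‖A - A'‖ := by
  have hn1 : 1 ≤ n := by omega
  have hfin := hX.isFiniteMeasure_incomingMeasure hn1
  set K := 2 * absorptionBound n M with hK
  set D : Space n × Dir n → ℝ := fun p => c.ballisticDensity p - c'.ballisticDensity p with hD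
  have hDm : Measurable D := hc.measurable_ballisticDensity.sub hc'.measurable_ballisticDensity
  have hDK : ∀ p, |D p| ≤ K := abs_ballisticDensity_sub_le hc hc'
  have he := hX.measurable_entryMap
  set f : Space n × Dir n → ℝ≥0∞ := fun p => ‖D p‖ₑ + ENNReal.ofReal K with hf
  have hfm : Measurable f := hDm.enorm.add_const _
  have h1 : ∀ B, MeasurableSet B → ∫⁻ p in entryMap X ⁻¹' B, f p ∂phaseMeasure X ≤
      ENNReal.ofReal ‖A - A'‖ * incomingMeasure X B +
        ENNReal.ofReal K * phaseMeasure X (entryMap X ⁻¹' B) := by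
    intro B hB
    refine ENNReal.le_of_forall_pos_le_add fun η hη _ => ?_
    -- the sign of `D` turns `D` into `|D|`; it is only a limit of admissible test functions
    set S : Space n × Dir n → ℝ := fun p => if 0 ≤ D p then 1 else -1 with hS
    have hSm : Measurable S :=
      Measurable.ite (measurableSet_le measurable_const hDm) measurable_const measurable_const
    obtain ⟨s, hs, hs1, hsη⟩ := exists_uniformContinuous_approx hX hSm
      (fun p => by simp only [hS]; split_ifs <;> simp)
      (η := (η / (K.toNNReal + 1) : NNReal)) (by
        rw [ENNReal.coe_ne_zero]; positivity)
    have h2 := setLIntegral_ballisticDensity_le hc hc' hX hn hσ₀ hσ hσ' hA hA' hs hs1 hB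
    have h3 : ∀ p, f p ≤ ENNReal.ofReal (s p * D p + K) + ENNReal.ofReal K * ‖S p - s p‖ₑ := by
      intro p
      have hK0 : 0 ≤ K := (abs_nonneg _).trans (hDK p)
      simp only [hf]
      rw [← ofReal_norm, ← ofReal_norm, ← ENNReal.ofReal_add (norm_nonneg _) hK0,
        ← ENNReal.ofReal_mul hK0]
      refine (ENNReal.ofReal_le_ofReal ?_).trans ENNReal.ofReal_add_le
      have h4 : |D p| = S p * D p := by
        simp only [hS]; split_ifs with h
        · rw [abs_of_nonneg h, one_mul]
        · rw [abs_of_neg (not_le.1 h), neg_one_mul]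
      have h5 : (S p - s p) * D p ≤ K * |S p - s p| := by
        refine (le_abs_self _).trans ?_
        rw [abs_mul, mul_comm]
        exact mul_le_mul_of_nonneg_right (hDK p) (abs_nonneg _)
      rw [Real.norm_eq_abs, Real.norm_eq_abs, h4]
      linarith
    calc ∫⁻ p in entryMap X ⁻¹' B, f p ∂phaseMeasure X
        ≤ ∫⁻ p in entryMap X ⁻¹' B, (ENNReal.ofReal (s p * D p + K) +
            ENNReal.ofReal K * ‖S p - s p‖ₑ) ∂phaseMeasure X := lintegral_mono fun p => h3 p
      _ = ∫⁻ p in entryMap X ⁻¹' B, ENNReal.ofReal (s p * D p + K) ∂phaseMeasure X +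
            ENNReal.ofReal K * ∫⁻ p in entryMap X ⁻¹' B, ‖S p - s p‖ₑ ∂phaseMeasure X := by
          have h6 : Measurable fun p => ENNReal.ofReal (s p * D p + K) :=
            ((hs.continuous.measurable.mul hDm).add_const _).ennreal_ofReal
          rw [lintegral_add_left h6, lintegral_const_mul' _ _ ENNReal.ofReal_ne_top]
      _ ≤ _ := by
          refine add_le_add h2 ?_
          calc _ ≤ ENNReal.ofReal K * (η / (K.toNNReal + 1) : NNReal) := by
                gcongr
                exact (setLIntegral_le_lintegral _ _).trans hsη
            _ ≤ η := by
                rw [ENNReal.ofReal, ← ENNReal.coe_mul, ENNReal.coe_le_coe, ← mul_div_assoc,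
                  div_le_iff₀ (by positivity), mul_comm]
                gcongr
                exact le_self_add
  have h7 : (fun p : Space n × Dir n => ∫⁻ t in Ioo 0 (exitTime X p.1 p.2),
      f (p.1 + t • (p.2 : Space n), p.2)) ≤ᵐ[incomingMeasure X]
      fun p => ENNReal.ofReal ‖A - A'‖ + (∫⁻ _ in Ioo 0 (exitTime X p.1 p.2),
        ENNReal.ofReal K) := by
    refine ae_le_of_forall_setLIntegral_le_of_sigmaFinite₀ (hX.aemeasurable_lintegral_chord hfm)
      fun B hB _ => ?_
    rw [← hX.setLIntegral_entryMap hn1 hfm hB, lintegral_add_left measurable_const,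
      ← hX.setLIntegral_entryMap hn1 (f := fun _ => ENNReal.ofReal K) measurable_const hB,
      setLIntegral_const, setLIntegral_const]
    exact h1 B hB
  filter_upwards [h7] with p hp
  simp only [hf] at hp
  rw [lintegral_add_right _ measurable_const] at hp
  have ht : ∫⁻ _ in Ioo 0 (exitTime X p.1 p.2), ENNReal.ofReal K ≠ ⊤ := by
    rw [setLIntegral_const, Real.volume_Ioo]
    exact ENNReal.mul_ne_top ENNReal.ofReal_ne_top ENNReal.ofReal_ne_top
  exact (ENNReal.add_le_add_iff_right ht).1 hp

end Comparison

/-! ### Reconstruction along a characteristic -/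

section Line

theorem abs_log_sub_log_le {m x y : ℝ} (hm : 0 < m) (hx : m ≤ x) (hy : m ≤ y) :
    |Real.log x - Real.log y| ≤ |x - y| / m := by
  have key : ∀ {x y : ℝ}, m ≤ x → m ≤ y → Real.log x - Real.log y ≤ |x - y| / m := by
    intro x y hx hy
    have hx0 := hm.trans_le hx
    have hy0 := hm.trans_le hy
    rw [← Real.log_div hx0.ne' hy0.ne']
    calc Real.log (x / y) ≤ x / y - 1 := Real.log_le_sub_one_of_pos (div_pos hx0 hy0)
      _ = (x - y) / y := by field_simp
      _ ≤ |x - y| / y := by gcongr; exact le_abs_self _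
      _ ≤ |x - y| / m := by gcongr
  refine abs_le.2 ⟨?_, key hx hy⟩
  have := key hy hx
  rw [abs_sub_comm] at this
  linarith

/-- The logarithm expands distances on `(0, M]` at least by the factor `M⁻¹`. -/
theorem abs_sub_le_mul_abs_log_sub_log {M x y : ℝ} (hx0 : 0 < x) (hy0 : 0 < y) (hx : x ≤ M)
    (hy : y ≤ M) : |x - y| ≤ M * |Real.log x - Real.log y| := by
  have key : ∀ {x y : ℝ}, 0 < x → 0 < y → x ≤ M → x - y ≤ M * |Real.log x - Real.log y| := by
    intro x y hx0 hy0 hx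
    have h1 := Real.log_le_sub_one_of_pos (div_pos hy0 hx0)
    rw [Real.log_div hy0.ne' hx0.ne'] at h1
    have h2 : x * (Real.log y - Real.log x) ≤ x * (y / x - 1) :=
      mul_le_mul_of_nonneg_left h1 hx0.le
    have h3 : x * (y / x - 1) = y - x := by field_simp
    calc x - y ≤ x * (Real.log x - Real.log y) := by linarith
      _ ≤ x * |Real.log x - Real.log y| := by gcongr; exact le_abs_self _
      _ ≤ _ := by gcongr
  refine abs_le.2 ⟨?_, key hx0 hy0 hx⟩
  have := key hy0 hx0 hy
  rw [abs_sub_comm] at this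
  linarith

variable {a a' b b' : ℝ → ℝ} {τ d M σ₀ δ₀ δ : ℝ}

theorem integral_le_of_support (h0 : ∀ t ∉ Ioo 0 τ, a t = 0) (hn : ∀ t, 0 ≤ a t)
    (hM : ∀ t, a t ≤ M) (hτ : 0 ≤ τ) (hτd : τ ≤ d) : ∫ t, a t ≤ M * d := by
  have hM0 : 0 ≤ M := (hn 0).trans (hM 0)
  rw [← setIntegral_eq_integral_of_forall_compl_eq_zero h0]
  have h1 := norm_setIntegral_le_of_norm_le_const (μ := volume) (s := Ioo 0 τ) (f := a) (C := M)
    (by simp) (fun t _ => by rw [Real.norm_of_nonneg (hn t)]; exact hM t)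
  rw [Real.volume_real_Ioo_of_le hτ, sub_zero] at h1
  exact (le_abs_self _).trans (h1.trans (by gcongr))

/-- The integral of the attenuation `a` beyond `t` minus the integral up to `t`. -/
def lineImbalance (a : ℝ → ℝ) (t : ℝ) : ℝ := (∫ s, a s) - 2 * lineDepth a t

/-- The ballistic absorptions of the two beams travelling in opposite directions along a chord
determine the imbalance of the attenuation, by their ratio, and then the absorption
coefficient, by their product; the total attenuation of the chord is known since the imbalance
is constant near the boundary. -/
theorem line_stability (ha : Integrable a) (ha' : Integrable a')
    (h0 : ∀ t ∉ Ioo 0 τ, a t = 0) (h0' : ∀ t ∉ Ioo 0 τ, a' t = 0)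
    (hn : ∀ t, 0 ≤ a t) (hn' : ∀ t, 0 ≤ a' t) (hM : ∀ t, a t ≤ M) (hM' : ∀ t, a' t ≤ M)
    (hτ : 0 ≤ τ) (hτd : τ ≤ d) (hσ₀ : 0 < σ₀) (hδ₀ : 0 < δ₀) (hδ : 0 ≤ δ)
    (hagree : ∀ᵐ t, t < δ₀ → a t = a' t)
    (hbm : Measurable b) (hbm' : Measurable b')
    (hb : ∀ᵐ t, t ∈ Ioo 0 τ → b t ∈ Icc σ₀ M) (hb' : ∀ᵐ t, t ∈ Ioo 0 τ → b' t ∈ Icc σ₀ M)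
    (hD : ∫⁻ t in Ioo 0 τ, ‖b t * Real.exp (-lineDepth a t) -
      b' t * Real.exp (-lineDepth a' t)‖ₑ ≤ ENNReal.ofReal δ)
    (hD' : ∫⁻ t in Ioo 0 τ, ‖b t * Real.exp (-((∫ s, a s) - lineDepth a t)) -
      b' t * Real.exp (-((∫ s, a' s) - lineDepth a' t))‖ₑ ≤ ENNReal.ofReal δ) :
    ∫⁻ t in Ioo 0 τ, ‖lineImbalance a t - lineImbalance a' t‖ₑ ≤
        ENNReal.ofReal (2 * δ / (σ₀ * Real.exp (-(M * d)))) ∧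
      ∫⁻ t in Ioo 0 τ, ‖b t - b' t‖ₑ ≤
        ENNReal.ofReal (M * (1 + d / δ₀) / (σ₀ * Real.exp (-(M * d))) * δ) := by
  set m := σ₀ * Real.exp (-(M * d)) with hm
  have hm0 : 0 < m := by positivity
  have hM0 : 0 ≤ M := (hn 0).trans (hM 0)
  have hd0 : 0 ≤ d := hτ.trans hτd
  set S := ∫ s, a s with hS
  set S' := ∫ s, a' s with hS'
  have hSd : S ≤ M * d := integral_le_of_support h0 hn hM hτ hτd
  have hSd' : S' ≤ M * d := integral_le_of_support h0' hn' hM' hτ hτd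
  set P : ℝ → ℝ := fun t => b t * Real.exp (-lineDepth a t) -
      b' t * Real.exp (-lineDepth a' t) with hP
  set Q : ℝ → ℝ := fun t => b t * Real.exp (-(S - lineDepth a t)) -
      b' t * Real.exp (-(S' - lineDepth a' t)) with hQ
  have hdm : Measurable (lineDepth a) := (lipschitzWith_lineDepth ha hn hM).continuous.measurable
  have hdm' : Measurable (lineDepth a') :=
    (lipschitzWith_lineDepth ha' hn' hM').continuous.measurable
  have hPm : Measurable P := (hbm.mul hdm.neg.exp).sub (hbm'.mul hdm'.neg.exp)
  have hQm : Measurable Q := (hbm.mul (measurable_const.sub hdm).neg.exp).sub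
    (hbm'.mul (measurable_const.sub hdm').neg.exp)
  have hle : ∀ {β x : ℝ}, σ₀ ≤ β → x ≤ M * d → m ≤ β * Real.exp (-x) := by
    intro β x hβ hx
    exact mul_le_mul hβ (Real.exp_le_exp.2 (by linarith)) (Real.exp_pos _).le (hσ₀.le.trans hβ)
  have hlog : ∀ {β : ℝ} (x : ℝ), σ₀ ≤ β → Real.log (β * Real.exp (-x)) = Real.log β - x := by
    intro β x hβ
    rw [Real.log_mul (hσ₀.trans_le hβ).ne' (Real.exp_pos _).ne', Real.log_exp, sub_eq_add_neg]
  -- the difference and the sum of the logarithms of the two absorptions are the imbalance and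
  -- `2 log b - S`
  have hpt : ∀ᵐ t, t ∈ Ioo 0 τ →
      |lineImbalance a t - lineImbalance a' t| ≤ (|P t| + |Q t|) / m ∧
      |b t - b' t| ≤ M / 2 * ((|P t| + |Q t|) / m + |S - S'|) := by
    filter_upwards [hb, hb'] with t h1 h2 ht
    obtain ⟨h1, h1M⟩ := h1 ht
    obtain ⟨h2, h2M⟩ := h2 ht
    have e1 := lineDepth_le_integral ha hn t
    have e2 := lineDepth_le_integral ha' hn' t
    have e3 := lineDepth_nonneg hn t
    have e4 := lineDepth_nonneg hn' t
    have hp := abs_log_sub_log_le hm0 (hle h1 (e1.trans hSd)) (hle h2 (e2.trans hSd'))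
    have hq := abs_log_sub_log_le hm0 (x := b t * Real.exp (-(S - lineDepth a t)))
      (y := b' t * Real.exp (-(S' - lineDepth a' t)))
      (hle h1 (by linarith)) (hle h2 (by linarith))
    rw [hlog _ h1, hlog _ h2] at hp hq
    have hsum : |P t| / m + |Q t| / m = (|P t| + |Q t|) / m := by ring
    rw [← hsum]
    refine ⟨?_, ?_⟩
    · refine le_trans ?_ (add_le_add hp hq)
      refine le_trans (le_of_eq ?_) (abs_sub _ _)
      rw [lineImbalance, lineImbalance]
      congr 1
      ring
    · refine (abs_sub_le_mul_abs_log_sub_log (hσ₀.trans_le h1) (hσ₀.trans_le h2) h1M h2M).trans ?_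
      rw [div_mul_eq_mul_div, le_div_iff₀ two_pos, mul_assoc]
      refine mul_le_mul_of_nonneg_left ?_ hM0
      have h3 : 2 * (Real.log (b t) - Real.log (b' t)) =
          ((Real.log (b t) - lineDepth a t - (Real.log (b' t) - lineDepth a' t)) +
          (Real.log (b t) - (S - lineDepth a t) - (Real.log (b' t) - (S' - lineDepth a' t)))) +
          (S - S') := by ring
      calc |Real.log (b t) - Real.log (b' t)| * 2
          = |2 * (Real.log (b t) - Real.log (b' t))| := by
            rw [abs_mul, abs_two, mul_comm]
        _ ≤ _ := by
            rw [h3]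
            refine (abs_add_le _ _).trans (add_le_add ((abs_add_le _ _).trans ?_) le_rfl)
            exact add_le_add hp hq
  have hPQ : ∫⁻ t in Ioo 0 τ, ENNReal.ofReal ((|P t| + |Q t|) / m) ≤
      ENNReal.ofReal (2 * δ / m) := by
    have h1 : ∀ t, ENNReal.ofReal ((|P t| + |Q t|) / m) =
        (‖P t‖ₑ + ‖Q t‖ₑ) * ENNReal.ofReal m⁻¹ := by
      intro t
      rw [← ofReal_norm, ← ofReal_norm, ← ENNReal.ofReal_add (norm_nonneg _) (norm_nonneg _),
        ← ENNReal.ofReal_mul (by positivity), div_eq_mul_inv]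
      rfl
    simp only [h1]
    rw [lintegral_mul_const' _ _ ENNReal.ofReal_ne_top, lintegral_add_left hPm.enorm,
      div_eq_mul_inv, ENNReal.ofReal_mul (by positivity)]
    gcongr
    refine (add_le_add hD hD').trans_eq ?_
    rw [← ENNReal.ofReal_add hδ hδ, two_mul]
  have hG : ∫⁻ t in Ioo 0 τ, ‖lineImbalance a t - lineImbalance a' t‖ₑ ≤
      ENNReal.ofReal (2 * δ / m) := by
    refine le_trans (lintegral_mono_ae ?_) hPQ
    filter_upwards [ae_restrict_of_ae hpt, ae_restrict_mem measurableSet_Ioo] with t h1 h2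
    rw [← ofReal_norm]
    exact ENNReal.ofReal_le_ofReal (h1 h2).1
  -- for `t < δ₀` the depths agree, and the imbalances differ by exactly `S - S'`
  have hSS : |S - S'| ≤ 2 * δ / m / δ₀ := by
    by_cases hτδ : τ ≤ δ₀
    · have h1 : S = S' := by
        refine integral_congr_ae ?_
        filter_upwards [hagree] with t ht
        by_cases h2 : t < δ₀
        · exact ht h2
        · have h3 : t ∉ Ioo 0 τ := fun h => h2 (h.2.trans_le hτδ)
          rw [h0 t h3, h0' t h3]
      rw [h1, sub_self, abs_zero]
      positivity
    · have h1 : ∀ t ∈ Ioo 0 δ₀, lineImbalance a t - lineImbalance a' t = S - S' := by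
        intro t ht
        have h2 : lineDepth a t = lineDepth a' t := by
          refine setIntegral_congr_ae measurableSet_Iic ?_
          filter_upwards [hagree] with s hs hst
          exact hs (lt_of_le_of_lt hst ht.2)
        rw [lineImbalance, lineImbalance, h2]
        ring
      have h3 : ENNReal.ofReal (|S - S'| * δ₀) ≤ ENNReal.ofReal (2 * δ / m) := by
        refine le_trans ?_ hG
        calc ENNReal.ofReal (|S - S'| * δ₀) = ∫⁻ _ in Ioo 0 δ₀, ‖S - S'‖ₑ := by
              rw [setLIntegral_const, Real.volume_Ioo, sub_zero, ← ofReal_norm,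
                ENNReal.ofReal_mul (abs_nonneg _)]
              rfl
          _ = ∫⁻ t in Ioo 0 δ₀, ‖lineImbalance a t - lineImbalance a' t‖ₑ :=
              setLIntegral_congr_fun measurableSet_Ioo fun t ht => by simp only [h1 t ht]
          _ ≤ _ := lintegral_mono_set (Ioo_subset_Ioo_right (not_le.1 hτδ).le)
      rw [ENNReal.ofReal_le_ofReal_iff (by positivity)] at h3
      rwa [le_div_iff₀ hδ₀]
  refine ⟨hG, ?_⟩
  calc ∫⁻ t in Ioo 0 τ, ‖b t - b' t‖ₑ
      ≤ ∫⁻ t in Ioo 0 τ, ENNReal.ofReal (M / 2) *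
          (ENNReal.ofReal ((|P t| + |Q t|) / m) + ENNReal.ofReal |S - S'|) := by
        refine lintegral_mono_ae ?_
        filter_upwards [ae_restrict_of_ae hpt, ae_restrict_mem measurableSet_Ioo] with t h1 h2
        rw [← ofReal_norm, ← ENNReal.ofReal_add (by positivity) (by positivity),
          ← ENNReal.ofReal_mul (by positivity)]
        exact ENNReal.ofReal_le_ofReal (h1 h2).2
    _ = ENNReal.ofReal (M / 2) * ((∫⁻ t in Ioo 0 τ, ENNReal.ofReal ((|P t| + |Q t|) / m)) +
          ENNReal.ofReal |S - S'| * ENNReal.ofReal τ) := by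
        rw [lintegral_const_mul' _ _ ENNReal.ofReal_ne_top, lintegral_add_right _ measurable_const,
          setLIntegral_const, Real.volume_Ioo, sub_zero]
    _ ≤ ENNReal.ofReal (M / 2) * (ENNReal.ofReal (2 * δ / m) +
          ENNReal.ofReal (2 * δ / m / δ₀) * ENNReal.ofReal d) := by
        gcongr
    _ = _ := by
        rw [← ENNReal.ofReal_mul (by positivity), ← ENNReal.ofReal_add (by positivity)
          (by positivity), ← ENNReal.ofReal_mul (by positivity)]
        congr 1
        ring

end Line

/-! ### Reversing the direction -/

section Reversal

variable {n : ℕ} {X : Set (Space n)} {M σ₀ δ₀ : ℝ} {c c' : Coeffs n}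

open scoped Pointwise in
theorem measurePreserving_dir_neg (n : ℕ) :
    MeasurePreserving (fun v : Dir n => -v) (dirMeasure n) (dirMeasure n) := by
  refine ⟨measurable_dir_neg, Measure.ext fun s hs => ?_⟩
  rw [Measure.map_apply measurable_dir_neg hs, dirMeasure,
    Measure.toSphere_apply' _ (measurable_dir_neg hs), Measure.toSphere_apply' _ hs,
    ← Measure.measure_neg (volume : Measure (Space n)) (Ioo (0 : ℝ) 1 • (Subtype.val '' s))]
  congr 2
  ext x
  simp only [mem_neg, mem_smul, mem_image, mem_preimage]
  constructor
  · rintro ⟨r, hr, _, ⟨v, hv, rfl⟩, rfl⟩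
    exact ⟨r, hr, _, ⟨-v, hv, rfl⟩, by simp⟩
  · rintro ⟨r, hr, _, ⟨v, hv, rfl⟩, h⟩
    refine ⟨r, hr, _, ⟨-v, by simpa using hv, rfl⟩, ?_⟩
    rw [← neg_neg x, ← h]
    simp

theorem measurePreserving_reverse (X : Set (Space n)) :
    MeasurePreserving (fun p : Space n × Dir n => (p.1, -p.2)) (phaseMeasure X)
      (phaseMeasure X) :=
  (MeasurePreserving.id (spaceMeasure X)).prod (measurePreserving_dir_neg n)

theorem Coeffs.AEEq.symmetric (h : c.AEEq X c') (hs : c.Symmetric X) : c'.Symmetric X where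
  sigmaA_neg := by
    filter_upwards [h.sigmaA, hs.sigmaA_neg,
      (measurePreserving_reverse X).quasiMeasurePreserving.ae h.sigmaA] with p h1 h2 h3
    rw [← h1, h2, h3]
  sigma_neg := by
    filter_upwards [h.sigma, hs.sigma_neg,
      (measurePreserving_reverse X).quasiMeasurePreserving.ae h.sigma] with p h1 h2 h3
    rw [← h1, h2, h3]

theorem AgreeNearBoundary.congr {d d' : Coeffs n} (h : AgreeNearBoundary X δ₀ c c')
    (hc : c.AEEq X d) (hc' : c'.AEEq X d') : AgreeNearBoundary X δ₀ d d' := by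
  filter_upwards [h, hc.sigma, hc'.sigma] with p h1 h2 h3 h4
  rw [← h2, ← h3, h1 h4]

/-- A bound for the integrals of `f` over almost all characteristics also holds for
the characteristics run through backwards. -/
theorem IsConvexDomain.ae_lintegral_reverse (hX : IsConvexDomain X) (hn : 1 ≤ n)
    {f : Space n × Dir n → ℝ≥0∞} {L : ℝ≥0∞}
    (h : ∀ᵐ p ∂incomingMeasure X, ∫⁻ t in Ioo 0 (exitTime X p.1 p.2),
      f (p.1 + t • (p.2 : Space n), p.2) ≤ L) :
    ∀ᵐ p ∂incomingMeasure X, ∫⁻ t in Ioo 0 (exitTime X p.1 p.2),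
      f (p.1 + t • (p.2 : Space n), -p.2) ≤ L := by
  set F : Space n × Dir n → ℝ≥0∞ := fun p =>
    ∫⁻ t : ℝ, X.indicator (fun x => f (x, p.2)) (p.1 + t • (p.2 : Space n)) with hF
  have hFt : ∀ (p : Space n × Dir n) (s : ℝ), F (p.1 + s • (p.2 : Space n), p.2) = F p := by
    intro p s
    simp only [hF, add_assoc, ← add_smul]
    exact lintegral_add_left_eq_self (fun t : ℝ =>
      X.indicator (fun x => f (x, p.2)) (p.1 + t • (p.2 : Space n))) s
  have h1 : ∀ᵐ p ∂phaseMeasure X, F p ≤ L := by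
    have h2 : ∀ᵐ p ∂incomingMeasure X, F p ≤ L := by
      filter_upwards [h, hX.ae_incoming] with p hp hpI
      refine le_trans (le_of_eq ?_) hp
      exact hX.lintegral_line_indicator (x := p.1) (v := p.2) hpI (fun x => f (x, p.2))
    filter_upwards [hX.ae_phase_entryPoint hn h2] with p hp
    have h3 := hFt (entryPoint X p.1 p.2, p.2) (chordLength X p.1 (-p.2))
    simp only [entryPoint_add] at h3
    rw [← h3] at hp
    exact hp
  -- `F` only depends on the line, so one good point of a characteristic suffices
  have h2 := (measurePreserving_reverse X).quasiMeasurePreserving.ae h1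
  filter_upwards [hX.ae_incoming_of_ae_phase hn h2, hX.ae_incoming] with p hp hpI
  have hτ := hX.exitTime_pos (x := p.1) (v := p.2) hpI
  have hpos : volume (Ioo 0 (exitTime X p.1 p.2)) ≠ 0 := by
    rw [Real.volume_Ioo, sub_zero, Ne, ENNReal.ofReal_eq_zero, not_le]
    exact hτ
  obtain ⟨t, ht, htL⟩ := (((frequently_ae_mem_iff).2 hpos).and_eventually hp).exists
  have h3 := htL ht
  refine le_trans (le_of_eq ?_) h3
  rw [← hX.lintegral_line_indicator (x := p.1) (v := p.2) hpI (fun x => f (x, -p.2))]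
  have h4 : ∀ s : ℝ, p.1 + t • (p.2 : Space n) + s • ((-p.2 : Dir n) : Space n) =
      p.1 + (t - s) • (p.2 : Space n) := by
    intro s
    rw [show ((-p.2 : Dir n) : Space n) = -(p.2 : Space n) from rfl, smul_neg, sub_smul]
    abel
  simp only [hF, h4]
  exact (lintegral_sub_left_eq_self (fun s : ℝ =>
    X.indicator (fun x => f (x, -p.2)) (p.1 + s • (p.2 : Space n))) t).symm

/-- The attenuation ahead of the point of phase space `p`, on its line, minus the attenuation behind
it. -/
def Coeffs.imbalance (c : Coeffs n) (p : Space n × Dir n) : ℝ :=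
  lineImbalance (c.alongLine p.1 p.2) 0

namespace Coeffs.IsRegular

theorem imbalance_line (x : Space n) (v : Dir n) (t : ℝ) :
    c.imbalance (x + t • (v : Space n), v) = lineImbalance (c.alongLine x v) t := by
  rw [Coeffs.imbalance, lineImbalance, lineImbalance, lineDepth_translate, add_zero]
  congr 1
  simp only [Coeffs.alongLine, add_assoc, ← add_smul]
  exact integral_add_left_eq_self (fun s => c.sigma (x + s • (v : Space n)) v) t

variable (hc : c.IsRegular X M) (hX : IsConvexDomain X) (hn : 1 ≤ n)

include hc hX hn in
/-- For symmetric coefficients, the beam running backwards is attenuated by what lies ahead. -/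
theorem ae_transmission_neg_line (hs : c.Symmetric X) :
    ∀ᵐ p ∂incomingMeasure X, ∀ t : ℝ, c.transmission (p.1 + t • (p.2 : Space n), -p.2) =
      Real.exp (-((∫ s, c.alongLine p.1 p.2 s) - lineDepth (c.alongLine p.1 p.2) t)) := by
  filter_upwards [hX.ae_incoming_of_ae_phase hn hs.sigma_neg, hX.ae_incoming] with p hp hpI t
  set a := c.alongLine p.1 p.2 with ha
  set f : ℝ → ℝ := fun r => c.sigma (p.1 + r • (p.2 : Space n)) (-p.2) with hf
  have hfa : f =ᵐ[volume] a := by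
    filter_upwards [hp] with r hr
    by_cases h : r ∈ Ioo 0 (exitTime X p.1 p.2)
    · exact (hr h).symm
    · have h' : p.1 + r • (p.2 : Space n) ∉ X := fun h'' =>
        h ((hX.mem_iff_of_incoming (x := p.1) (v := p.2) hpI r).1 h'')
      rw [hf, ha, Coeffs.alongLine]
      simp only
      rw [hc.sigma_eq_zero _ _ h', hc.sigma_eq_zero _ _ h']
  rw [Coeffs.transmission]
  congr 2
  have h1 : ∀ s, c.alongLine (p.1 + t • (p.2 : Space n)) (-p.2) s = f (t - s) := by
    intro s
    rw [Coeffs.alongLine, show ((-p.2 : Dir n) : Space n) = -(p.2 : Space n) from rfl, smul_neg]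
    simp only [hf, sub_smul]
    congr 1
    abel
  calc lineDepth (c.alongLine (p.1 + t • (p.2 : Space n)) (-p.2)) 0
      = ∫ s, (Ici t).indicator f (t - s) := by
        rw [lineDepth, ← integral_indicator measurableSet_Iic]
        refine integral_congr_ae (.of_forall fun s => ?_)
        by_cases h : s ≤ 0
        · simp only
          rw [indicator_of_mem (mem_Iic.2 h), indicator_of_mem (by simpa using h), h1]
        · simp only
          rw [indicator_of_notMem (by simpa using h), indicator_of_notMem (by simpa using h)]
    _ = ∫ s in Ici t, f s := by
        rw [integral_sub_left_eq_self (fun s => (Ici t).indicator f s),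
          integral_indicator measurableSet_Ici]
    _ = ∫ s in Ioi t, a s := by
        rw [integral_Ici_eq_integral_Ioi]
        exact integral_congr_ae (ae_restrict_of_ae hfa)
    _ = _ := by
        have h2 := intervalIntegral.integral_Iic_add_Ioi
          (hc.integrable_alongLine hX p.1 p.2).integrableOn
          (hc.integrable_alongLine hX p.1 p.2).integrableOn (b := t)
        rw [← h2, lineDepth]
        ring

end Coeffs.IsRegular

variable {A A' : L1In X →L[ℝ] L1Space X}

/-- On almost every characteristic, the albedo operator determines the imbalance and the absorption
stably. -/
theorem ae_characteristic_stability (hc : c.IsRegular X M) (hc' : c'.IsRegular X M)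
    (hX : IsConvexDomain X) (hn : 2 ≤ n) (hσ₀ : 0 < σ₀) (hδ₀ : 0 < δ₀)
    (hσ : ∀ᵐ p ∂phaseMeasure X, σ₀ ≤ c.sigmaA p.1 p.2)
    (hσ' : ∀ᵐ p ∂phaseMeasure X, σ₀ ≤ c'.sigmaA p.1 p.2)
    (hs : c.Symmetric X) (hs' : c'.Symmetric X) (hagree : AgreeNearBoundary X δ₀ c c')
    (hA : IsAlbedoOperator X c A) (hA' : IsAlbedoOperator X c' A') :
    ∀ᵐ p ∂incomingMeasure X,
      ∫⁻ t in Ioo 0 (exitTime X p.1 p.2), ‖c.imbalance (p.1 + t • (p.2 : Space n), p.2) -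
        c'.imbalance (p.1 + t • (p.2 : Space n), p.2)‖ₑ ≤
          ENNReal.ofReal (2 * ‖A - A'‖ / (σ₀ * Real.exp (-(M * chordBound X)))) ∧
      ∫⁻ t in Ioo 0 (exitTime X p.1 p.2), ‖c.sigmaA (p.1 + t • (p.2 : Space n)) p.2 -
        c'.sigmaA (p.1 + t • (p.2 : Space n)) p.2‖ₑ ≤
          ENNReal.ofReal (M * (1 + chordBound X / δ₀) /
            (σ₀ * Real.exp (-(M * chordBound X))) * ‖A - A'‖) := by
  have hn1 : 1 ≤ n := by omega
  have hmem : ∀ {c : Coeffs n}, c.IsRegular X M →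
      (∀ᵐ p ∂phaseMeasure X, σ₀ ≤ c.sigmaA p.1 p.2) →
      ∀ᵐ p ∂phaseMeasure X, c.sigmaA p.1 p.2 ∈ Icc σ₀ M := by
    intro c hc hσ
    filter_upwards [hσ] with p hp
    refine ⟨hp, ?_⟩
    have h1 := hc.sigmaS_nonneg p.1 p.2
    have h2 := hc.sigma_le p.1 p.2
    rw [Coeffs.sigmaA]
    linarith
  have hD := ae_lintegral_ballisticDensity_sub_le hc hc' hX hn hσ₀ hσ hσ' hA hA'
  have hD' := hX.ae_lintegral_reverse hn1
    (f := fun p => ‖c.ballisticDensity p - c'.ballisticDensity p‖ₑ) hD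
  have hsm : ∀ (c : Coeffs n), c.IsRegular X M → ∀ p : Space n × Dir n,
      Measurable fun t : ℝ => c.sigmaA (p.1 + t • (p.2 : Space n)) p.2 := by
    intro c hc p
    have := hc.measurable_sigmaA.comp ((measurable_advect_line p.1 p.2).prodMk
      (measurable_const (a := p.2)))
    exact this
  filter_upwards [hD, hD', hX.ae_incoming, hc.ae_transmission_neg_line hX hn1 hs,
    hc'.ae_transmission_neg_line hX hn1 hs', hX.ae_incoming_of_ae_phase hn1 hs.sigmaA_neg,
    hX.ae_incoming_of_ae_phase hn1 hs'.sigmaA_neg, hX.ae_incoming_of_ae_phase hn1 (hmem hc hσ),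
    hX.ae_incoming_of_ae_phase hn1 (hmem hc' hσ'), hX.ae_incoming_of_ae_phase hn1 hagree]
    with p h1 h2 hpI h3 h4 h5 h6 h7 h8 h9
  have hτ := hX.exitTime_pos (x := p.1) (v := p.2) hpI
  have hτd := hX.exitTime_le (x := p.1) (v := p.2) hX.dist_le_chordBound hpI
  have h0 : ∀ {c : Coeffs n}, c.IsRegular X M → ∀ t ∉ Ioo 0 (exitTime X p.1 p.2),
      c.alongLine p.1 p.2 t = 0 := fun hc t ht => hc.sigma_eq_zero _ _ fun h =>
    ht ((hX.mem_iff_of_incoming (x := p.1) (v := p.2) hpI t).1 h)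
  simp only [Coeffs.IsRegular.imbalance_line]
  refine line_stability (hc.integrable_alongLine hX p.1 p.2)
    (hc'.integrable_alongLine hX p.1 p.2) (h0 hc) (h0 hc') (fun t => hc.sigma_nonneg _ _)
    (fun t => hc'.sigma_nonneg _ _) (fun t => hc.sigma_le _ _) (fun t => hc'.sigma_le _ _)
    hτ.le hτd hσ₀ hδ₀ (norm_nonneg _) ?_ (hsm c hc p) (hsm c' hc' p) h7 h8 ?_ ?_
  · filter_upwards [h9] with t ht htδ
    by_cases h : t ∈ Ioo 0 (exitTime X p.1 p.2)
    · refine ht h ?_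
      refine (infDist_le_dist_of_mem (y := p.1) hpI.1).trans_lt ?_
      rw [dist_eq_norm, add_sub_cancel_left, norm_smul, norm_dir, mul_one, Real.norm_eq_abs,
        abs_of_pos h.1]
      exact htδ
    · rw [h0 hc t h, h0 hc' t h]
  · refine le_trans (le_of_eq ?_) h1
    refine lintegral_congr fun t => ?_
    rw [Coeffs.ballisticDensity, Coeffs.ballisticDensity, Coeffs.IsRegular.transmission_line,
      Coeffs.IsRegular.transmission_line]
  · refine le_trans (le_of_eq ?_) h2
    refine lintegral_congr_ae ?_
    filter_upwards [ae_restrict_of_ae h5, ae_restrict_of_ae h6, ae_restrict_mem measurableSet_Ioo]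
      with t e1 e2 ht
    rw [Coeffs.ballisticDensity, Coeffs.ballisticDensity, h3, h4, e1 ht, e2 ht]

end Reversal

/-! ### From characteristics to directions -/

section Directions

variable {n : ℕ} {X : Set (Space n)}

theorem IsConvexDomain.incomingMeasure_preimage_snd_le (hX : IsConvexDomain X) (hn : 1 ≤ n)
    {V : Set (Dir n)} (hV : MeasurableSet V) :
    incomingMeasure X (Prod.snd ⁻¹' V) ≤ boundaryMeasure X univ * dirMeasure n V := by
  have := hX.isFiniteMeasure_boundaryMeasure hn
  have hI := hX.measurableSet_incoming
  rw [incomingMeasure, withDensity_apply _ (measurable_snd hV)]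
  calc _ ≤ ∫⁻ _ in Prod.snd ⁻¹' V, 1
        ∂((boundaryMeasure X).prod (dirMeasure n)).restrict (incoming X) := by
        refine lintegral_mono_ae (ae_restrict_of_ae ?_)
        filter_upwards [ae_restrict_mem hI] with p hp
        refine ENNReal.ofReal_le_one.2 ((abs_real_inner_le_norm _ _).trans ?_)
        rw [norm_dir, hX.norm_outerNormal hp.1, one_mul]
    _ ≤ ((boundaryMeasure X).prod (dirMeasure n)) (Prod.snd ⁻¹' V) := by
        rw [setLIntegral_one]
        exact Measure.restrict_apply_le _ _
    _ = _ := by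
        rw [← univ_prod, Measure.prod_prod]

/-- A bound for the integrals of `f` over almost all characteristics is, up to the area of the
boundary, a bound for its integrals over `X` for almost all directions. -/
theorem IsConvexDomain.ae_dir_lintegral_le (hX : IsConvexDomain X) (hn : 1 ≤ n)
    {f : Space n × Dir n → ℝ≥0∞} (hf : Measurable f) {L : ℝ≥0∞}
    (h : ∀ᵐ p ∂incomingMeasure X, ∫⁻ t in Ioo 0 (exitTime X p.1 p.2),
      f (p.1 + t • (p.2 : Space n), p.2) ≤ L) :
    ∀ᵐ v ∂dirMeasure n, ∫⁻ x in X, f (x, v) ≤ L * boundaryMeasure X univ := by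
  refine ae_le_of_forall_setLIntegral_le_of_sigmaFinite (g := fun _ => L * boundaryMeasure X univ)
    (hf.lintegral_prod_left' (μ := spaceMeasure X)) fun V hV _ => ?_
  have hVm : MeasurableSet (Prod.snd ⁻¹' V : Set (Space n × Dir n)) := measurable_snd hV
  calc ∫⁻ v in V, (∫⁻ x in X, f (x, v)) ∂dirMeasure n
      = ∫⁻ p, (Prod.snd ⁻¹' V).indicator f p ∂phaseMeasure X := by
        rw [phaseMeasure, lintegral_prod_symm _ (hf.indicator hVm).aemeasurable,
          ← lintegral_indicator hV]
        refine lintegral_congr fun v => ?_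
        by_cases hv : v ∈ V
        · rw [indicator_of_mem hv]
          refine lintegral_congr fun x => ?_
          rw [indicator_of_mem (show (x, v) ∈ Prod.snd ⁻¹' V from hv)]
        · rw [indicator_of_notMem hv]
          refine (lintegral_zero.symm).trans (lintegral_congr fun x => ?_)
          rw [indicator_of_notMem (show (x, v) ∉ Prod.snd ⁻¹' V from hv)]
    _ = ∫⁻ p, (∫⁻ t in Ioo 0 (exitTime X p.1 p.2), (Prod.snd ⁻¹' V).indicator f
          (p.1 + t • (p.2 : Space n), p.2)) ∂incomingMeasure X :=
        hX.lintegral_phaseMeasure hn (hf.indicator hVm)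
    _ ≤ ∫⁻ p, (Prod.snd ⁻¹' V).indicator (fun _ => L) p ∂incomingMeasure X := by
        refine lintegral_mono_ae ?_
        filter_upwards [h] with p hp
        by_cases hv : p.2 ∈ V
        · rw [indicator_of_mem (show p ∈ Prod.snd ⁻¹' V from hv)]
          refine le_trans (le_of_eq (lintegral_congr fun t => ?_)) hp
          exact indicator_of_mem
            (show (p.1 + t • (p.2 : Space n), p.2) ∈ Prod.snd ⁻¹' V from hv) f
        · rw [indicator_of_notMem (show p ∉ Prod.snd ⁻¹' V from hv)]
          refine le_of_eq (Eq.trans (lintegral_congr fun t => ?_) lintegral_zero)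
          exact indicator_of_notMem
            (show (p.1 + t • (p.2 : Space n), p.2) ∉ Prod.snd ⁻¹' V from hv) f
    _ ≤ L * (boundaryMeasure X univ * dirMeasure n V) := by
        rw [lintegral_indicator_const hVm]
        gcongr
        exact hX.incomingMeasure_preimage_snd_le hn hV
    _ = _ := by rw [setLIntegral_const, mul_assoc]

end Directions

/-! ### The negative Sobolev norm -/

section NegSobolev

variable {n : ℕ} {X : Set (Space n)}

/-- `1` for positive `s`, `-1` otherwise; unlike `Real.sign` it is nonzero at `0`. -/
def sideSign (s : ℝ) : ℝ := if 0 < s then 1 else -1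

theorem measurable_sideSign : Measurable sideSign :=
  Measurable.ite measurableSet_Ioi measurable_const measurable_const

theorem abs_sideSign (s : ℝ) : |sideSign s| = 1 := by
  rw [sideSign]; split_ifs <;> simp

theorem integral_sideSign_mul {f : ℝ → ℝ} (hf : Integrable f) :
    ∫ s, sideSign s * f s = (∫ s in Ioi 0, f s) - ∫ s in Iic 0, f s := by
  have h1 : Integrable fun s => sideSign s * f s :=
    hf.bdd_mul measurable_sideSign.aestronglyMeasurable
      (.of_forall fun s => (abs_sideSign s).le)
  rw [← intervalIntegral.integral_Iic_add_Ioi h1.integrableOn h1.integrableOn (b := 0),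
    add_comm, sub_eq_add_neg, ← integral_neg]
  congr 1
  · refine setIntegral_congr_fun measurableSet_Ioi fun s hs => ?_
    simp only [sideSign, if_pos (mem_Ioi.1 hs), one_mul]
  · refine setIntegral_congr_fun measurableSet_Iic fun s hs => ?_
    simp only [sideSign, if_neg (not_lt.2 (mem_Iic.1 hs)), neg_one_mul]

/-- A test function is recovered from its derivative along a line, by integration from both
ends. -/
theorem integral_sideSign_mul_fderiv {ψ : Space n → ℝ} (hψ : ContDiff ℝ 1 ψ)
    (hψc : HasCompactSupport ψ) (x : Space n) (v : Dir n) :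
    ∫ s, sideSign s * fderiv ℝ ψ (x - s • (v : Space n)) v = 2 * ψ x := by
  set h : ℝ → ℝ := fun s => ψ (x - s • (v : Space n)) with hh
  have hh1 : ContDiff ℝ 1 h := hψ.comp (by fun_prop)
  have hemb : IsClosedEmbedding fun s : ℝ => x - s • (v : Space n) := by
    refine Isometry.isClosedEmbedding (Isometry.of_dist_eq fun s t => ?_)
    rw [dist_sub_left, dist_eq_norm, ← sub_smul, norm_smul, norm_dir, mul_one, dist_eq_norm]
  have hhc : HasCompactSupport h := hψc.comp_isClosedEmbedding hemb
  have hderiv : ∀ s, fderiv ℝ ψ (x - s • (v : Space n)) v = -deriv h s := by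
    intro s
    have h1 : HasDerivAt (fun s : ℝ => x - s • (v : Space n)) (-(v : Space n)) s := by
      have := ((hasDerivAt_id s).smul_const (v : Space n)).const_sub x
      simpa using this
    have h2 := ((hψ.differentiable one_ne_zero) (x - s • (v : Space n))).hasFDerivAt.comp_hasDerivAt
      s h1
    have h3 : deriv h s = fderiv ℝ ψ (x - s • (v : Space n)) (-(v : Space n)) := h2.deriv
    rw [h3, map_neg, neg_neg]
  simp only [hderiv]
  have hint : Integrable (deriv h) :=
    (hh1.continuous_deriv le_rfl).integrable_of_hasCompactSupport hhc.deriv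
  have hsplit := integral_sideSign_mul (f := fun s => -deriv h s) hint.neg
  rw [hsplit]
  rw [integral_neg, integral_neg, hhc.integral_Ioi_deriv_eq hh1, hhc.integral_Iic_deriv_eq hh1]
  simp only [hh, zero_smul, sub_zero]
  ring

theorem integrable_of_bounded_support {F : Space n × ℝ → ℝ} (hF : Measurable F) {B R R' : ℝ}
    (hB : ∀ p, |F p| ≤ B) (h0 : ∀ p, F p ≠ 0 → ‖p.1‖ ≤ R ∧ |p.2| ≤ R') :
    Integrable F (volume.prod volume) := by
  have hsub : Function.support F ⊆ closedBall (0 : Space n) R ×ˢ Icc (-R') R' := by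
    intro p hp
    have := h0 p hp
    exact ⟨by simpa using this.1, abs_le.1 this.2⟩
  rw [← integrableOn_iff_integrable_of_support_subset hsub]
  refine Measure.integrableOn_of_bounded ?_ hF.aestronglyMeasurable (.of_forall hB)
  rw [Measure.prod_prod]
  exact (ENNReal.mul_lt_top measure_closedBall_lt_top measure_Icc_lt_top).ne

/-- Integration by parts along the lines of direction `v`; the integral of `q` ahead of a point
minus the integral behind it is, up to a constant on each line, minus twice a primitive of `q`. -/
theorem two_mul_integral_eq {q : Space n → ℝ} (hq : Measurable q) {M R : ℝ}
    (hqM : ∀ x, |q x| ≤ M) (hqR : ∀ x, q x ≠ 0 → ‖x‖ ≤ R) {ψ : Space n → ℝ}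
    (hψ : ContDiff ℝ 1 ψ) (hψc : HasCompactSupport ψ) (hψR : ∀ x, fderiv ℝ ψ x ≠ 0 → ‖x‖ ≤ R)
    (v : Dir n) :
    2 * ∫ x, q x * ψ x =
      ∫ x, (∫ s : ℝ, sideSign s * q (x + s • (v : Space n))) * fderiv ℝ ψ x v := by
  set D : Space n → ℝ := fun x => fderiv ℝ ψ x v with hD
  have hDc : Continuous D := (hψ.continuous_fderiv one_ne_zero).clm_apply continuous_const
  have hDs : HasCompactSupport D := (hψc.fderiv ℝ).comp_left
    (g := fun L : Space n →L[ℝ] ℝ => L v) rfl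
  obtain ⟨B, hB⟩ := hDc.bounded_above_of_compact_support hDs
  have hM0 : 0 ≤ M := (abs_nonneg _).trans (hqM 0)
  have hDR : ∀ x, D x ≠ 0 → ‖x‖ ≤ R := fun x hx => hψR x fun h => hx (by simp [hD, h])
  have hplus : Measurable fun p : Space n × ℝ => p.1 + p.2 • (v : Space n) := by fun_prop
  have hminus : Measurable fun p : Space n × ℝ => p.1 - p.2 • (v : Space n) := by fun_prop
  have hw : Measurable fun p : Space n × ℝ => sideSign p.2 :=
    measurable_sideSign.comp measurable_snd
  have hbound : ∀ (s : ℝ) (x y : Space n), |sideSign s * (q x * D y)| ≤ M * B := by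
    intro s x y
    rw [abs_mul, abs_sideSign, one_mul, abs_mul]
    exact mul_le_mul (hqM x) (hB y) (abs_nonneg _) hM0
  have hs : ∀ (x y : Space n) (s : ℝ), ‖x‖ ≤ R → ‖y‖ ≤ R → s • (v : Space n) = x - y →
      |s| ≤ 2 * R := by
    intro x y s hx hy h
    have h1 : |s| = ‖x - y‖ := by rw [← h, norm_smul, norm_dir, mul_one, Real.norm_eq_abs]
    rw [h1]
    exact (norm_sub_le _ _).trans (by linarith)
  have hF1 : Integrable (fun p : Space n × ℝ =>
      sideSign p.2 * (q (p.1 + p.2 • (v : Space n)) * D p.1)) (volume.prod volume) := by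
    refine integrable_of_bounded_support (hw.mul ((hq.comp hplus).mul
      (hDc.measurable.comp measurable_fst))) (fun p => hbound _ _ _) (R := R) (R' := 2 * R)
      fun p hp => ?_
    have h1 := hqR _ (left_ne_zero_of_mul (right_ne_zero_of_mul hp))
    have h2 := hDR _ (right_ne_zero_of_mul (right_ne_zero_of_mul hp))
    exact ⟨h2, hs _ _ _ h1 h2 (by abel)⟩
  have hF2 : Integrable (fun p : Space n × ℝ =>
      sideSign p.2 * (q p.1 * D (p.1 - p.2 • (v : Space n)))) (volume.prod volume) := by
    refine integrable_of_bounded_support (hw.mul ((hq.comp measurable_fst).mul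
      (hDc.measurable.comp hminus))) (fun p => hbound _ _ _) (R := R) (R' := 2 * R)
      fun p hp => ?_
    have h1 := hqR _ (left_ne_zero_of_mul (right_ne_zero_of_mul hp))
    have h2 := hDR _ (right_ne_zero_of_mul (right_ne_zero_of_mul hp))
    exact ⟨h1, hs _ _ _ h1 h2 (by abel)⟩
  calc 2 * ∫ x, q x * ψ x = ∫ x, ∫ s : ℝ, sideSign s * (q x * D (x - s • (v : Space n))) := by
        rw [← integral_const_mul]
        refine integral_congr_ae (.of_forall fun x => ?_)
        simp only
        rw [mul_left_comm, ← integral_sideSign_mul_fderiv hψ hψc x v, ← integral_const_mul]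
        refine integral_congr_ae (.of_forall fun s => ?_)
        simp only [hD]
        ring
    _ = ∫ s : ℝ, ∫ x, sideSign s * (q x * D (x - s • (v : Space n))) :=
        integral_integral_swap hF2
    _ = ∫ s : ℝ, ∫ x, sideSign s * (q (x + s • (v : Space n)) * D x) := by
        refine integral_congr_ae (.of_forall fun s => ?_)
        simp only
        rw [← integral_add_right_eq_self _ (s • (v : Space n))]
        simp only [add_sub_cancel_right]
    _ = ∫ x, ∫ s : ℝ, sideSign s * (q (x + s • (v : Space n)) * D x) :=
        (integral_integral_swap hF1).symm
    _ = _ := by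
        refine integral_congr_ae (.of_forall fun x => ?_)
        simp only
        rw [← integral_mul_const]
        refine integral_congr_ae (.of_forall fun s => ?_)
        simp only [hD]
        ring

/-- Functions in the unit ball of `W_0^{1,∞}` are limits of smooth test functions in `X`, with
the same bounds: they are mollified at scales smaller than the distance of the support to `∂X`. -/
theorem exists_smooth_approx (hX : IsConvexDomain X) {φ : Space n → ℝ} {G : Space n → Space n}
    (h : IsW01Infty X φ G)
    (hle : eLpNorm φ ⊤ (spaceMeasure X) + eLpNorm G ⊤ (spaceMeasure X) ≤ 1) (v : Dir n) :
    ∃ ψ : ℕ → Space n → ℝ, (∀ k, ContDiff ℝ 1 (ψ k) ∧ HasCompactSupport (ψ k) ∧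
      tsupport (ψ k) ⊆ X ∧ (∀ x, |ψ k x| ≤ 1) ∧ ∀ x, |fderiv ℝ (ψ k) x v| ≤ 1) ∧
      ∀ᵐ x, Filter.Tendsto (fun k => ψ k x) Filter.atTop (𝓝 (φ x)) := by
  have hXm := hX.isOpen.measurableSet
  have hφ1 : ∀ᵐ x ∂spaceMeasure X, ‖φ x‖ ≤ 1 := by
    have h1 : eLpNormEssSup φ (spaceMeasure X) ≤ 1 := by
      rw [← eLpNorm_exponent_top]; exact le_self_add.trans hle
    filter_upwards [ae_le_eLpNormEssSup (f := φ) (μ := spaceMeasure X)] with x hx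
    have := hx.trans h1
    rwa [← ofReal_norm, ENNReal.ofReal_le_one] at this
  have hG1 : ∀ᵐ x ∂spaceMeasure X, ‖G x‖ ≤ 1 := by
    have h1 : eLpNormEssSup G (spaceMeasure X) ≤ 1 := by
      rw [← eLpNorm_exponent_top]; exact le_add_self.trans hle
    filter_upwards [ae_le_eLpNormEssSup (f := G) (μ := spaceMeasure X)] with x hx
    have := hx.trans h1
    rwa [← ofReal_norm, ENNReal.ofReal_le_one] at this
  have hφ0 : ∀ x, x ∉ X → φ x = 0 := fun x hx =>
    image_eq_zero_of_notMem_tsupport fun h' => hx (h.tsupport_subset h')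
  have hφind : X.indicator φ = φ := indicator_eq_self.2 fun x hx => by
    by_contra h'
    exact hx (hφ0 x h')
  have hφint : Integrable φ := by
    rw [← hφind, integrable_indicator_iff hXm]
    have := hX.isFiniteMeasure_spaceMeasure
    exact h.memLp.integrable le_top
  have hφ1' : ∀ᵐ x, |φ x| ≤ 1 := by
    have h1 := (ae_restrict_iff' hXm).1 hφ1
    filter_upwards [h1] with x hx
    by_cases hxX : x ∈ X
    · exact hx hxX
    · rw [hφ0 x hxX, abs_zero]; exact zero_le_one
  have hK : IsCompact (tsupport φ) := Metric.isCompact_of_isClosed_isBounded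
    (isClosed_tsupport φ) (hX.isBounded.subset h.tsupport_subset)
  obtain ⟨ε, hε, hεX⟩ := hK.exists_cthickening_subset_open hX.isOpen h.tsupport_subset
  let ρ : ℕ → ContDiffBump (0 : Space n) := fun k =>
    ⟨ε / (2 * (k + 2)), ε / (k + 2), by positivity, by
      rw [div_lt_div_iff_of_pos_left hε (by positivity) (by positivity)]
      linarith [(Nat.cast_nonneg k : (0 : ℝ) ≤ k)]⟩
  have hrOut : ∀ k, (ρ k).rOut = ε / (k + 2) := fun k => rfl
  have hrIn : ∀ k, (ρ k).rIn = ε / (2 * (k + 2)) := fun k => rfl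
  have hrOutε : ∀ k, 2 * (ρ k).rOut ≤ ε := by
    intro k
    rw [hrOut, ← mul_div_assoc, div_le_iff₀ (by positivity)]
    nlinarith [(Nat.cast_nonneg k : (0 : ℝ) ≤ k)]
  set r : ℕ → Space n → ℝ := fun k => (ρ k).normed volume with hr
  have hrs : ∀ k, ContDiff ℝ ∞ (r k) := fun k => (ρ k).contDiff_normed
  have hrc : ∀ k, HasCompactSupport (r k) := fun k => (ρ k).hasCompactSupport_normed
  have hr0 : ∀ k x, 0 ≤ r k x := fun k x => (ρ k).nonneg_normed x
  have hr1 : ∀ k, ∫ x, r k x = 1 := fun k => (ρ k).integral_normed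
  have hrint : ∀ k, Integrable (r k) := fun k => (ρ k).integrable_normed
  have hrx : ∀ k x, Integrable fun y => r k (x - y) := fun k x => (hrint k).comp_sub_left x
  have hrx1 : ∀ k x, ∫ y, r k (x - y) = 1 := fun k x => by
    rw [integral_sub_left_eq_self (r k), hr1]
  set ψ : ℕ → Space n → ℝ := fun k =>
    convolution φ (r k) (ContinuousLinearMap.lsmul ℝ ℝ).flip volume with hψ
  have hψx : ∀ k x, ψ k x = ∫ y, r k (x - y) * φ y := fun k x => rfl
  have hsupp : ∀ k, tsupport (ψ k) ⊆ cthickening (ρ k).rOut (tsupport φ) := by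
    intro k
    refine closure_minimal (fun x hx => ?_) isClosed_cthickening
    obtain ⟨y, hy⟩ : ∃ y, r k (x - y) * φ y ≠ 0 := by
      by_contra! h'
      exact hx (by rw [hψx]; simp [h'])
    have h1 : x - y ∈ ball (0 : Space n) (ρ k).rOut := by
      rw [← (ρ k).support_normed_eq (μ := volume)]
      exact left_ne_zero_of_mul hy
    refine mem_cthickening_of_dist_le _ y _ _ (subset_tsupport _ (right_ne_zero_of_mul hy)) ?_
    rw [mem_ball_zero_iff] at h1
    rw [dist_eq_norm]
    exact h1.le
  have hrpos : ∀ k, 0 < (ρ k).rOut := fun k => (ρ k).rOut_pos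
  refine ⟨ψ, fun k => ⟨?_, ?_, ?_, ?_, ?_⟩, ?_⟩
  · exact (hrc k).contDiff_convolution_right _ hφint.locallyIntegrable
      ((hrs k).of_le (by exact_mod_cast le_top))
  · exact IsCompact.of_isClosed_subset hK.cthickening (isClosed_tsupport _) (hsupp k)
  · exact (hsupp k).trans ((cthickening_mono (by linarith [hrOutε k, hrpos k]) _).trans hεX)
  · intro x
    rw [hψx, ← Real.norm_eq_abs, ← hrx1 k x]
    refine norm_integral_le_of_norm_le (hrx k x) ?_
    filter_upwards [hφ1'] with y hy
    rw [norm_mul, Real.norm_of_nonneg (hr0 _ _)]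
    exact mul_le_of_le_one_right (hr0 _ _) hy
  · intro x
    by_cases hx : x ∈ tsupport (ψ k)
    swap
    · have h1 : fderiv ℝ (ψ k) x = 0 := by
        by_contra h2
        exact hx (support_fderiv_subset ℝ h2)
      rw [h1]
      simp
    -- the mollifier centred at `x` is a test function for the distributional gradient
    set η : Space n → ℝ := fun y => r k (x - y) with hη
    have hηs : ContDiff ℝ ∞ η := (hrs k).comp (by fun_prop)
    have hηsupp : tsupport η ⊆ closedBall x (ρ k).rOut := by
      refine closure_minimal (fun y hy => ?_) isClosed_closedBall
      have h1 : x - y ∈ ball (0 : Space n) (ρ k).rOut := by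
        rw [← (ρ k).support_normed_eq (μ := volume)]
        exact hy
      rw [mem_ball_zero_iff] at h1
      rw [mem_closedBall, dist_comm, dist_eq_norm]
      exact h1.le
    have hηX : tsupport η ⊆ X := by
      refine hηsupp.trans (Subset.trans ?_ hεX)
      refine (closedBall_subset_cthickening (hsupp k hx) _).trans ?_
      refine (cthickening_cthickening_subset (hrpos k).le (hrpos k).le _).trans ?_
      exact cthickening_mono (by linarith [hrOutε k]) _
    have hηc : HasCompactSupport η := IsCompact.of_isClosed_subset (isCompact_closedBall _ _)
      (isClosed_tsupport _) hηsupp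
    have h1 : fderiv ℝ (ψ k) x v = ∫ y, fderiv ℝ (r k) (x - y) v * φ y := by
      rw [((hrc k).hasFDerivAt_convolution_right _ hφint.locallyIntegrable
        ((hrs k).of_le (by exact_mod_cast le_top)) x).fderiv,
        convolution_precompR_apply _ hφint.locallyIntegrable ((hrc k).fderiv ℝ)
          ((hrs k).continuous_fderiv (by simp))]
      rfl
    have h2 : ∀ y, fderiv ℝ (r k) (x - y) v = -fderiv ℝ η y v := by
      intro y
      have h3 := (((hrs k).differentiable (by simp)) (x - y)).hasFDerivAt.comp y
        ((hasFDerivAt_id y).const_sub x)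
      have h4 : fderiv ℝ η y = (fderiv ℝ (r k) (x - y)).comp
        (-ContinuousLinearMap.id ℝ (Space n)) := h3.fderiv
      rw [h4]
      simp
    have h3 := h.integral_eq η hηs hηc hηX v
    have h4 : fderiv ℝ (ψ k) x v = ∫ y in X, ⟪G y, (v : Space n)⟫ * η y := by
      rw [h1, ← neg_neg (∫ y in X, ⟪G y, (v : Space n)⟫ * η y), ← h3,
        setIntegral_eq_integral_of_forall_compl_eq_zero
          (fun y hy => by rw [hφ0 y hy, zero_mul]), ← integral_neg]
      refine integral_congr_ae (.of_forall fun y => ?_)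
      simp only [h2]
      ring
    rw [h4, ← Real.norm_eq_abs]
    calc ‖∫ y in X, ⟪G y, (v : Space n)⟫ * η y‖ ≤ ∫ y in X, η y := by
          refine norm_integral_le_of_norm_le (hrx k x).integrableOn ?_
          filter_upwards [hG1] with y hy
          rw [norm_mul, Real.norm_of_nonneg (hr0 k (x - y))]
          refine mul_le_of_le_one_left (hr0 _ _) ((norm_inner_le_norm _ _).trans ?_)
          rw [norm_dir, mul_one]
          exact hy
      _ ≤ ∫ y, η y := setIntegral_le_integral (hrx k x) (.of_forall fun y => hr0 _ _)
      _ = 1 := hrx1 k x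
  · have h1 := ContDiffBump.ae_convolution_tendsto_right_of_locallyIntegrable (φ := ρ)
      (l := Filter.atTop) (K := 2) (μ := volume) (g := φ) ?_ (.of_forall fun k => ?_)
      hφint.locallyIntegrable
    · filter_upwards [h1] with x hx
      refine hx.congr fun k => ?_
      exact congrFun (convolution_flip (ContinuousLinearMap.lsmul ℝ ℝ)).symm x
    · simp only [hrOut]
      exact Filter.Tendsto.div_atTop tendsto_const_nhds
        (Filter.tendsto_atTop_add_const_right _ _ tendsto_natCast_atTop_atTop)
    · rw [hrOut, hrIn]
      refine le_of_eq ?_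
      field_simp

end NegSobolev

/-! ### Uniqueness and stability -/

section Conclusion

variable {n : ℕ} {X : Set (Space n)} {M σ₀ δ₀ : ℝ} {c c' : Coeffs n}

theorem Coeffs.measurable_imbalance
    (hm : Measurable fun p : Space n × Dir n => c.sigma p.1 p.2) : Measurable c.imbalance := by
  have h1 := (c.measurable_alongLine hm).stronglyMeasurable.integral_prod_right' (ν := volume)
  have h2 := (c.measurable_alongLine hm).stronglyMeasurable.integral_prod_right'
    (ν := volume.restrict (Iic (0 : ℝ)))
  have h3 := h1.measurable.sub (h2.measurable.const_mul 2)
  exact h3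

namespace Coeffs.IsRegular

theorem imbalance_eq_integral (hc : c.IsRegular X M) (hX : IsConvexDomain X) (x : Space n)
    (v : Dir n) : c.imbalance (x, v) = ∫ s : ℝ, sideSign s * c.sigma (x + s • (v : Space n)) v := by
  have hint := hc.integrable_alongLine hX x v
  have h1 := integral_sideSign_mul hint
  have h2 := intervalIntegral.integral_Iic_add_Ioi hint.integrableOn hint.integrableOn (b := 0)
  simp only [Coeffs.alongLine] at h1 h2
  rw [h1, Coeffs.imbalance, lineImbalance, lineDepth]
  simp only [Coeffs.alongLine]
  rw [← h2]
  ring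

theorem imbalance_sub_eq_integral (hc : c.IsRegular X M) (hc' : c'.IsRegular X M)
    (hX : IsConvexDomain X) (x : Space n) (v : Dir n) :
    c.imbalance (x, v) - c'.imbalance (x, v) = ∫ s : ℝ, sideSign s *
      (c.sigma (x + s • (v : Space n)) v - c'.sigma (x + s • (v : Space n)) v) := by
  have hint : ∀ {c : Coeffs n}, c.IsRegular X M →
      Integrable fun s : ℝ => sideSign s * c.sigma (x + s • (v : Space n)) v := fun hc =>
    (hc.integrable_alongLine hX x v).bdd_mul measurable_sideSign.aestronglyMeasurable
      (.of_forall fun s => (abs_sideSign s).le)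
  rw [hc.imbalance_eq_integral hX, hc'.imbalance_eq_integral hX,
    ← integral_sub (hint hc) (hint hc')]
  simp only [mul_sub]

end Coeffs.IsRegular

/-- The imbalance is minus twice a primitive of the attenuation in the direction `v`, up to a
constant on each line, so that its `L¹` norm controls the `W^{-1,1}` norm of the attenuation. -/
theorem negSobolevNorm_sigma_sub_le (hc : c.IsRegular X M) (hc' : c'.IsRegular X M)
    (hX : IsConvexDomain X) (v : Dir n) :
    negSobolevNorm X (fun x => c.sigma x v - c'.sigma x v) ≤
      ∫⁻ x in X, ‖c.imbalance (x, v) - c'.imbalance (x, v)‖ₑ := by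
  have hXm := hX.isOpen.measurableSet
  have hfin := hX.isFiniteMeasure_spaceMeasure
  set q : Space n → ℝ := fun x => c.sigma x v - c'.sigma x v with hq
  have hqm : Measurable q := by
    have h1 := hc.measurable_sigma.comp (measurable_prodMk_right (y := v))
    have h2 := hc'.measurable_sigma.comp (measurable_prodMk_right (y := v))
    exact h1.sub h2
  have hqM : ∀ x, |q x| ≤ M := fun x => abs_le.2
    ⟨by linarith [hc.sigma_nonneg x v, hc'.sigma_le x v],
      by linarith [hc'.sigma_nonneg x v, hc.sigma_le x v]⟩
  have hq0 : ∀ x, x ∉ X → q x = 0 := fun x hx => by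
    simp only [hq, hc.sigma_eq_zero x v hx, hc'.sigma_eq_zero x v hx, sub_zero]
  obtain ⟨R, hR⟩ := hX.isBounded.exists_norm_le
  have hqR : ∀ x, q x ≠ 0 → ‖x‖ ≤ R := fun x hx => hR x (by_contra fun h => hx (hq0 x h))
  refine iSup_le fun φ => iSup_le fun G => iSup_le fun h => iSup_le fun hle => ?_
  obtain ⟨ψ, hψ, hlim⟩ := exists_smooth_approx hX h hle v
  have hbound : ∀ k, ‖∫ x in X, q x * ψ k x‖ₑ ≤
      ∫⁻ x in X, ‖c.imbalance (x, v) - c'.imbalance (x, v)‖ₑ := by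
    intro k
    obtain ⟨h1, h2, h3, -, h5⟩ := hψ k
    have hD0 : ∀ x, x ∉ X → fderiv ℝ (ψ k) x = 0 := fun x hx =>
      by_contra fun h' => hx (h3 (support_fderiv_subset ℝ h'))
    have h6 := two_mul_integral_eq hqm hqM hqR h1 h2
      (fun x hx => hR x (by_contra fun h' => hx (hD0 x h'))) v
    rw [setIntegral_eq_integral_of_forall_compl_eq_zero
      (fun x hx => by rw [hq0 x hx, zero_mul])]
    calc ‖∫ x, q x * ψ k x‖ₑ ≤ ‖2 * ∫ x, q x * ψ k x‖ₑ := by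
          rw [enorm_le_iff_norm_le, norm_mul, Real.norm_ofNat]
          linarith [norm_nonneg (∫ x, q x * ψ k x)]
      _ ≤ ∫⁻ x, ‖(∫ s : ℝ, sideSign s * q (x + s • (v : Space n))) *
            fderiv ℝ (ψ k) x v‖ₑ := by
          rw [h6]
          exact enorm_integral_le_lintegral_enorm _
      _ ≤ ∫⁻ x, X.indicator (fun x => ‖c.imbalance (x, v) - c'.imbalance (x, v)‖ₑ) x := by
          refine lintegral_mono fun x => ?_
          by_cases hx : x ∈ X
          · rw [indicator_of_mem hx, hc.imbalance_sub_eq_integral hc' hX, enorm_mul]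
            refine mul_le_of_le_one_right' ?_
            rw [← ofReal_norm, ENNReal.ofReal_le_one]
            exact h5 x
          · rw [hD0 x hx]
            simp
      _ = _ := lintegral_indicator hXm _
  refine le_of_tendsto' (Filter.Tendsto.enorm
    (tendsto_integral_of_dominated_convergence (fun _ => M) (fun k => ?_) ?_ (fun k => ?_) ?_))
    hbound
  · exact (hqm.mul (hψ k).1.continuous.measurable).aestronglyMeasurable
  · exact integrable_const (μ := spaceMeasure X) M
  · refine .of_forall fun x => ?_
    rw [norm_mul]
    exact (mul_le_of_le_one_right (norm_nonneg _) ((hψ k).2.2.2.1 x)).trans (hqM x)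
  · exact ae_restrict_of_ae (hlim.mono fun x hx => hx.const_mul _)

theorem Coeffs.AEEq.negSobolevNorm_sigma_sub {d d' : Coeffs n} (h : c.AEEq X d)
    (h' : c'.AEEq X d') : ∀ᵐ v ∂dirMeasure n,
      negSobolevNorm X (fun x => c.sigma x v - c'.sigma x v) =
        negSobolevNorm X (fun x => d.sigma x v - d'.sigma x v) := by
  have h1 := Measure.ae_ae_of_ae_prod (Measure.measurePreserving_swap.quasiMeasurePreserving.ae
    (h.sigma.and h'.sigma))
  filter_upwards [h1] with v hv
  refine iSup_congr fun φ => iSup_congr fun G => iSup_congr fun _ => iSup_congr fun _ => ?_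
  refine congrArg _ (integral_congr_ae (hv.mono fun x hx => ?_))
  simp only [Prod.fst_swap, Prod.snd_swap] at hx
  simp only [hx.1, hx.2]

theorem Coeffs.AEEq.lintegral_sigmaA_sub {d d' : Coeffs n} (h : c.AEEq X d)
    (h' : c'.AEEq X d') : ∀ᵐ v ∂dirMeasure n,
      ∫⁻ x in X, ‖c.sigmaA x v - c'.sigmaA x v‖ₑ = ∫⁻ x in X, ‖d.sigmaA x v - d'.sigmaA x v‖ₑ := by
  have h1 := Measure.ae_ae_of_ae_prod (Measure.measurePreserving_swap.quasiMeasurePreserving.ae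
    (h.sigmaA.and h'.sigmaA))
  filter_upwards [h1] with v hv
  refine lintegral_congr_ae (hv.mono fun x hx => ?_)
  simp only [Prod.fst_swap, Prod.snd_swap] at hx
  simp only [hx.1, hx.2]

variable {A A' : L1In X →L[ℝ] L1Space X}

theorem normLinfty_add_le_of_isRegular (hc : c.IsRegular X M) (hc' : c'.IsRegular X M)
    (hX : IsConvexDomain X) (hn : 2 ≤ n) (hσ₀ : 0 < σ₀) (hδ₀ : 0 < δ₀)
    (hσ : ∀ᵐ p ∂phaseMeasure X, σ₀ ≤ c.sigmaA p.1 p.2)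
    (hσ' : ∀ᵐ p ∂phaseMeasure X, σ₀ ≤ c'.sigmaA p.1 p.2)
    (hs : c.Symmetric X) (hs' : c'.Symmetric X) (hagree : AgreeNearBoundary X δ₀ c c')
    (hA : IsAlbedoOperator X c A) (hA' : IsAlbedoOperator X c' A') :
    normLinftyNegSobolev X (fun x v => c.sigma x v - c'.sigma x v) +
      normLinftyL1 X (fun x v => c.sigmaA x v - c'.sigmaA x v) ≤
    ENNReal.ofReal ((2 + M * (1 + chordBound X / δ₀)) / (σ₀ * Real.exp (-(M * chordBound X))) *
      (boundaryMeasure X univ).toReal * ‖A - A'‖) := by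
  have hn1 : 1 ≤ n := by omega
  have hfin := hX.isFiniteMeasure_boundaryMeasure hn1
  have hM : 0 ≤ M := (hc.sigma_nonneg 0 ⟨EuclideanSpace.single ⟨0, hn1⟩ 1, by simp⟩).trans
    (hc.sigma_le _ _)
  have hd := chordBound_pos X
  have hst := ae_characteristic_stability hc hc' hX hn hσ₀ hδ₀ hσ hσ' hs hs' hagree hA hA'
  have hs1 : Measurable fun p : Space n × Dir n => ‖c.imbalance p - c'.imbalance p‖ₑ :=
    ((c.measurable_imbalance hc.measurable_sigma).sub
      (c'.measurable_imbalance hc'.measurable_sigma)).enorm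
  have hs2 : Measurable fun p : Space n × Dir n => ‖c.sigmaA p.1 p.2 - c'.sigmaA p.1 p.2‖ₑ :=
    (hc.measurable_sigmaA.sub hc'.measurable_sigmaA).enorm
  have h1 := hX.ae_dir_lintegral_le hn1 hs1 (hst.mono fun p hp => hp.1)
  have h2 := hX.ae_dir_lintegral_le hn1 hs2 (hst.mono fun p hp => hp.2)
  have h3 : normLinftyNegSobolev X (fun x v => c.sigma x v - c'.sigma x v) ≤ _ :=
    essSup_le_of_ae_le _ (h1.mono fun v hv => (negSobolevNorm_sigma_sub_le hc hc' hX v).trans hv)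
  have h4 : normLinftyL1 X (fun x v => c.sigmaA x v - c'.sigmaA x v) ≤ _ :=
    essSup_le_of_ae_le _ h2
  refine (add_le_add h3 h4).trans (le_of_eq ?_)
  rw [← add_mul, ← ENNReal.ofReal_add (by positivity) (by positivity),
    ← ENNReal.ofReal_toReal (measure_ne_top (boundaryMeasure X) univ),
    ← ENNReal.ofReal_mul (by positivity), ENNReal.toReal_ofReal ENNReal.toReal_nonneg]
  congr 1
  ring

/-- The attenuation on an interval is determined by the imbalance, whose derivative is `-2 a`. -/
theorem ae_eq_of_lineImbalance {a a' : ℝ → ℝ} {M τ : ℝ} (ha : Integrable a) (ha' : Integrable a')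
    (h0 : ∀ t, 0 ≤ a t) (h0' : ∀ t, 0 ≤ a' t) (hM : ∀ t, a t ≤ M) (hM' : ∀ t, a' t ≤ M)
    (h : ∀ᵐ t, t ∈ Ioo 0 τ → lineImbalance a t = lineImbalance a' t) :
    ∀ᵐ t, t ∈ Ioo 0 τ → a t = a' t := by
  have hcont : Continuous (lineImbalance a) := continuous_const.sub
    (continuous_const.mul (lipschitzWith_lineDepth ha h0 hM).continuous)
  have hcont' : Continuous (lineImbalance a') := continuous_const.sub
    (continuous_const.mul (lipschitzWith_lineDepth ha' h0' hM').continuous)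
  have heq : EqOn (lineImbalance a) (lineImbalance a') (Ioo 0 τ) :=
    Measure.eqOn_open_of_ae_eq ((ae_restrict_iff' measurableSet_Ioo).2 h) isOpen_Ioo
      hcont.continuousOn hcont'.continuousOn
  filter_upwards [ae_hasDerivAt_lineDepth ha, ae_hasDerivAt_lineDepth ha'] with t h1 h2 ht
  have h3 : HasDerivAt (lineImbalance a) (-(2 * a t)) t := (h1.const_mul 2).const_sub _
  have h4 : HasDerivAt (lineImbalance a') (-(2 * a' t)) t := (h2.const_mul 2).const_sub _
  have h5 := h4.unique (h3.congr_of_eventuallyEq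
    (heq.symm.eventuallyEq_of_mem (isOpen_Ioo.mem_nhds ht)))
  linarith

theorem ae_eq_of_isRegular (hc : c.IsRegular X M) (hc' : c'.IsRegular X M)
    (hX : IsConvexDomain X) (hn : 2 ≤ n) (hσ₀ : 0 < σ₀) (hδ₀ : 0 < δ₀)
    (hσ : ∀ᵐ p ∂phaseMeasure X, σ₀ ≤ c.sigmaA p.1 p.2)
    (hσ' : ∀ᵐ p ∂phaseMeasure X, σ₀ ≤ c'.sigmaA p.1 p.2)
    (hs : c.Symmetric X) (hs' : c'.Symmetric X) (hagree : AgreeNearBoundary X δ₀ c c')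
    (hA : IsAlbedoOperator X c A) (hA' : IsAlbedoOperator X c' A) :
    ∀ᵐ p ∂phaseMeasure X, c.sigmaA p.1 p.2 = c'.sigmaA p.1 p.2 ∧
      c.sigma p.1 p.2 = c'.sigma p.1 p.2 := by
  have hn1 : 1 ≤ n := by omega
  have hst := ae_characteristic_stability hc hc' hX hn hσ₀ hδ₀ hσ hσ' hs hs' hagree hA hA'
  simp only [sub_self, norm_zero, mul_zero, zero_div, ENNReal.ofReal_zero, nonpos_iff_eq_zero]
    at hst
  have hline : ∀ {f : Space n × Dir n → ℝ≥0∞} (_ : Measurable f) (p : Space n × Dir n),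
      Measurable fun t : ℝ => f (p.1 + t • (p.2 : Space n), p.2) := fun hf p => by
    have := hf.comp ((measurable_advect_line p.1 p.2).prodMk (measurable_const (a := p.2)))
    exact this
  have hs1 : Measurable fun p : Space n × Dir n => ‖c.imbalance p - c'.imbalance p‖ₑ :=
    ((c.measurable_imbalance hc.measurable_sigma).sub
      (c'.measurable_imbalance hc'.measurable_sigma)).enorm
  have hs2 : Measurable fun p : Space n × Dir n => ‖c.sigmaA p.1 p.2 - c'.sigmaA p.1 p.2‖ₑ :=
    (hc.measurable_sigmaA.sub hc'.measurable_sigmaA).enorm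
  refine Filter.Eventually.and ?_ ?_
  · refine hX.ae_phase_of_ae_incoming hn1
      (measurableSet_eq_fun hc.measurable_sigmaA hc'.measurable_sigmaA).nullMeasurableSet ?_
    filter_upwards [hst] with p hp
    have h1 := (lintegral_eq_zero_iff (hline hs2 p)).1 hp.2
    filter_upwards [(ae_restrict_iff' measurableSet_Ioo).1 h1] with t ht hτ
    exact sub_eq_zero.1 (enorm_eq_zero.1 (ht hτ))
  · refine hX.ae_phase_of_ae_incoming hn1
      (measurableSet_eq_fun hc.measurable_sigma hc'.measurable_sigma).nullMeasurableSet ?_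
    filter_upwards [hst] with p hp
    have h1 := (lintegral_eq_zero_iff (hline hs1 p)).1 hp.1
    refine ae_eq_of_lineImbalance (a := c.alongLine p.1 p.2) (a' := c'.alongLine p.1 p.2)
      (hc.integrable_alongLine hX p.1 p.2)
      (hc'.integrable_alongLine hX p.1 p.2) (fun t => hc.sigma_nonneg _ _)
      (fun t => hc'.sigma_nonneg _ _) (fun t => hc.sigma_le _ _) (fun t => hc'.sigma_le _ _) ?_
    filter_upwards [(ae_restrict_iff' measurableSet_Ioo).1 h1] with t ht hτ
    rw [← Coeffs.IsRegular.imbalance_line, ← Coeffs.IsRegular.imbalance_line]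
    exact sub_eq_zero.1 (enorm_eq_zero.1 (ht hτ))

theorem Coeffs.Admissible.le_sigmaA_regularize (hc : c.Admissible X M σ₀)
    (hX : IsConvexDomain X) :
    ∀ᵐ p ∂phaseMeasure X, σ₀ ≤ (c.regularize X M).sigmaA p.1 p.2 := by
  filter_upwards [hc.le_sigmaA, (hc.aeEq_regularize hX).sigmaA] with p h1 h2
  rwa [← h2]

end Conclusion

end Photoacoustics

end

theorem theorem2p5 (n : ℕ) (hn : 2 ≤ n) (X : Set (Photoacoustics.Space n)) (hX_open : IsOpen X)
    (hX_nonempty : X.Nonempty) (hX_bounded : Bornology.IsBounded X) (hX_convex : Convex ℝ X)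
    (hX_boundary : Photoacoustics.HasC1Boundary X)
    (M σ₀ δ₀ : ℝ) (hσ₀ : 0 < σ₀) (hδ₀ : 0 < δ₀) :
    -- the albedo operator is well defined
    (∀ c : Photoacoustics.Coeffs n, c.Admissible X M σ₀ →
      ∃! A, Photoacoustics.IsAlbedoOperator X c A) ∧
    -- it determines `σ` and `σ_a`
    (∀ c c' : Photoacoustics.Coeffs n, c.Admissible X M σ₀ → c'.Admissible X M σ₀ →
      c.Symmetric X → c'.Symmetric X → Photoacoustics.AgreeNearBoundary X δ₀ c c' →
      ∀ A, Photoacoustics.IsAlbedoOperator X c A → Photoacoustics.IsAlbedoOperator X c' A →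
        ∀ᵐ p ∂(Photoacoustics.phaseMeasure X),
          c.sigmaA p.1 p.2 = c'.sigmaA p.1 p.2 ∧ c.sigma p.1 p.2 = c'.sigma p.1 p.2) ∧
    -- in a Lipschitz stable way
    ∃ C : ℝ, 0 < C ∧ ∀ c c' : Photoacoustics.Coeffs n,
      c.Admissible X M σ₀ → c'.Admissible X M σ₀ → c.Symmetric X → c'.Symmetric X →
      Photoacoustics.AgreeNearBoundary X δ₀ c c' →
      ∀ A A', Photoacoustics.IsAlbedoOperator X c A → Photoacoustics.IsAlbedoOperator X c' A' →
        Photoacoustics.normLinftyNegSobolev X (fun x v => c.sigma x v - c'.sigma x v) +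
          Photoacoustics.normLinftyL1 X (fun x v => c.sigmaA x v - c'.sigmaA x v) ≤
        ENNReal.ofReal (C * ‖A - A'‖) := by
  have hX : Photoacoustics.IsConvexDomain X :=
    ⟨hX_open, hX_nonempty, hX_bounded, hX_convex, hX_boundary⟩
  have hn1 : 1 ≤ n := by omega
  have hd := Photoacoustics.chordBound_pos X
  refine ⟨fun c hc => hc.existsUnique_isAlbedoOperator hX hn1 hσ₀, ?_, ?_⟩
  · intro c c' hc hc' hs hs' hagree A hA hA'
    have e := hc.aeEq_regularize hX
    have e' := hc'.aeEq_regularize hX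
    have h := Photoacoustics.ae_eq_of_isRegular (hc.isRegular_regularize hX.isOpen)
      (hc'.isRegular_regularize hX.isOpen) hX hn hσ₀ hδ₀ (hc.le_sigmaA_regularize hX)
      (hc'.le_sigmaA_regularize hX) (e.symmetric hs) (e'.symmetric hs') (hagree.congr e e')
      (e.isAlbedoOperator hX hn1 hA) (e'.isAlbedoOperator hX hn1 hA')
    filter_upwards [h, e.sigma, e'.sigma, e.sigmaA, e'.sigmaA] with p h0 h1 h2 h3 h4
    rw [h1, h2, h3, h4]
    exact h0
  -- `max M 0` covers negative `M`, and the summand `1` makes the constant positive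
  · refine ⟨(2 + max M 0 * (1 + Photoacoustics.chordBound X / δ₀)) /
      (σ₀ * Real.exp (-(max M 0 * Photoacoustics.chordBound X))) *
      (Photoacoustics.boundaryMeasure X univ).toReal + 1, by positivity, ?_⟩
    intro c c' hc hc' hs hs' hagree A A' hA hA'
    have e := hc.aeEq_regularize hX
    have e' := hc'.aeEq_regularize hX
    have h := Photoacoustics.normLinfty_add_le_of_isRegular (hc.isRegular_regularize hX.isOpen)
      (hc'.isRegular_regularize hX.isOpen) hX hn hσ₀ hδ₀ (hc.le_sigmaA_regularize hX)
      (hc'.le_sigmaA_regularize hX) (e.symmetric hs) (e'.symmetric hs') (hagree.congr e e')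
      (e.isAlbedoOperator hX hn1 hA) (e'.isAlbedoOperator hX hn1 hA')
    have h1 := essSup_congr_ae (e.negSobolevNorm_sigma_sub e')
    have h2 := essSup_congr_ae (e.lintegral_sigmaA_sub e')
    rw [Photoacoustics.normLinftyNegSobolev, Photoacoustics.normLinftyL1, h1, h2]
    refine h.trans (ENNReal.ofReal_le_ofReal ?_)
    gcongr
    linarith
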